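/- A state on $\mathbb{C}^d$ is a positive semidefinite matrix $\rho\in\mathbb{C}^{d\times d}$ with $\mathrm{tr}\,\rho=1$; an observable is a Hermitian matrix $O\in\mathbb{C}^{d\times d}$, and $\|O\|$ is its operator norm. A classical-shadows algorithm for dimension $d$ using $n$ copies applies a (possibly entangled and randomized) POVM to $\rho^{\otimes n}$ and stores the classical outcome $z$; the POVM does not depend on any observable. Afterwards, given an observable $O$, it outputs an estimate $\tau=\tau(O,z)\in\mathbb{R}$ that depends only on $O$ and $z$. The algorithm solves classical shadows with parameters $d,\epsilon$ with probability $p$ if for every state $\rho$ on $\mathbb{C}^d$ and every observable $O$, with probability at least $p$, \[ |\mathrm{tr}(O\rho)-\tau|\le \epsilon\,\|O\| . \] Theorem. There is a universal constant $C>0$ such that the following holds. Let $\epsilon>0$ and let $d,k$ be integers with $d\ge k\ge 100\sqrt d/\epsilon$. Suppose that some algorithm using $f$ copies solves classical shadows with parameters $k,\ 0.01\,\epsilon k/d$ with probability $0.9$. Then for every $\delta\in(0,1/2]$ there is an algorithm that solves classical shadows with parameters $d,\epsilon$ with probability $1-\delta$ and uses at most \[ C\,\bigl(f+1/\epsilon^2\bigr)\,\log(1/\delta)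 \] copies. -/

import Mathlib

open MeasureTheory
open scoped ComplexOrder

noncomputable section

namespace Shadows

/-- A (mixed) quantum state on `ℂ^ι`: a positive semidefinite matrix of trace one. -/
def IsState {ι : Type} [Fintype ι] (ρ : Matrix ι ι ℂ) : Prop :=
  ρ.PosSemidef ∧ ρ.trace = 1

/-- The operator norm `‖O‖` of a matrix acting on the Hilbert space `ℂ^d`. -/
def opNorm {d : ℕ} (O : Matrix (Fin d) (Fin d) ℂ) : ℝ :=
  ‖Matrix.toEuclideanCLM (n := Fin d) (𝕜 := ℂ) O‖

/-- `n` copies of `ρ`: the matrix of `ρ^{⊗ n}` on `(ℂ^d)^{⊗ n}`, in the product basis indexed by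
`Fin n → Fin d`. -/
def tensorPower {d : ℕ} (n : ℕ) (ρ : Matrix (Fin d) (Fin d) ℂ) :
    Matrix (Fin n → Fin d) (Fin n → Fin d) ℂ :=
  Matrix.of fun x y => ∏ i, ρ (x i) (y i)

/-- A POVM `{M_z dμ(z)}` on `ℂ^ι` with outcomes in an arbitrary measurable space `Ω`: a measurable
family of positive semidefinite matrices with `∫ M_z dμ(z) = 1` (entrywise). Since `ℂ^ι` is finite
dimensional, every positive-operator-valued measure `E` on `Ω` has this form, for instance with
`μ = tr E` and `M = dE/dμ`; discrete POVMs are the case of a counting measure. -/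
structure POVM (ι : Type) [Fintype ι] [DecidableEq ι] (Ω : Type) [MeasurableSpace Ω] where
  μ : Measure Ω
  sigmaFinite : SigmaFinite μ
  elem : Ω → Matrix ι ι ℂ
  measurable_elem : ∀ i j, Measurable fun z => elem z i j
  posSemidef_elem : ∀ z, (elem z).PosSemidef
  integrable_elem : ∀ i j, Integrable (fun z => elem z i j) μ
  integral_elem : ∀ i j, ∫ z, elem z i j ∂μ = (1 : Matrix ι ι ℂ) i j

/-- Born's rule: the law of the outcome when the state `σ` is measured,
`dP(z) = tr(M_z σ) dμ(z)`. -/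
def POVM.law {ι : Type} [Fintype ι] [DecidableEq ι] {Ω : Type} [MeasurableSpace Ω]
    (M : POVM ι Ω) (σ : Matrix ι ι ℂ) : Measure Ω :=
  M.μ.withDensity fun z => ENNReal.ofReal (M.elem z * σ).trace.re

/-- A classical-shadows algorithm on `n` copies of a `d`-dimensional state. In the measurement
phase it applies a (possibly entangled) POVM to `ρ^{⊗ n}` and stores the outcome `z : Ω`; neither
depends on the observable. In the estimation phase it answers a query `O` with `estimate O z`.
Adaptive measurements and all internal randomness (including random bits that are to be used in the
estimation phase) are part of the POVM and of its outcome. -/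
structure Algorithm (d n : ℕ) where
  Ω : Type
  mΩ : MeasurableSpace Ω
  povm : POVM (Fin n → Fin d) Ω
  estimate : Matrix (Fin d) (Fin d) ℂ → Ω → ℝ
  measurable_estimate : ∀ O : Matrix (Fin d) (Fin d) ℂ, O.IsHermitian → Measurable (estimate O)

/-- The algorithm solves classical shadows to accuracy `ε` with probability `p`: for every state
`ρ` and every observable (Hermitian matrix) `O`, with probability at least `p` the estimate `τ`
satisfies `|tr(O ρ) - τ| ≤ ε ‖O‖`. -/
def Algorithm.Solves {d n : ℕ} (A : Algorithm d n) (ε p : ℝ) : Prop :=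
  letI := A.mΩ
  ∀ ρ : Matrix (Fin d) (Fin d) ℂ, IsState ρ →
    ∀ O : Matrix (Fin d) (Fin d) ℂ, O.IsHermitian →
      ENNReal.ofReal p ≤ A.povm.law (tensorPower n ρ)
        {z | |(O * ρ).trace.re - A.estimate O z| ≤ ε * opNorm O}

end Shadows

end

noncomputable section

namespace Shadows

/-! ### Positive semidefinite matrices and tensor products -/

lemma exists_eq_conjTranspose_mul_self {ι : Type*} [Fintype ι] [DecidableEq ι]
    {A : Matrix ι ι ℂ} (hA : A.PosSemidef) : ∃ B : Matrix ι ι ℂ, A = B.conjTranspose * B := by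
  open scoped MatrixOrder Matrix.Norms.L2Operator in
  exact CStarAlgebra.nonneg_iff_eq_star_mul_self.mp hA.nonneg

lemma trace_mul_nonneg {ι : Type*} [Fintype ι] [DecidableEq ι] {A B : Matrix ι ι ℂ}
    (hA : A.PosSemidef) (hB : B.PosSemidef) : 0 ≤ (A * B).trace := by
  obtain ⟨C, rfl⟩ := exists_eq_conjTranspose_mul_self hA
  rw [Matrix.mul_assoc, Matrix.trace_mul_comm]
  exact (hB.mul_mul_conjTranspose_same C).trace_nonneg

/-- The tensor product of a finite family of matrices, in the product bases. -/
def tensorMat {ι X Y : Type*} [Fintype ι] (K : ι → Matrix X Y ℂ) : Matrix (ι → X) (ι → Y) ℂ :=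
  Matrix.of fun x y => ∏ i, K i (x i) (y i)

section tensorMat

variable {ι X Y Z R : Type*} [Fintype ι]

lemma tensorMat_mul [DecidableEq ι] [Fintype Y] (K : ι → Matrix X Y ℂ) (L : ι → Matrix Y Z ℂ) :
    tensorMat K * tensorMat L = tensorMat fun i => K i * L i := by
  ext x z
  simp only [tensorMat, Matrix.mul_apply, Matrix.of_apply, ← Finset.prod_mul_distrib]
  rw [Finset.prod_univ_sum]
  simp

lemma tensorMat_conjTranspose (K : ι → Matrix X Y ℂ) :
    (tensorMat K).conjTranspose = tensorMat fun i => (K i).conjTranspose := by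
  ext x z
  simp [tensorMat, Matrix.conjTranspose_apply]

lemma tensorMat_one [DecidableEq X] : tensorMat (fun _ : ι => (1 : Matrix X X ℂ)) = 1 := by
  classical
  ext x y
  simp only [tensorMat, Matrix.of_apply, Matrix.one_apply, funext_iff]
  rw [Finset.prod_ite_zero]
  simp

lemma trace_tensorMat [DecidableEq ι] [Fintype X] (K : ι → Matrix X X ℂ) : (tensorMat K).trace = ∏ i, (K i).trace := by
  simp only [Matrix.trace, Matrix.diag_apply, tensorMat, Matrix.of_apply]
  rw [Finset.prod_univ_sum]
  simp

lemma sum_tensorMat [DecidableEq ι] [Fintype R] (K : ι → R → Matrix X Y ℂ) :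
    ∑ r : ι → R, tensorMat (fun i => K i (r i)) = tensorMat fun i => ∑ r, K i r := by
  ext x y
  simp only [tensorMat, Matrix.of_apply, Matrix.sum_apply]
  rw [Finset.prod_univ_sum]
  simp

lemma posSemidef_tensorMat [DecidableEq ι] [Fintype X] [DecidableEq X] {K : ι → Matrix X X ℂ} (hK : ∀ i, (K i).PosSemidef) :
    (tensorMat K).PosSemidef := by
  choose B hB using fun i => exists_eq_conjTranspose_mul_self (hK i)
  have : tensorMat K = (tensorMat B).conjTranspose * tensorMat B := by
    rw [tensorMat_conjTranspose, tensorMat_mul]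
    congr 1
    funext i
    exact hB i
  rw [this]
  exact Matrix.posSemidef_conjTranspose_mul_self _

end tensorMat

lemma tensorPower_eq_tensorMat {d : ℕ} (n : ℕ) (ρ : Matrix (Fin d) (Fin d) ℂ) :
    tensorPower n ρ = tensorMat fun _ : Fin n => ρ := rfl

lemma IsState.tensorPower {d n : ℕ} {ρ : Matrix (Fin d) (Fin d) ℂ} (hρ : IsState ρ) :
    IsState (Shadows.tensorPower n ρ) := by
  refine ⟨posSemidef_tensorMat fun _ => hρ.1, ?_⟩
  rw [tensorPower_eq_tensorMat, trace_tensorMat]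
  simp [hρ.2]

/-! ### Outcome laws -/

namespace POVM

variable {ι κ : Type} [Fintype ι] [DecidableEq ι] [Fintype κ] [DecidableEq κ]
  {Ω : Type} [MeasurableSpace Ω]

lemma trace_eq_sum (M : POVM ι Ω) (σ : Matrix ι ι ℂ) (z : Ω) :
    (M.elem z * σ).trace = ∑ i, ∑ j, M.elem z i j * σ j i := by
  simp [Matrix.trace, Matrix.mul_apply]

lemma measurable_trace (M : POVM ι Ω) (σ : Matrix ι ι ℂ) :
    Measurable fun z => (M.elem z * σ).trace := by
  simp only [trace_eq_sum]
  exact Finset.measurable_sum _ fun i _ => Finset.measurable_sum _ fun j _ =>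
    (M.measurable_elem i j).mul_const _

lemma integrable_trace (M : POVM ι Ω) (σ : Matrix ι ι ℂ) :
    Integrable (fun z => (M.elem z * σ).trace) M.μ := by
  simp only [trace_eq_sum]
  exact integrable_finsetSum _ fun i _ => integrable_finsetSum _ fun j _ =>
    (M.integrable_elem i j).mul_const _

lemma integral_trace (M : POVM ι Ω) (σ : Matrix ι ι ℂ) :
    ∫ z, (M.elem z * σ).trace ∂M.μ = σ.trace := by
  simp only [trace_eq_sum]
  rw [integral_finsetSum _ fun i _ => integrable_finsetSum _ fun j _ =>
    (M.integrable_elem i j).mul_const _]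
  have : ∀ i, ∫ z, ∑ j, M.elem z i j * σ j i ∂M.μ = σ i i := by
    intro i
    rw [integral_finsetSum _ fun j _ => (M.integrable_elem i j).mul_const _]
    simp only [integral_mul_const, M.integral_elem, Matrix.one_apply]
    simp
  simp [this, Matrix.trace]

lemma measurable_density (M : POVM ι Ω) (σ : Matrix ι ι ℂ) :
    Measurable fun z => ENNReal.ofReal (M.elem z * σ).trace.re :=
  (Complex.measurable_re.comp (M.measurable_trace σ)).ennreal_ofReal

lemma law_apply (M : POVM ι Ω) (σ : Matrix ι ι ℂ) {S : Set Ω} (hS : MeasurableSet S) :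
    M.law σ S = ∫⁻ z in S, ENNReal.ofReal (M.elem z * σ).trace.re ∂M.μ :=
  withDensity_apply _ hS

lemma isProbabilityMeasure_law (M : POVM ι Ω) {σ : Matrix ι ι ℂ} (hσ : IsState σ) :
    IsProbabilityMeasure (M.law σ) := by
  refine ⟨?_⟩
  rw [law_apply _ _ MeasurableSet.univ, setLIntegral_univ,
    ← ofReal_integral_eq_lintegral_ofReal]
  · have := integral_re (𝕜 := ℂ) (M.integrable_trace σ)
    simp only [RCLike.re_eq_complex_re] at this
    rw [this, M.integral_trace, hσ.2]
    simp
  · exact (M.integrable_trace σ).re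
  · exact Filter.Eventually.of_forall fun z =>
      (Complex.nonneg_iff.mp (trace_mul_nonneg (M.posSemidef_elem z) hσ.1)).1

lemma integrable_conj {ι : Type} (M : POVM κ Ω) (K : Matrix κ ι ℂ) (i j : ι) :
    Integrable (fun z => (K.conjTranspose * M.elem z * K) i j) M.μ := by
  simp only [Matrix.mul_apply, Finset.sum_mul]
  exact integrable_finsetSum _ fun a _ => integrable_finsetSum _ fun b _ =>
    ((M.integrable_elem b a).const_mul _).mul_const _

lemma integral_conj {ι : Type} (M : POVM κ Ω) (K : Matrix κ ι ℂ) (i j : ι) :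
    ∫ z, (K.conjTranspose * M.elem z * K) i j ∂M.μ = (K.conjTranspose * K) i j := by
  simp only [Matrix.mul_apply, Finset.sum_mul]
  rw [integral_finsetSum _ fun a _ => integrable_finsetSum _ fun b _ =>
    ((M.integrable_elem b a).const_mul _).mul_const _]
  refine Finset.sum_congr rfl fun a _ => ?_
  rw [integral_finsetSum _ fun b _ => ((M.integrable_elem b a).const_mul _).mul_const _]
  simp only [integral_mul_const, integral_const_mul, M.integral_elem, Matrix.one_apply]
  simp

/-- Draw `g` uniformly from a finite set, apply the quantum channel with Kraus operators `K g`,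
and measure the POVM `M`. The outcome is recorded together with `g`. -/
def mixture {G R : Type} [Fintype G] [Nonempty G] [MeasurableSpace G]
    [MeasurableSingletonClass G] [Fintype R]
    (M : POVM κ Ω) (K : G → R → Matrix κ ι ℂ)
    (hK : ∀ g, ∑ r, (K g r).conjTranspose * K g r = 1) : POVM ι (G × Ω) :=
  have hmeas : ∀ i j, Measurable fun p : G × Ω => (((Fintype.card G : ℝ)⁻¹ : ℝ) •
      ∑ r, (K p.1 r).conjTranspose * M.elem p.2 * K p.1 r) i j := by
    intro i j
    refine measurable_from_prod_countable_right fun g => ?_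
    simp only [Matrix.smul_apply, Matrix.sum_apply, Matrix.mul_apply, Finset.sum_mul]
    have : Measurable fun z => ∑ r, ∑ a, ∑ b,
        (K g r).conjTranspose i b * M.elem z b a * K g r a j :=
      Finset.measurable_sum _ fun r _ => Finset.measurable_sum _
        fun a _ => Finset.measurable_sum _ fun b _ =>
          ((M.measurable_elem b a).const_mul _).mul_const _
    exact this.const_smul (Fintype.card G : ℝ)⁻¹
  have hint : ∀ g i j, Integrable (fun z => (((Fintype.card G : ℝ)⁻¹ : ℝ) •
      ∑ r, (K g r).conjTranspose * M.elem z * K g r) i j) M.μ := by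
    intro g i j
    simp only [Matrix.smul_apply, Matrix.sum_apply]
    exact Integrable.smul (Fintype.card G : ℝ)⁻¹
      (integrable_finsetSum Finset.univ fun r _ => M.integrable_conj (K g r) i j)
  have hint' : ∀ i j, Integrable (fun p : G × Ω => (((Fintype.card G : ℝ)⁻¹ : ℝ) •
      ∑ r, (K p.1 r).conjTranspose * M.elem p.2 * K p.1 r) i j) (Measure.count.prod M.μ) := by
    intro i j
    have := M.sigmaFinite
    rw [integrable_prod_iff (hmeas i j).aestronglyMeasurable]
    exact ⟨Filter.Eventually.of_forall fun g => hint g i j, Integrable.of_finite⟩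
  { μ := Measure.count.prod M.μ
    sigmaFinite := by
      have := M.sigmaFinite
      infer_instance
    elem := fun p => ((Fintype.card G : ℝ)⁻¹ : ℝ) •
      ∑ r, (K p.1 r).conjTranspose * M.elem p.2 * K p.1 r
    measurable_elem := hmeas
    posSemidef_elem := by
      intro p
      refine Matrix.PosSemidef.smul (Matrix.posSemidef_sum _ fun r _ => ?_) (by positivity)
      exact (M.posSemidef_elem p.2).conjTranspose_mul_mul_same _
    integrable_elem := hint'
    integral_elem := by
      intro i j
      have := M.sigmaFinite
      rw [integral_prod _ (hint' i j), integral_fintype Integrable.of_finite]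
      have key : ∀ g, ∫ z, (((Fintype.card G : ℝ)⁻¹ : ℝ) •
          ∑ r, (K g r).conjTranspose * M.elem z * K g r) i j ∂M.μ
            = ((Fintype.card G : ℝ)⁻¹ : ℝ) • (1 : Matrix ι ι ℂ) i j := by
        intro g
        simp only [Matrix.smul_apply, Matrix.sum_apply]
        rw [integral_smul, integral_finsetSum _ fun r _ => M.integrable_conj (K g r) i j]
        simp only [integral_conj]
        rw [← hK g, Matrix.sum_apply]
      have hc : ∀ g : G, (Measure.count : Measure G).real {g} = 1 := fun g => by
        simp [Measure.real]
      simp only [key, hc, one_smul, Finset.sum_const, Finset.card_univ]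
      rw [← Nat.cast_smul_eq_nsmul ℝ, smul_smul, mul_inv_cancel₀ (by simp), one_smul] }

lemma mixture_law_apply {G R : Type} [Fintype G] [Nonempty G] [MeasurableSpace G]
    [MeasurableSingletonClass G] [Fintype R]
    (M : POVM κ Ω) (K : G → R → Matrix κ ι ℂ)
    (hK : ∀ g, ∑ r, (K g r).conjTranspose * K g r = 1) (σ : Matrix ι ι ℂ)
    {S : Set (G × Ω)} (hS : MeasurableSet S) :
    (M.mixture K hK).law σ S = ENNReal.ofReal (Fintype.card G : ℝ)⁻¹ *
      ∑ g, M.law (∑ r, K g r * σ * (K g r).conjTranspose) {z | (g, z) ∈ S} := by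
  have := M.sigmaFinite
  rw [law_apply _ _ hS, ← lintegral_indicator hS]
  change ∫⁻ p, _ ∂(Measure.count.prod M.μ) = _
  rw [lintegral_prod _ (((M.mixture K hK).measurable_density σ).indicator hS).aemeasurable,
    lintegral_count, tsum_fintype, Finset.mul_sum]
  refine Finset.sum_congr rfl fun g _ => ?_
  have hSg : MeasurableSet {z | (g, z) ∈ S} := measurable_prodMk_left hS
  rw [law_apply _ _ hSg, ← lintegral_indicator hSg, ← lintegral_const_mul _
    ((M.measurable_density _).indicator hSg)]
  refine lintegral_congr fun z => ?_
  have htr : ((M.mixture K hK).elem (g, z) * σ).trace = ((Fintype.card G : ℝ)⁻¹ : ℝ) •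
      (M.elem z * ∑ r, K g r * σ * (K g r).conjTranspose).trace := by
    change ((((Fintype.card G : ℝ)⁻¹ : ℝ) •
      ∑ r, (K g r).conjTranspose * M.elem z * K g r) * σ).trace = _
    rw [Matrix.smul_mul, Matrix.trace_smul, Matrix.sum_mul, Matrix.mul_sum, Matrix.trace_sum,
      Matrix.trace_sum]
    congr 1
    refine Finset.sum_congr rfl fun r _ => ?_
    rw [Matrix.mul_assoc, Matrix.mul_assoc, Matrix.trace_mul_comm]
    simp only [Matrix.mul_assoc]
  by_cases h : (g, z) ∈ S
  · rw [Set.indicator_of_mem h, Set.indicator_of_mem (show z ∈ {z | (g, z) ∈ S} from h), htr,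
      Complex.real_smul, Complex.re_ofReal_mul, ENNReal.ofReal_mul (by positivity)]
  · rw [Set.indicator_of_notMem h, Set.indicator_of_notMem (show z ∉ {z | (g, z) ∈ S} from h),
      mul_zero]

end POVM

/-! ### Reduction through random channels -/

lemma isState_kraus {ι κ R : Type} [Fintype ι] [DecidableEq ι] [Fintype κ] [DecidableEq κ]
    [Fintype R] {K : R → Matrix κ ι ℂ} (hK : ∑ r, (K r).conjTranspose * K r = 1)
    {ρ : Matrix ι ι ℂ} (hρ : IsState ρ) :
    IsState (∑ r, K r * ρ * (K r).conjTranspose) := by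
  refine ⟨Matrix.posSemidef_sum _ fun r _ => hρ.1.mul_mul_conjTranspose_same _, ?_⟩
  have : ∀ r, (K r * ρ * (K r).conjTranspose).trace = ((K r).conjTranspose * K r * ρ).trace := by
    intro r
    rw [Matrix.trace_mul_comm, Matrix.mul_assoc]
  rw [Matrix.trace_sum, Finset.sum_congr rfl fun r _ => this r, ← Matrix.trace_sum,
    ← Matrix.sum_mul, hK, Matrix.one_mul, hρ.2]

lemma sum_tensorMat_kraus {ι X Y R : Type} [Fintype ι] [DecidableEq ι] [Fintype X] [DecidableEq X]
    [Fintype Y] [DecidableEq Y] [Fintype R] {K : R → Matrix X Y ℂ}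
    (hK : ∑ r, (K r).conjTranspose * K r = 1) :
    ∑ r : ι → R, (tensorMat fun i => K (r i)).conjTranspose * (tensorMat fun i => K (r i)) = 1 := by
  simp only [tensorMat_conjTranspose, tensorMat_mul]
  rw [sum_tensorMat (fun _ : ι => fun r => (K r).conjTranspose * K r), hK, tensorMat_one]

lemma sum_tensorMat_kraus_apply {ι X Y R : Type} [Fintype ι] [DecidableEq ι] [Fintype X]
    [Fintype Y] [Fintype R] (K : R → Matrix X Y ℂ) (ρ : Matrix Y Y ℂ) :
    ∑ r : ι → R, (tensorMat fun i => K (r i)) * (tensorMat fun _ : ι => ρ) *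
      (tensorMat fun i => K (r i)).conjTranspose
        = tensorMat fun _ : ι => ∑ r, K r * ρ * (K r).conjTranspose := by
  simp only [tensorMat_conjTranspose, tensorMat_mul]
  rw [sum_tensorMat (fun _ : ι => fun r => K r * ρ * (K r).conjTranspose)]

/-- If a random channel maps queries about a state to queries about its image, accurately with
probability at least `q`, then an algorithm for the image dimension yields one for the original
dimension. -/
lemma exists_algorithm_of_channels {d k f : ℕ} (A : Algorithm k f) {η p ε q s : ℝ} (hp : 0 ≤ p)
    (hs : 0 ≤ s) (hA : A.Solves η p) {G R : Type} [Fintype G] [Nonempty G] [Fintype R]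
    (K : G → R → Matrix (Fin k) (Fin d) ℂ) (hK : ∀ g, ∑ r, (K g r).conjTranspose * K g r = 1)
    (Q : G → Matrix (Fin d) (Fin d) ℂ → Matrix (Fin k) (Fin k) ℂ)
    (hQ : ∀ g O, O.IsHermitian → (Q g O).IsHermitian)
    (hgood : ∀ ρ, IsState ρ → ∀ O : Matrix (Fin d) (Fin d) ℂ, O.IsHermitian →
      ∃ T : Finset G, q * Fintype.card G ≤ T.card ∧ ∀ g ∈ T,
        |(O * ρ).trace.re -
          s * (Q g O * ∑ r, K g r * ρ * (K g r).conjTranspose).trace.re| +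
          s * (η * opNorm (Q g O)) ≤ ε * opNorm O) :
    ∃ B : Algorithm d f, B.Solves ε (p * q) := by
  let _ : MeasurableSpace G := ⊤
  let _ := A.mΩ
  have hK' := fun g => sum_tensorMat_kraus (ι := Fin f) (hK g)
  refine ⟨⟨G × A.Ω, inferInstance, A.povm.mixture
    (fun g (r : Fin f → R) => tensorMat fun i => K g (r i)) hK',
    fun O z => s * A.estimate (Q z.1 O) z.2, ?_⟩, ?_⟩
  · intro O hO
    exact measurable_from_prod_countable_right fun g =>
      (A.measurable_estimate _ (hQ g O hO)).const_mul s
  · intro ρ hρ O hO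
    obtain ⟨T, hT, hTg⟩ := hgood ρ hρ O hO
    have hmeas : Measurable fun z : G × A.Ω => s * A.estimate (Q z.1 O) z.2 :=
      measurable_from_prod_countable_right fun g =>
        (A.measurable_estimate _ (hQ g O hO)).const_mul s
    have hS : MeasurableSet {z : G × A.Ω |
        |(O * ρ).trace.re - s * A.estimate (Q z.1 O) z.2| ≤ ε * opNorm O} :=
      measurableSet_le ((measurable_const.sub hmeas).abs) measurable_const
    change _ ≤ (A.povm.mixture _ hK').law (tensorPower f ρ) {z : G × A.Ω |
        |(O * ρ).trace.re - s * A.estimate (Q z.1 O) z.2| ≤ ε * opNorm O}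
    rw [POVM.mixture_law_apply _ _ _ _ hS]
    simp only [tensorPower_eq_tensorMat, sum_tensorMat_kraus_apply]
    have hcard : (0 : ℝ) < Fintype.card G := by exact_mod_cast Fintype.card_pos
    have hterm : ∀ g ∈ T, ENNReal.ofReal p ≤
        A.povm.law (tensorMat fun _ : Fin f => ∑ r, K g r * ρ * (K g r).conjTranspose)
          {z | (g, z) ∈ {z : G × A.Ω |
            |(O * ρ).trace.re - s * A.estimate (Q z.1 O) z.2| ≤ ε * opNorm O}} := by
      intro g hg
      refine (hA _ (isState_kraus (hK g) hρ) (Q g O) (hQ g O hO)).trans (measure_mono ?_)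
      intro z hz
      simp only [Set.mem_ofPred_eq] at hz ⊢
      have h1 := hTg g hg
      have h2 := mul_le_mul_of_nonneg_left hz hs
      set x := (Q g O * ∑ r, K g r * ρ * (K g r).conjTranspose).trace.re
      set y := A.estimate (Q g O) z
      calc |(O * ρ).trace.re - s * y|
          ≤ |(O * ρ).trace.re - s * x| + |s * x - s * y| := abs_sub_le _ _ _
        _ = |(O * ρ).trace.re - s * x| + s * |x - y| := by
            rw [← mul_sub, abs_mul, abs_of_nonneg hs]
        _ ≤ ε * opNorm O := by linarith
    calc ENNReal.ofReal (p * q)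
        ≤ ENNReal.ofReal ((Fintype.card G : ℝ)⁻¹ * (T.card * p)) := by
          apply ENNReal.ofReal_le_ofReal
          rw [inv_mul_eq_div, le_div_iff₀ hcard]
          nlinarith
      _ = ENNReal.ofReal (Fintype.card G : ℝ)⁻¹ * ∑ g ∈ T, ENNReal.ofReal p := by
          rw [ENNReal.ofReal_mul (by positivity), ENNReal.ofReal_mul (by positivity)]
          simp
      _ ≤ _ := by
          gcongr
          exact (Finset.sum_le_sum hterm).trans
            (Finset.sum_le_sum_of_subset (Finset.subset_univ T))

/-! ### Independent repetitions -/

namespace POVM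

variable {ι κ : Type} [Fintype ι] [DecidableEq ι] [Fintype κ] [DecidableEq κ]
  {Ω : Type} [MeasurableSpace Ω]

/-- Measure each of `N` registers with the POVM `M`. -/
def pi (M : POVM ι Ω) (N : ℕ) : POVM (Fin N → ι) (Fin N → Ω) where
  μ := Measure.pi fun _ => M.μ
  sigmaFinite := by
    have := M.sigmaFinite
    infer_instance
  elem := fun z => tensorMat fun i => M.elem (z i)
  measurable_elem := by
    intro x y
    simp only [tensorMat, Matrix.of_apply]
    exact Finset.measurable_prod _ fun i _ =>
      (M.measurable_elem (x i) (y i)).comp (measurable_pi_apply i)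
  posSemidef_elem := fun z => posSemidef_tensorMat fun i => M.posSemidef_elem (z i)
  integrable_elem := by
    intro x y
    have := M.sigmaFinite
    simp only [tensorMat, Matrix.of_apply]
    exact Integrable.fintype_prod (f := fun i z => M.elem z (x i) (y i))
      fun i => M.integrable_elem (x i) (y i)
  integral_elem := by
    intro x y
    have := M.sigmaFinite
    simp only [tensorMat, Matrix.of_apply]
    rw [integral_fintype_prod_eq_prod (f := fun i z => M.elem z (x i) (y i))]
    simp only [M.integral_elem]
    rw [← tensorMat_one]
    rfl

lemma pi_law (M : POVM ι Ω) (N : ℕ) {σ : Matrix ι ι ℂ} (hσ : IsState σ) :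
    (M.pi N).law (tensorMat fun _ : Fin N => σ) = Measure.pi fun _ => M.law σ := by
  have := M.sigmaFinite
  have := M.isProbabilityMeasure_law hσ
  symm
  refine Measure.pi_eq fun s hs => ?_
  have hnn : ∀ z, 0 ≤ (M.elem z * σ).trace := fun z => trace_mul_nonneg (M.posSemidef_elem z) hσ.1
  have hre : ∀ z, (((M.elem z * σ).trace.re : ℝ) : ℂ) = (M.elem z * σ).trace := fun z =>
    (Complex.eq_re_of_ofReal_le (hnn z)).symm
  have hdens : ∀ z : Fin N → Ω,
      ((M.pi N).elem z * tensorMat fun _ : Fin N => σ).trace.re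
        = ∏ i, (M.elem (z i) * σ).trace.re := by
    intro z
    change (tensorMat (fun i => M.elem (z i)) * tensorMat fun _ : Fin N => σ).trace.re = _
    rw [tensorMat_mul, trace_tensorMat, ← Finset.prod_congr rfl fun i _ => hre (z i),
      ← Complex.ofReal_prod, Complex.ofReal_re]
  have hint : ∀ i, Integrable ((s i).indicator fun z => (M.elem z * σ).trace.re) M.μ :=
    fun i => (M.integrable_trace σ).re.indicator (hs i)
  have hone : ∀ i, M.law σ (s i)
      = ENNReal.ofReal (∫ z, (s i).indicator (fun z => (M.elem z * σ).trace.re) z ∂M.μ) := by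
    intro i
    rw [ofReal_integral_eq_lintegral_ofReal (hint i), law_apply _ _ (hs i),
      ← lintegral_indicator (hs i)]
    · refine lintegral_congr fun z => ?_
      by_cases h : z ∈ s i <;> simp [h]
    · exact Filter.Eventually.of_forall fun z => Set.indicator_nonneg
        (fun z _ => (Complex.nonneg_iff.mp (hnn z)).1) z
  rw [law_apply _ _ (MeasurableSet.univ_pi hs), ← lintegral_indicator (MeasurableSet.univ_pi hs)]
  simp only [hone]
  rw [← ENNReal.ofReal_prod_of_nonneg fun i _ => integral_nonneg fun z => Set.indicator_nonneg
        (fun z _ => (Complex.nonneg_iff.mp (hnn z)).1) z,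
    ← integral_fintype_prod_eq_prod (f := fun i z =>
      (s i).indicator (fun z => (M.elem z * σ).trace.re) z),
    ofReal_integral_eq_lintegral_ofReal (Integrable.fintype_prod hint)]
  · refine lintegral_congr fun z => ?_
    by_cases h : z ∈ Set.univ.pi s
    · rw [Set.indicator_of_mem h, hdens]
      congr 1
      refine Finset.prod_congr rfl fun i _ => ?_
      rw [Set.indicator_of_mem (h i (Set.mem_univ i))]
    · rw [Set.indicator_of_notMem h]
      simp only [Set.mem_univ_pi, not_forall] at h
      obtain ⟨i, hi⟩ := h
      rw [Finset.prod_eq_zero (Finset.mem_univ i) (Set.indicator_of_notMem hi _)]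
      simp
  · exact Filter.Eventually.of_forall fun z => Finset.prod_nonneg fun i _ =>
      Set.indicator_nonneg (fun z _ => (Complex.nonneg_iff.mp (hnn z)).1) (z i)

/-- Relabel the basis of the measured space. -/
def reindex (M : POVM ι Ω) (e : κ ≃ ι) : POVM κ Ω where
  μ := M.μ
  sigmaFinite := M.sigmaFinite
  elem := fun z => (M.elem z).submatrix e e
  measurable_elem := fun i j => M.measurable_elem (e i) (e j)
  posSemidef_elem := fun z => (M.posSemidef_elem z).submatrix e
  integrable_elem := fun i j => M.integrable_elem (e i) (e j)
  integral_elem := by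
    intro i j
    simp only [Matrix.submatrix_apply, M.integral_elem, Matrix.one_apply, e.injective.eq_iff]

lemma reindex_law (M : POVM ι Ω) (e : κ ≃ ι) (σ : Matrix ι ι ℂ) :
    (M.reindex e).law (σ.submatrix e e) = M.law σ := by
  unfold law
  congr 1
  funext z
  congr 2
  change ((M.elem z).submatrix e e * σ.submatrix e e).trace = _
  rw [Matrix.submatrix_mul_equiv]
  simp only [Matrix.trace, Matrix.diag_apply, Matrix.submatrix_apply]
  exact Equiv.sum_comp e fun i => (M.elem z * σ) i i

end POVM

/-! ### Majority vote -/

lemma exists_mem_of_majority {N : ℕ} (S : {S : Finset (Fin N) // N < 2 * S.card}) :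
    S.1.Nonempty := by
  rw [← Finset.card_pos]
  have := S.2
  omega

instance {N : ℕ} [NeZero N] : Nonempty {S : Finset (Fin N) // N < 2 * S.card} :=
  ⟨⟨Finset.univ, by
    have := NeZero.pos N
    simp only [Finset.card_univ, Fintype.card_fin]
    omega⟩⟩

/-- The median of `N` numbers, as the least of the maxima over all majorities. -/
def median {N : ℕ} [NeZero N] (v : Fin N → ℝ) : ℝ :=
  Finset.univ.inf' Finset.univ_nonempty
    fun S : {S : Finset (Fin N) // N < 2 * S.card} => S.1.sup' (exists_mem_of_majority S) v

lemma measurable_median {N : ℕ} [NeZero N] : Measurable (median (N := N)) := by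
  have h : ∀ S : {S : Finset (Fin N) // N < 2 * S.card},
      Measurable fun v : Fin N → ℝ => S.1.sup' (exists_mem_of_majority S) v := by
    intro S
    have := Finset.measurable_sup' (exists_mem_of_majority S)
      (f := fun (i : Fin N) (v : Fin N → ℝ) => v i) fun i _ => measurable_pi_apply i
    convert! this using 1
    funext v
    simp [Finset.sup'_apply]
  have : Measurable (Finset.univ.inf' Finset.univ_nonempty
      fun (S : {S : Finset (Fin N) // N < 2 * S.card}) (v : Fin N → ℝ) =>
        S.1.sup' (exists_mem_of_majority S) v) :=
    Finset.inf'_induction _ _ (fun _ hf _ hg => hf.inf hg) fun S _ => h S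
  convert! this using 1
  funext v
  simp [Finset.inf'_apply, median]

lemma abs_sub_median_le {N : ℕ} [NeZero N] {v : Fin N → ℝ} {x r : ℝ}
    (h : N < 2 * (Finset.univ.filter fun i => |x - v i| ≤ r).card) : |x - median v| ≤ r := by
  set T := Finset.univ.filter fun i => |x - v i| ≤ r with hT
  have hmem : ∀ i ∈ T, |x - v i| ≤ r := fun i hi => (Finset.mem_filter.mp hi).2
  have upper : median v ≤ x + r := by
    refine (Finset.inf'_le (fun S : {S : Finset (Fin N) // N < 2 * S.card} =>
      S.1.sup' (exists_mem_of_majority S) v) (Finset.mem_univ ⟨T, h⟩)).trans ?_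
    refine Finset.sup'_le _ _ fun i hi => ?_
    have := abs_le.mp (hmem i hi)
    linarith [this.1]
  have lower : x - r ≤ median v := by
    refine Finset.le_inf' _ _ fun S _ => ?_
    obtain ⟨i, hi⟩ : (S.1 ∩ T).Nonempty := by
      rw [← Finset.card_pos]
      have h1 := Finset.card_union_add_card_inter S.1 T
      have h2 : (S.1 ∪ T).card ≤ N := by simpa using Finset.card_le_univ (S.1 ∪ T)
      have := S.2
      omega
    rw [Finset.mem_inter] at hi
    have := abs_le.mp (hmem i hi.2)
    exact (by linarith [this.2] : x - r ≤ v i).trans (Finset.le_sup' v hi.1)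
  rw [abs_le]
  constructor <;> linarith

lemma pi_majority_le {Ω : Type} [MeasurableSpace Ω] (μ : Measure Ω) [IsProbabilityMeasure μ]
    {F : Set Ω} (hF : MeasurableSet F) (hμF : μ.real F ≤ 0.34) (N : ℕ)
    (S : Set (Fin N → Ω))
    (hS : ∀ z ∈ S, ∃ T : Finset (Fin N), N ≤ 2 * T.card ∧ ∀ i ∈ T, z i ∈ F) :
    (Measure.pi fun _ : Fin N => μ) S ≤ ENNReal.ofReal (0.96 ^ N) := by
  classical
  let X : Ω → ENNReal := F.piecewise (fun _ => ENNReal.ofReal (5 / 4)) fun _ => ENNReal.ofReal (4 / 5)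
  have hX : Measurable X := measurable_const.piecewise hF measurable_const
  have hXint : ∫⁻ z, X z ∂μ ≤ ENNReal.ofReal 0.96 := by
    rw [← lintegral_add_compl _ hF]
    have h1 : ∫⁻ z in F, X z ∂μ = ENNReal.ofReal (5 / 4 * μ.real F) := by
      rw [setLIntegral_congr_fun hF (g := fun _ => ENNReal.ofReal (5 / 4))
        (fun z hz => Set.piecewise_eq_of_mem _ _ _ hz)]
      rw [setLIntegral_const, ENNReal.ofReal_mul (by norm_num), ofReal_measureReal]
    have h2 : ∫⁻ z in Fᶜ, X z ∂μ = ENNReal.ofReal (4 / 5 * (1 - μ.real F)) := by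
      rw [setLIntegral_congr_fun hF.compl (g := fun _ => ENNReal.ofReal (4 / 5))
        (fun z hz => Set.piecewise_eq_of_notMem _ _ _ hz)]
      rw [setLIntegral_const, ENNReal.ofReal_mul (by norm_num), ← probReal_compl_eq_one_sub hF,
        ofReal_measureReal]
    rw [h1, h2, ← ENNReal.ofReal_add (by positivity)
      (mul_nonneg (by norm_num) (by linarith))]
    apply ENNReal.ofReal_le_ofReal
    linarith
  have hprod : ∫⁻ z, ∏ i, X (z i) ∂(Measure.pi fun _ : Fin N => μ) = (∫⁻ z, X z ∂μ) ^ N := by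
    have hind := ProbabilityTheory.iIndepFun_pi (μ := fun _ : Fin N => μ) (X := fun _ => X)
      (fun _ => hX.aemeasurable)
    rw [ProbabilityTheory.lintegral_prod_eq_prod_lintegral_of_indepFun _ _ hind
      fun i => hX.comp (measurable_pi_apply i)]
    have : ∀ i : Fin N, ∫⁻ z, X (z i) ∂(Measure.pi fun _ : Fin N => μ) = ∫⁻ z, X z ∂μ := by
      intro i
      exact (measurePreserving_eval (fun _ : Fin N => μ) i).lintegral_comp hX
    simp [this]
  have hle : ∀ z ∈ S, 1 ≤ ∏ i, X (z i) := by
    intro z hz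
    obtain ⟨T, hT, hTF⟩ := hS z hz
    have hlow : ∀ i, ENNReal.ofReal (4 / 5) ≤ X (z i) := by
      intro i
      by_cases h : z i ∈ F
      · simp only [X, Set.piecewise_eq_of_mem _ _ _ h]
        exact ENNReal.ofReal_le_ofReal (by norm_num)
      · simp only [X, Set.piecewise_eq_of_notMem _ _ _ h, le_refl]
    rw [← Finset.prod_mul_prod_compl T]
    calc (1 : ENNReal) ≤ ENNReal.ofReal ((5 / 4) ^ T.card * (4 / 5) ^ (Tᶜ).card) := by
          rw [← ENNReal.ofReal_one]
          apply ENNReal.ofReal_le_ofReal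
          have hc : (Tᶜ).card ≤ T.card := by
            rw [Finset.card_compl, Fintype.card_fin]; omega
          calc (1 : ℝ) = (5 / 4) ^ (Tᶜ).card * (4 / 5) ^ (Tᶜ).card := by
                rw [← mul_pow]; norm_num
            _ ≤ _ := by gcongr; norm_num
      _ = (∏ i ∈ T, ENNReal.ofReal (5 / 4)) * ∏ i ∈ Tᶜ, ENNReal.ofReal (4 / 5) := by
          rw [Finset.prod_const, Finset.prod_const, ENNReal.ofReal_mul (by positivity),
            ENNReal.ofReal_pow (by norm_num), ENNReal.ofReal_pow (by norm_num)]
      _ ≤ _ := by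
          refine mul_le_mul' (Finset.prod_le_prod' fun i hi => ?_)
            (Finset.prod_le_prod' fun i _ => hlow i)
          simp only [X, Set.piecewise_eq_of_mem _ _ _ (hTF i hi), le_refl]
  calc (Measure.pi fun _ : Fin N => μ) S
      ≤ ∫⁻ z, ∏ i, X (z i) ∂(Measure.pi fun _ : Fin N => μ) := by
        have hm : Measurable fun z : Fin N → Ω => ∏ i, X (z i) :=
          Finset.measurable_prod _ fun i _ => hX.comp (measurable_pi_apply i)
        have := mul_meas_ge_le_lintegral (μ := Measure.pi fun _ : Fin N => μ) hm 1
        rw [one_mul] at this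
        exact (measure_mono hle).trans this
    _ = (∫⁻ z, X z ∂μ) ^ N := hprod
    _ ≤ ENNReal.ofReal 0.96 ^ N := by gcongr
    _ = _ := by rw [ENNReal.ofReal_pow (by norm_num)]

/-- A basis of `(ℂ^d)^{⊗ N f}`, seen as `N` groups of `f` tensor factors. -/
def groupEquiv (N f d : ℕ) : (Fin (N * f) → Fin d) ≃ (Fin N → Fin f → Fin d) :=
  (Equiv.arrowCongr finProdFinEquiv (Equiv.refl (Fin d))).symm.trans (Equiv.curry _ _ _)

lemma tensorPower_mul {d : ℕ} (N f : ℕ) (ρ : Matrix (Fin d) (Fin d) ℂ) :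
    tensorPower (N * f) ρ = (tensorMat fun _ : Fin N => tensorPower f ρ).submatrix
      (groupEquiv N f d) (groupEquiv N f d) := by
  ext x y
  simp only [tensorPower, tensorMat, Matrix.of_apply, Matrix.submatrix_apply, groupEquiv,
    Equiv.trans_apply, Equiv.curry_apply, Function.curry]
  rw [← Fintype.prod_prod_type', ← Equiv.prod_comp finProdFinEquiv]
  rfl

lemma exists_algorithm_boost {d f : ℕ} {ε : ℝ} (A : Algorithm d f) (hA : A.Solves ε 0.66)
    {δ : ℝ} (hδ : 0 < δ) (hδ' : δ ≤ 1 / 2) :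
    ∃ N : ℕ, (N : ℝ) ≤ 27 * Real.log (1 / δ) ∧
      ∃ B : Algorithm d (N * f), B.Solves ε (1 - δ) := by
  set L := Real.log (1 / δ) with hL
  have hL2 : 0.69 ≤ L := by
    have : Real.log 2 ≤ L := by
      apply Real.log_le_log (by norm_num)
      rw [le_div_iff₀ hδ]; linarith
    linarith [Real.log_two_gt_d9]
  set N := ⌈25 * L⌉₊ with hN
  have hN1 : 25 * L ≤ N := Nat.le_ceil _
  have hN2 : (N : ℝ) < 25 * L + 1 := Nat.ceil_lt_add_one (by linarith)
  have hNpos : 0 < N := Nat.ceil_pos.mpr (by linarith)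
  have : NeZero N := ⟨hNpos.ne'⟩
  refine ⟨N, by linarith, ?_⟩
  have hdec : (0.96 : ℝ) ^ N ≤ δ := by
    have h1 : (0.96 : ℝ) ≤ Real.exp (-(1 / 25)) := by
      have := Real.add_one_le_exp (-(1 / 25) : ℝ)
      linarith
    calc (0.96 : ℝ) ^ N ≤ Real.exp (-(1 / 25)) ^ N := by gcongr
      _ = Real.exp (-(N / 25)) := by rw [← Real.exp_nat_mul]; ring_nf
      _ ≤ Real.exp (-L) := by apply Real.exp_le_exp.mpr; linarith
      _ = δ := by rw [hL, one_div, Real.log_inv, neg_neg, Real.exp_log hδ]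
  let _ := A.mΩ
  have hmed : ∀ O : Matrix (Fin d) (Fin d) ℂ, O.IsHermitian →
      Measurable fun z : Fin N → A.Ω => median fun i => A.estimate O (z i) := fun O hO =>
    measurable_median.comp (measurable_pi_lambda _ fun i =>
      (A.measurable_estimate O hO).comp (measurable_pi_apply i))
  refine ⟨⟨Fin N → A.Ω, inferInstance, (A.povm.pi N).reindex (groupEquiv N f d),
    fun O z => median fun i => A.estimate O (z i), hmed⟩, ?_⟩
  intro ρ hρ O hO
  set r := ε * opNorm O
  set x := (O * ρ).trace.re
  change _ ≤ ((A.povm.pi N).reindex (groupEquiv N f d)).law (tensorPower (N * f) ρ)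
    {z : Fin N → A.Ω | |x - median fun i => A.estimate O (z i)| ≤ r}
  rw [tensorPower_mul, POVM.reindex_law, POVM.pi_law _ _ hρ.tensorPower]
  have := A.povm.isProbabilityMeasure_law (hρ.tensorPower (n := f))
  set μ := A.povm.law (tensorPower f ρ)
  have hG : MeasurableSet {z | |x - A.estimate O z| ≤ r} :=
    measurableSet_le (measurable_const.sub (A.measurable_estimate O hO)).abs measurable_const
  have hGμ : 0.66 ≤ μ.real {z | |x - A.estimate O z| ≤ r} := by
    have h := hA ρ hρ O hO
    rw [Measure.real]
    exact (ENNReal.ofReal_le_iff_le_toReal (measure_ne_top _ _)).mp h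
  have hbad := pi_majority_le μ hG.compl (by rw [probReal_compl_eq_one_sub hG]; linarith) N
    {z : Fin N → A.Ω | |x - median fun i => A.estimate O (z i)| ≤ r}ᶜ (by
      intro z hz
      refine ⟨Finset.univ.filter fun i => ¬ |x - A.estimate O (z i)| ≤ r, ?_, ?_⟩
      · by_contra hlt
        apply hz
        apply abs_sub_median_le
        have := Finset.card_filter_add_card_filter_not (s := (Finset.univ : Finset (Fin N)))
          (fun i => |x - A.estimate O (z i)| ≤ r)
        simp only [Finset.card_univ, Fintype.card_fin] at this
        omega
      · intro i hi
        exact (Finset.mem_filter.mp hi).2)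
  have hS : MeasurableSet {z : Fin N → A.Ω | |x - median fun i => A.estimate O (z i)| ≤ r} :=
    measurableSet_le (measurable_const.sub (hmed O hO)).abs measurable_const
  have hb : (Measure.pi fun _ : Fin N => μ).real
      {z : Fin N → A.Ω | |x - median fun i => A.estimate O (z i)| ≤ r}ᶜ ≤ δ := by
    rw [Measure.real]
    exact ENNReal.toReal_le_of_le_ofReal hδ.le (hbad.trans (ENNReal.ofReal_le_ofReal hdec))
  rw [probReal_compl_eq_one_sub hS] at hb
  rw [← ofReal_measureReal (μ := Measure.pi fun _ : Fin N => μ)]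
  exact ENNReal.ofReal_le_ofReal (by linarith)

open Finset
open scoped BigOperators ComplexConjugate

/-! ### Uniform probability on finite sets -/

section Uniform

variable {G H : Type*} [Fintype G] [Fintype H]

open Classical in
/-- The proportion of elements that satisfy a predicate. -/
def prob (p : G → Prop) : ℝ := 𝔼 g, if p g then (1 : ℝ) else 0

lemma expect_mono {f g : G → ℝ} (h : ∀ x, f x ≤ g x) : 𝔼 x, f x ≤ 𝔼 x, g x :=
  Finset.expect_le_expect fun x _ => h x

lemma prob_le_of_le {p : G → Prop} {X : G → ℝ} {a : ℝ} (ha : 0 < a) (hX : ∀ g, 0 ≤ X g)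
    (h : ∀ g, p g → a ≤ X g) : prob p ≤ (𝔼 g, X g) / a := by
  rw [le_div_iff₀ ha, prob, Finset.expect_mul]
  refine expect_mono fun g => ?_
  split_ifs with hp
  · simpa using h g hp
  · simpa using hX g

lemma prob_mono {p q : G → Prop} (h : ∀ g, p g → q g) : prob p ≤ prob q := by
  refine expect_mono fun g => ?_
  by_cases hp : p g
  · simp [hp, h g hp]
  · simp only [hp, if_false]; split_ifs <;> norm_num

lemma prob_or_le (p q : G → Prop) : prob (fun g => p g ∨ q g) ≤ prob p + prob q := by
  rw [prob, prob, prob, ← Finset.expect_add_distrib]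
  refine expect_mono fun g => ?_
  by_cases hp : p g <;> by_cases hq : q g <;> simp [hp, hq]

lemma prob_exists_le {T : Type*} (s : Finset T) (p : T → G → Prop) :
    prob (fun g => ∃ x ∈ s, p x g) ≤ ∑ x ∈ s, prob (p x) := by
  classical
  simp only [prob]
  rw [← Finset.expect_sum_comm]
  refine expect_mono fun g => ?_
  split_ifs with h
  · obtain ⟨x, hx, hpx⟩ := h
    have := Finset.single_le_sum (f := fun x => if p x g then (1 : ℝ) else 0)
      (fun y _ => by split_ifs <;> norm_num) hx
    simp only [hpx, if_true] at this
    convert! this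
  · exact Finset.sum_nonneg fun y _ => by split_ifs <;> norm_num

lemma card_mul_prob [Nonempty G] (p : G → Prop) [DecidablePred p] :
    (Fintype.card G : ℝ) * prob p = (Finset.univ.filter p).card := by
  have h0 : (Fintype.card G : ℝ) ≠ 0 := by simp
  rw [prob, Finset.expect_eq_sum_div_card, Finset.card_univ, mul_div_cancel₀ _ h0,
    ← Finset.sum_boole]
  refine Finset.sum_congr rfl fun g _ => ?_
  congr

lemma prob_not [Nonempty G] (p : G → Prop) : prob (fun g => ¬ p g) = 1 - prob p := by
  have : (1 : ℝ) = 𝔼 _g : G, (1 : ℝ) := by simp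
  rw [this, prob, prob, ← Finset.expect_sub_distrib]
  refine Finset.expect_congr rfl fun g _ => ?_
  by_cases hp : p g <;> simp [hp]

lemma expect_prod_type (f : G × H → ℝ) : 𝔼 x, f x = 𝔼 g, 𝔼 h, f (g, h) := by
  rw [← Finset.univ_product_univ, Finset.expect_product]

lemma expect_prod_type_right (f : G × H → ℝ) : 𝔼 x, f x = 𝔼 h, 𝔼 g, f (g, h) := by
  rw [expect_prod_type, Finset.expect_comm]

lemma expect_comp_equiv {E : Type*} [AddCommMonoid E] [Module ℚ≥0 E] (e : G ≃ H) (f : H → E) :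
    𝔼 x, f (e x) = 𝔼 y, f y :=
  Fintype.expect_equiv e _ _ fun _ => rfl

lemma ofReal_expect (f : G → ℝ) : ((𝔼 g, f g : ℝ) : ℂ) = 𝔼 g, (f g : ℂ) := by
  simp [Finset.expect_eq_sum_div_card]

lemma expect_norm_sq_le_gram {P : Type*} [Fintype P] (e : P → G → ℂ) (c : P → ℂ) :
    𝔼 g, ‖∑ p, c p * e p g‖ ^ 2
      ≤ ∑ p, ∑ q, ‖c p‖ * ‖c q‖ * ‖𝔼 g, e p g * conj (e q g)‖ := by
  have h : ((𝔼 g, ‖∑ p, c p * e p g‖ ^ 2 : ℝ) : ℂ)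
      = ∑ p, ∑ q, c p * conj (c q) * 𝔼 g, e p g * conj (e q g) := by
    rw [ofReal_expect]
    simp only [Finset.mul_expect]
    simp only [← Finset.expect_sum_comm]
    refine Finset.expect_congr rfl fun g _ => ?_
    rw [Complex.ofReal_pow, ← Complex.mul_conj', map_sum, Finset.sum_mul_sum]
    refine Finset.sum_congr rfl fun p _ => Finset.sum_congr rfl fun q _ => ?_
    rw [map_mul]
    ring
  calc 𝔼 g, ‖∑ p, c p * e p g‖ ^ 2
      ≤ ‖((𝔼 g, ‖∑ p, c p * e p g‖ ^ 2 : ℝ) : ℂ)‖ := by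
        rw [Complex.norm_real]; exact le_abs_self _
    _ ≤ _ := by
        rw [h]
        refine (norm_sum_le _ _).trans (Finset.sum_le_sum fun p _ => ?_)
        refine (norm_sum_le _ _).trans (Finset.sum_le_sum fun q _ => ?_)
        rw [norm_mul, norm_mul, RCLike.norm_conj]

lemma norm_expect_mul_conj_le {e e' : G → ℂ} (he : ∀ g, ‖e g‖ ≤ 1) (he' : ∀ g, ‖e' g‖ ≤ 1) :
    ‖𝔼 g, e g * conj (e' g)‖ ≤ 1 := by
  rw [Finset.expect_eq_sum_div_card, norm_div, Finset.card_univ, Complex.norm_natCast]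
  refine div_le_one_of_le₀ ((norm_sum_le _ _).trans ?_) (by positivity)
  refine (Finset.sum_le_card_nsmul _ _ 1 fun g _ => ?_).trans (by simp)
  rw [norm_mul, RCLike.norm_conj]
  exact mul_le_one₀ (he g) (norm_nonneg _) (he' g)

/-- Second moment of a combination of bounded functions, each of which is orthogonal to all
others but its partner under `τ`. -/
lemma expect_norm_sq_le_two {P : Type*} [Fintype P] [DecidableEq P] (τ : Equiv.Perm P)
    (e : P → G → ℂ) (hbd : ∀ p g, ‖e p g‖ ≤ 1)
    (horth : ∀ p q, q ≠ p → q ≠ τ p → 𝔼 g, e p g * conj (e q g) = 0) (c : P → ℂ) :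
    𝔼 g, ‖∑ p, c p * e p g‖ ^ 2 ≤ 2 * ∑ p, ‖c p‖ ^ 2 := by
  have key : ∀ p, ∑ q, ‖c p‖ * ‖c q‖ * ‖𝔼 g, e p g * conj (e q g)‖
      ≤ ‖c p‖ * ‖c p‖ + ‖c p‖ * ‖c (τ p)‖ := by
    intro p
    calc ∑ q, ‖c p‖ * ‖c q‖ * ‖𝔼 g, e p g * conj (e q g)‖
        ≤ ∑ q, ((if q = p then ‖c p‖ * ‖c q‖ else 0) +
            (if q = τ p then ‖c p‖ * ‖c q‖ else 0)) := by
          refine Finset.sum_le_sum fun q _ => ?_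
          have h1 := mul_le_mul_of_nonneg_left (norm_expect_mul_conj_le (hbd p) (hbd q))
            (by positivity : 0 ≤ ‖c p‖ * ‖c q‖)
          have h0 : 0 ≤ ‖c p‖ * ‖c q‖ := by positivity
          by_cases h : q = p
          · rw [if_pos h]
            split_ifs <;> linarith
          · by_cases h' : q = τ p
            · rw [if_neg h, if_pos h']; linarith
            · rw [if_neg h, if_neg h', horth p q h h']; simp
      _ = _ := by simp [Finset.sum_add_distrib]
  calc _ ≤ ∑ p, (‖c p‖ * ‖c p‖ + ‖c p‖ * ‖c (τ p)‖) :=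
        (expect_norm_sq_le_gram e c).trans (Finset.sum_le_sum fun p _ => key p)
    _ ≤ ∑ p, (3 / 2 * ‖c p‖ ^ 2 + 1 / 2 * ‖c (τ p)‖ ^ 2) := by
        refine Finset.sum_le_sum fun p _ => ?_
        nlinarith [sq_nonneg (‖c p‖ - ‖c (τ p)‖)]
    _ = _ := by
        rw [Finset.sum_add_distrib, ← Finset.mul_sum, ← Finset.mul_sum,
          Equiv.sum_comp τ fun p => ‖c p‖ ^ 2]
        ring

/-- Bessel's inequality for bounded orthogonal functions. -/
lemma expect_norm_sq_le {P : Type*} [Fintype P]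
    (e : P → G → ℂ) (hbd : ∀ p g, ‖e p g‖ ≤ 1)
    (horth : ∀ p q, q ≠ p → 𝔼 g, e p g * conj (e q g) = 0) (c : P → ℂ) :
    𝔼 g, ‖∑ p, c p * e p g‖ ^ 2 ≤ ∑ p, ‖c p‖ ^ 2 := by
  refine (expect_norm_sq_le_gram e c).trans (Finset.sum_le_sum fun p _ => ?_)
  rw [Finset.sum_eq_single p (fun q _ hq => by rw [horth p q hq]; simp) (by simp)]
  have := mul_le_mul_of_nonneg_left (norm_expect_mul_conj_le (hbd p) (hbd p))
    (by positivity : 0 ≤ ‖c p‖ * ‖c p‖)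
  nlinarith

end Uniform

/-! ### Complex signs -/

/-- The fourth roots of unity. -/
def phase : Fin 4 → ℂ := ![1, Complex.I, -1, -Complex.I]

lemma norm_phase (n : Fin 4) : ‖phase n‖ = 1 := by
  fin_cases n <;> simp [phase]

lemma phase_add_one (n : Fin 4) : phase (n + 1) = Complex.I * phase n := by
  fin_cases n <;> simp [phase]

lemma expect_exp_re_phase_mul (c : ℂ) :
    𝔼 n, Real.exp (phase n * c).re ≤ Real.exp (‖c‖ ^ 2 / 4) := by
  have h : 𝔼 n, Real.exp (phase n * c).re
      = Real.cosh ((c.re + c.im) / 2) * Real.cosh ((c.re - c.im) / 2) := by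
    rw [Finset.expect_eq_sum_div_card, Fin.sum_univ_four]
    simp [phase, Real.cosh_eq]
    ring_nf
    simp only [← Real.exp_add]
    ring_nf
  rw [h]
  calc _ ≤ Real.exp (((c.re + c.im) / 2) ^ 2 / 2) * Real.exp (((c.re - c.im) / 2) ^ 2 / 2) := by
        gcongr <;> exact Real.cosh_le_exp_half_sq _
    _ = _ := by
        rw [← Real.exp_add, ← Complex.normSq_eq_norm_sq, Complex.normSq_apply]
        ring_nf

section Signs

variable {ι : Type*} [Fintype ι] [DecidableEq ι]

lemma phase_add_single {ι : Type*} [DecidableEq ι] (ω : ι → Fin 4) (u s : ι) :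
    phase ((ω + Pi.single u 1 : ι → Fin 4) s) = (if s = u then Complex.I else 1) * phase (ω s) := by
  by_cases h : s = u
  · subst h; simp [phase_add_one]
  · simp [h]

lemma expect_eq_zero_of_rotate (F : (ι → Fin 4) → ℂ) (u : ι) {c : ℂ} (hc : c ≠ 1)
    (hF : ∀ ω, F (ω + Pi.single u 1) = c * F ω) : 𝔼 ω, F ω = 0 := by
  have h := expect_comp_equiv (Equiv.addRight (Pi.single u 1 : ι → Fin 4)) F
  simp only [Equiv.coe_addRight, hF, ← Finset.mul_expect] at h
  have : (c - 1) * 𝔼 ω, F ω = 0 := by linear_combination h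
  exact (mul_eq_zero.mp this).resolve_left (sub_ne_zero.mpr hc)

lemma expect_eq_expect_expect_single (F : (ι → Fin 4) → ℝ) (u : ι) :
    𝔼 ω, F ω = 𝔼 ω, 𝔼 n : Fin 4, F (ω + (Pi.single u n : ι → Fin 4)) := by
  rw [Finset.expect_comm]
  have : ∀ n : Fin 4, 𝔼 ω, F (ω + (Pi.single u n : ι → Fin 4)) = 𝔼 ω, F ω := fun n =>
    expect_comp_equiv (Equiv.addRight (Pi.single u n : ι → Fin 4)) F
  simp [this]

lemma expect_norm_sq_linear_le (c : ι → ℂ) :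
    𝔼 ω : ι → Fin 4, ‖∑ s, c s * phase (ω s)‖ ^ 2 ≤ ∑ s, ‖c s‖ ^ 2 := by
  refine expect_norm_sq_le (fun s (ω : ι → Fin 4) => phase (ω s)) (fun s ω => (norm_phase _).le)
    (fun p q hqp => ?_) c
  refine expect_eq_zero_of_rotate (fun ω => phase (ω p) * conj (phase (ω q))) p
    (c := Complex.I) (by simp [Complex.ext_iff]) fun ω => ?_
  simp only [phase_add_single, hqp, if_true, if_false, one_mul]
  ring

lemma expect_norm_sq_quadratic_le (C : ι → ι → ℂ) :
    𝔼 ω : ι → Fin 4, ‖∑ s, ∑ t, C s t * (phase (ω s) * conj (phase (ω t))) - ∑ s, C s s‖ ^ 2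
      ≤ ∑ s, ∑ t, ‖C s t‖ ^ 2 := by
  have h := expect_norm_sq_le
    (fun (p : ι × ι) (ω : ι → Fin 4) =>
      if p.1 = p.2 then 0 else phase (ω p.1) * conj (phase (ω p.2)))
    (fun p ω => by split_ifs <;> simp [norm_phase])
    (fun p q hqp => ?_) (fun p => C p.1 p.2)
  · rw [Fintype.sum_prod_type] at h
    refine le_trans (le_of_eq ?_) h
    refine Finset.expect_congr rfl fun ω _ => ?_
    congr 2
    rw [Fintype.sum_prod_type, ← Finset.sum_sub_distrib]
    refine Finset.sum_congr rfl fun s _ => ?_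
    have h1 : phase (ω s) * conj (phase (ω s)) = 1 := by
      rw [Complex.mul_conj', norm_phase]; simp
    rw [sub_eq_iff_eq_add, show C s s = ∑ t, if s = t then C s t else 0 by simp,
      ← Finset.sum_add_distrib]
    refine Finset.sum_congr rfl fun t _ => ?_
    by_cases hst : s = t
    · subst hst; simp [h1]
    · simp [hst]
  · by_cases hp : p.1 = p.2
    · simp [hp]
    by_cases hq : q.1 = q.2
    · simp [hq]
    simp only [hp, hq, if_false]
    by_cases h1 : q.1 = p.1
    · have h2 : q.2 ≠ p.2 := fun h2 => hqp (Prod.ext h1 h2)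
      refine expect_eq_zero_of_rotate (fun ω => phase (ω p.1) * conj (phase (ω p.2)) *
        conj (phase (ω q.1) * conj (phase (ω q.2)))) p.2 (c := -Complex.I)
        (by simp [Complex.ext_iff]) fun ω => ?_
      simp only [phase_add_single, hp, h1, h2, if_true, if_false, map_mul, Complex.conj_I, map_one]
      ring
    · by_cases h2 : q.2 = p.1
      · refine expect_eq_zero_of_rotate (fun ω => phase (ω p.1) * conj (phase (ω p.2)) *
          conj (phase (ω q.1) * conj (phase (ω q.2)))) p.1 (c := Complex.I * Complex.I)
          (by norm_num) fun ω => ?_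
        simp only [phase_add_single, Ne.symm hp, h1, h2, if_true, if_false, map_mul, Complex.conj_I,
          map_one, Complex.conj_conj, map_neg]
        ring
      · refine expect_eq_zero_of_rotate (fun ω => phase (ω p.1) * conj (phase (ω p.2)) *
          conj (phase (ω q.1) * conj (phase (ω q.2)))) p.1 (c := Complex.I)
          (by simp [Complex.ext_iff]) fun ω => ?_
        simp only [phase_add_single, Ne.symm hp, h1, h2, if_true, if_false, map_mul, map_one]
        ring

lemma expect_norm_sq_bilinear_le (C : ι → ι → ℂ) :
    𝔼 ω : ι → Fin 4, ‖∑ s, ∑ t, C s t * (phase (ω s) * phase (ω t))‖ ^ 2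
      ≤ 2 * ∑ s, ∑ t, ‖C s t‖ ^ 2 := by
  have h := expect_norm_sq_le_two (Equiv.prodComm ι ι)
    (fun (p : ι × ι) (ω : ι → Fin 4) => phase (ω p.1) * phase (ω p.2))
    (fun p ω => by simp [norm_phase])
    (fun p q hqp hqs => ?_) (fun p => C p.1 p.2)
  · simpa only [Fintype.sum_prod_type] using h
  · have rot : ∀ (u : ι) (ω : ι → Fin 4), phase ((ω + Pi.single u 1 : ι → Fin 4) p.1) *
        phase ((ω + Pi.single u 1 : ι → Fin 4) p.2) *
        conj (phase ((ω + Pi.single u 1 : ι → Fin 4) q.1) *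
          phase ((ω + Pi.single u 1 : ι → Fin 4) q.2)) =
        ((if p.1 = u then Complex.I else 1) * (if p.2 = u then Complex.I else 1) *
        conj ((if q.1 = u then Complex.I else 1) * (if q.2 = u then Complex.I else 1))) *
        (phase (ω p.1) * phase (ω p.2) * conj (phase (ω q.1) * phase (ω q.2))) := by
      intro u ω
      simp only [phase_add_single, map_mul]
      ring
    by_cases h1 : q.1 = p.1
    · have h2 : q.2 ≠ p.2 := fun h2 => hqp (Prod.ext h1 h2)
      refine expect_eq_zero_of_rotate _ q.2 ?_ (rot q.2)
      rw [h1]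
      by_cases h3 : p.1 = q.2 <;> simp [h3, Ne.symm h2, Complex.ext_iff]
    · by_cases h2 : q.2 = p.1
      · have h3 : p.2 ≠ q.1 := fun h3 => hqs (Prod.ext h3.symm h2)
        refine expect_eq_zero_of_rotate _ q.1 ?_ (rot q.1)
        rw [h2]
        simp [Ne.symm h1, h3, Complex.ext_iff]
      · refine expect_eq_zero_of_rotate _ p.1 ?_ (rot p.1)
        by_cases h3 : p.2 = p.1
        · simp only [h1, h2, h3, if_true, if_false, Complex.I_mul_I]
          norm_num
        · simp [h1, h2, h3, Complex.ext_iff]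

lemma expect_prod_pi (g : ι → Fin 4 → ℝ) :
    𝔼 ω : ι → Fin 4, ∏ s, g s (ω s) = ∏ s, 𝔼 n, g s n := by
  simp only [Finset.expect_eq_sum_div_card, Finset.prod_div_distrib]
  rw [Finset.prod_univ_sum]
  simp

lemma expect_exp_re_linear_le (c : ι → ℂ) :
    𝔼 ω : ι → Fin 4, Real.exp (∑ s, c s * phase (ω s)).re ≤ Real.exp (∑ s, ‖c s‖ ^ 2 / 4) := by
  simp only [Complex.re_sum, Real.exp_sum]
  rw [expect_prod_pi fun s n => Real.exp (c s * phase n).re]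
  refine Finset.prod_le_prod (fun s _ => Finset.expect_nonneg fun n _ => (Real.exp_pos _).le)
    fun s _ => ?_
  simpa only [mul_comm] using expect_exp_re_phase_mul (c s)

/-- Exponential moments of a sum of squares of disjoint linear forms in complex signs. -/
lemma expect_exp_sum_sq_le {β : Type*} [Fintype β] [DecidableEq β] (π : ι → β) (x : ι → ℂ)
    (S : Finset ι) : ∀ t : β → ℝ, (∀ b, 0 ≤ t b) →
      (∀ b, t b * ∑ s ∈ S with π s = b, ‖x s‖ ^ 2 < 1) →
      𝔼 ω : ι → Fin 4, Real.exp (∑ b, t b * ‖∑ s ∈ S with π s = b, x s * phase (ω s)‖ ^ 2)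
        ≤ ∏ b, (1 - t b * ∑ s ∈ S with π s = b, ‖x s‖ ^ 2)⁻¹ := by
  induction S using Finset.induction_on with
  | empty => intro t _ _; simp
  | insert u S hu ih =>
    intro t ht hlt
    set b := π u with hb
    set q := ‖x u‖ ^ 2 with hq
    set z : (ι → Fin 4) → β → ℂ := fun ω c => ∑ s ∈ S with π s = c, x s * phase (ω s) with hz
    set X : β → ℝ := fun c => ∑ s ∈ S with π s = c, ‖x s‖ ^ 2 with hX
    have hsum : ∀ (ω : ι → Fin 4) (c : β), ∑ s ∈ insert u S with π s = c, x s * phase (ω s)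
        = z ω c + if b = c then x u * phase (ω u) else 0 := by
      intro ω c
      rw [Finset.filter_insert]
      split_ifs with h
      · rw [Finset.sum_insert (by simp [hu]), add_comm]
      · simp [hz]
    have hsumX : ∀ c : β, ∑ s ∈ insert u S with π s = c, ‖x s‖ ^ 2
        = X c + if b = c then q else 0 := by
      intro c
      rw [Finset.filter_insert]
      split_ifs with h
      · rw [Finset.sum_insert (by simp [hu]), add_comm]
      · simp [hX]
    have hX0 : ∀ c, 0 ≤ X c := fun c => Finset.sum_nonneg fun s _ => by positivity
    have hq0 : 0 ≤ q := by positivity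
    simp only [hsumX] at hlt ⊢
    simp only [hsum]
    have hlb : t b * (X b + q) < 1 := by simpa using hlt b
    have htq : t b * q < 1 := by nlinarith [ht b, mul_nonneg (ht b) (hX0 b)]
    let t' : β → ℝ := Function.update t b (t b + t b ^ 2 * q)
    have ht'b : t' b = t b + t b ^ 2 * q := by simp [t']
    have ht'c : ∀ c, c ≠ b → t' c = t c := fun c hc => by simp [t', hc]
    have ht'0 : ∀ c, 0 ≤ t' c := by
      intro c
      by_cases hc : c = b
      · rw [hc, ht'b]; have := ht b; positivity
      · rw [ht'c c hc]; exact ht c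
    have hprod : 1 - t b * (X b + q) ≤ (1 - t b * q) * (1 - t' b * X b) := by
      rw [ht'b]
      have : 0 ≤ t b ^ 3 * q ^ 2 * X b := by
        have := ht b; have := hX0 b; positivity
      nlinarith
    have hpos1 : 0 < 1 - t b * q := by linarith
    have hpos2 : 0 < 1 - t' b * X b := by
      by_contra hneg
      nlinarith
    have hlt' : ∀ c, t' c * X c < 1 := by
      intro c
      by_cases hc : c = b
      · rw [hc]; linarith
      · rw [ht'c c hc]; simpa [Ne.symm hc] using hlt c
    have hIH := ih t' ht'0 hlt'
    have hstep : ∀ ω : ι → Fin 4, 𝔼 n : Fin 4, Real.exp (∑ c, t c *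
        ‖z (ω + Pi.single u n) c +
          if b = c then x u * phase ((ω + Pi.single u n : ι → Fin 4) u) else 0‖ ^ 2)
        ≤ Real.exp (t b * q) * Real.exp (∑ c, t' c * ‖z ω c‖ ^ 2) := by
      intro ω
      have hzn : ∀ n : Fin 4, z (ω + Pi.single u n) = z ω := by
        intro n
        funext c
        refine Finset.sum_congr rfl fun s hs => ?_
        have : s ≠ u := by
          rintro rfl
          exact hu (Finset.mem_filter.mp hs).1
        simp [this]
      have hexp : ∀ n : Fin 4, ∑ c, t c * ‖z (ω + Pi.single u n) c +
          (if b = c then x u * phase ((ω + Pi.single u n : ι → Fin 4) u) else 0)‖ ^ 2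
          = (∑ c, t c * ‖z ω c‖ ^ 2 + t b * q) +
            (phase (ω u + n) * (2 * t b * (x u * conj (z ω b)))).re := by
        intro n
        rw [hzn]
        have hpt : ∀ c, t c * ‖z ω c + (if b = c then
            x u * phase ((ω + Pi.single u n : ι → Fin 4) u) else 0)‖ ^ 2
            = t c * ‖z ω c‖ ^ 2 + if b = c then t b * q +
              (phase (ω u + n) * (2 * t b * (x u * conj (z ω b)))).re else 0 := by
          intro c
          split_ifs with h
          · subst h
            have hp : ‖phase (ω u + n)‖ ^ 2 = 1 := by rw [norm_phase]; norm_num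
            simp only [Pi.add_apply, Pi.single_eq_same]
            simp only [hq, ← Complex.normSq_eq_norm_sq] at hp ⊢
            rw [Complex.normSq_add, Complex.normSq_mul, hp]
            have : (phase (ω u + n) * (2 * t b * (x u * conj (z ω b)))).re
                = t b * (2 * (z ω b * conj (x u * phase (ω u + n))).re) := by
              simp
              ring
            rw [this]
            ring
          · simp
        rw [Finset.sum_congr rfl fun c _ => hpt c, Finset.sum_add_distrib,
          Finset.sum_ite_eq, if_pos (Finset.mem_univ b)]
        ring
      simp only [hexp, Real.exp_add, ← Finset.mul_expect]
      have hreidx : 𝔼 n : Fin 4, Real.exp (phase (ω u + n) * (2 * t b * (x u * conj (z ω b)))).re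
          = 𝔼 n : Fin 4, Real.exp (phase n * (2 * t b * (x u * conj (z ω b)))).re :=
        expect_comp_equiv (Equiv.addLeft (ω u))
          fun n => Real.exp (phase n * (2 * t b * (x u * conj (z ω b)))).re
      rw [hreidx]
      have hm := expect_exp_re_phase_mul (2 * t b * (x u * conj (z ω b)))
      have hnorm : ‖2 * (t b : ℂ) * (x u * conj (z ω b))‖ ^ 2 / 4
          = t b ^ 2 * q * ‖z ω b‖ ^ 2 := by
        rw [norm_mul, norm_mul, norm_mul, RCLike.norm_conj, Complex.norm_real, hq,
          Real.norm_eq_abs, abs_of_nonneg (ht b)]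
        norm_num
        ring
      rw [hnorm] at hm
      have hsplit : ∑ c, t' c * ‖z ω c‖ ^ 2
          = ∑ c, t c * ‖z ω c‖ ^ 2 + t b ^ 2 * q * ‖z ω b‖ ^ 2 := by
        have : ∀ c, t' c * ‖z ω c‖ ^ 2 = t c * ‖z ω c‖ ^ 2 +
            if b = c then t b ^ 2 * q * ‖z ω b‖ ^ 2 else 0 := by
          intro c
          by_cases hc : c = b
          · rw [hc, ht'b, if_pos rfl]; ring
          · rw [ht'c c hc, if_neg (Ne.symm hc), add_zero]
        rw [Finset.sum_congr rfl fun c _ => this c, Finset.sum_add_distrib,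
          Finset.sum_ite_eq, if_pos (Finset.mem_univ b)]
      rw [hsplit, Real.exp_add]
      calc _ ≤ Real.exp (∑ c, t c * ‖z ω c‖ ^ 2) * Real.exp (t b * q) *
            Real.exp (t b ^ 2 * q * ‖z ω b‖ ^ 2) := by gcongr
        _ = _ := by ring
    rw [expect_eq_expect_expect_single _ u]
    calc _ ≤ 𝔼 ω : ι → Fin 4, Real.exp (t b * q) * Real.exp (∑ c, t' c * ‖z ω c‖ ^ 2) :=
          expect_mono hstep
      _ = Real.exp (t b * q) * 𝔼 ω : ι → Fin 4, Real.exp (∑ c, t' c * ‖z ω c‖ ^ 2) := by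
          rw [Finset.mul_expect]
      _ ≤ (1 - t b * q)⁻¹ * ∏ c, (1 - t' c * X c)⁻¹ := by
          gcongr
          rw [← inv_inv (Real.exp (t b * q)), ← Real.exp_neg]
          refine inv_anti₀ hpos1 ?_
          have := Real.add_one_le_exp (-(t b * q))
          linarith
      _ ≤ _ := by
          rw [← Finset.mul_prod_erase _ _ (Finset.mem_univ b),
            ← Finset.mul_prod_erase (s := Finset.univ) (a := b)
              (f := fun c => (1 - t c * (X c + if b = c then q else 0))⁻¹) (Finset.mem_univ b),
            ← mul_assoc]
          have herase : ∏ c ∈ Finset.univ.erase b, (1 - t' c * X c)⁻¹ = ∏ c ∈ Finset.univ.erase b,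
              (1 - t c * (X c + if b = c then q else 0))⁻¹ := by
            refine Finset.prod_congr rfl fun c hc => ?_
            have hc' := Finset.ne_of_mem_erase hc
            rw [ht'c c hc', if_neg (Ne.symm hc'), add_zero]
          rw [herase]
          refine mul_le_mul_of_nonneg_right ?_ (Finset.prod_nonneg fun c _ => ?_)
          · rw [if_pos rfl, ← mul_inv]
            exact inv_anti₀ (by linarith) hprod
          · exact inv_nonneg.mpr (by linarith [hlt c])

end Signs

/-! ### Nets on the unit sphere -/

lemma card_le_of_separated_sphere {E : Type*} [NormedAddCommGroup E] [NormedSpace ℝ E]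
    [FiniteDimensional ℝ E] (s : Finset E) (hs : ∀ c ∈ s, ‖c‖ = 1)
    (h : ∀ c ∈ s, ∀ d ∈ s, c ≠ d → 1 / 10 ≤ ‖c - d‖) : s.card ≤ 21 ^ Module.finrank ℝ E := by
  borelize E
  let μ : Measure E := Measure.addHaar
  have D : Set.Pairwise (s : Set E) (Function.onFun Disjoint fun c => Metric.ball (c : E) (1 / 20)) := by
    rintro c hc d hd hcd
    apply Metric.ball_disjoint_ball
    rw [dist_eq_norm]
    linarith [h c hc d hd hcd]
  have hsub : (⋃ c ∈ s, Metric.ball (c : E) (1 / 20)) ⊆ Metric.ball (0 : E) (21 / 20) := by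
    refine Set.iUnion₂_subset fun x hx => Metric.ball_subset_ball' ?_
    rw [dist_zero_right, hs x hx]
    norm_num
  have I : (s.card : ENNReal) * ENNReal.ofReal ((1 / 20 : ℝ) ^ Module.finrank ℝ E) *
      μ (Metric.ball 0 1) ≤
      ENNReal.ofReal ((21 / 20 : ℝ) ^ Module.finrank ℝ E) * μ (Metric.ball 0 1) :=
    calc (s.card : ENNReal) * ENNReal.ofReal ((1 / 20 : ℝ) ^ Module.finrank ℝ E) *
          μ (Metric.ball 0 1) = μ (⋃ c ∈ s, Metric.ball (c : E) (1 / 20)) := by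
          rw [measure_biUnion_finset D fun c _ => measurableSet_ball]
          simp only [μ.addHaar_ball_of_pos _ (show (0 : ℝ) < 1 / 20 by norm_num)]
          simp only [Finset.sum_const, nsmul_eq_mul, mul_assoc]
      _ ≤ μ (Metric.ball (0 : E) (21 / 20)) := measure_mono hsub
      _ = _ := by simp only [μ.addHaar_ball_of_pos _ (show (0 : ℝ) < 21 / 20 by norm_num)]
  have J := (ENNReal.mul_le_mul_iff_left (Metric.measure_ball_pos μ (0 : E) zero_lt_one).ne'
    measure_ball_lt_top.ne).1 I
  have K : (s.card : ℝ) ≤ (21 : ℝ) ^ Module.finrank ℝ E := by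
    have := ENNReal.toReal_le_of_le_ofReal (by positivity) J
    rw [ENNReal.toReal_mul, ENNReal.toReal_ofReal (by positivity), ENNReal.toReal_natCast,
      div_pow, div_pow, one_pow, mul_one_div] at this
    exact (div_le_div_iff_of_pos_right (by positivity)).mp this
  exact_mod_cast K

lemma exists_net_sphere (E : Type*) [NormedAddCommGroup E] [NormedSpace ℝ E]
    [FiniteDimensional ℝ E] : ∃ T : Finset E, (∀ x ∈ T, ‖x‖ = 1) ∧
      T.card ≤ 21 ^ Module.finrank ℝ E ∧ ∀ x : E, ‖x‖ = 1 → ∃ y ∈ T, ‖x - y‖ ≤ 1 / 10 := by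
  classical
  let P : ℕ → Prop := fun n => ∃ s : Finset E, s.card = n ∧ (∀ c ∈ s, ‖c‖ = 1) ∧
    ∀ c ∈ s, ∀ d ∈ s, c ≠ d → 1 / 10 ≤ ‖c - d‖
  set b := 21 ^ Module.finrank ℝ E
  have h0 : P 0 := ⟨∅, by simp, by simp, by simp⟩
  obtain ⟨s, hcard, hs, hsep⟩ := Nat.findGreatest_spec (P := P) (Nat.zero_le b) h0
  refine ⟨s, hs, card_le_of_separated_sphere s hs hsep, fun x hx => ?_⟩
  by_contra! hfar
  have hxs : x ∉ s := fun hxs => by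
    have := hfar x hxs
    rw [sub_self, norm_zero] at this
    linarith
  have hP : P (s.card + 1) := by
    refine ⟨insert x s, Finset.card_insert_of_notMem hxs, ?_, ?_⟩
    · intro c hc
      rcases Finset.mem_insert.mp hc with rfl | hc
      · exact hx
      · exact hs c hc
    · intro c hc d hd hcd
      rcases Finset.mem_insert.mp hc with rfl | hc' <;>
        rcases Finset.mem_insert.mp hd with rfl | hd'
      · exact absurd rfl hcd
      · exact (hfar d hd').le
      · rw [norm_sub_rev]; exact (hfar c hc').le
      · exact hsep c hc' d hd' hcd
  have hle : s.card + 1 ≤ b := by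
    obtain ⟨s', h1, h2, h3⟩ := hP
    rw [← h1]
    exact card_le_of_separated_sphere s' h2 h3
  have := Nat.le_findGreatest hle hP
  omega

lemma ContinuousLinearMap.norm_le_of_net {E F : Type*} [NormedAddCommGroup E] [NormedSpace ℂ E]
    [NormedAddCommGroup F] [NormedSpace ℂ F] (L : E →L[ℂ] F) {T : Finset E}
    (hT : ∀ x : E, ‖x‖ = 1 → ∃ y ∈ T, ‖x - y‖ ≤ 1 / 10) {a : ℝ} (ha : 0 ≤ a)
    (h : ∀ y ∈ T, ‖L y‖ ≤ a) : ‖L‖ ≤ 10 / 9 * a := by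
  have : ‖L‖ ≤ a + ‖L‖ * (1 / 10) := by
    refine ContinuousLinearMap.opNorm_le_of_unit_norm (by positivity) fun x hx => ?_
    obtain ⟨y, hy, hxy⟩ := hT x hx
    calc ‖L x‖ = ‖L y + L (x - y)‖ := by rw [← map_add, add_sub_cancel]
      _ ≤ ‖L y‖ + ‖L (x - y)‖ := norm_add_le _ _
      _ ≤ a + ‖L‖ * (1 / 10) := by
        gcongr
        · exact h y hy
        · exact (L.le_opNorm _).trans (by gcongr)
  linarith

lemma ContinuousLinearMap.norm_le_of_re_inner_le {E : Type*} [NormedAddCommGroup E]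
    [InnerProductSpace ℂ E] (L : E →L[ℂ] E) (hL : ∀ x y, inner ℂ (L x) y = inner ℂ x (L y)) {a : ℝ}
    (ha : 0 ≤ a) (h : ∀ x, ‖x‖ = 1 → |(inner ℂ x (L x)).re| ≤ a) : ‖L‖ ≤ a := by
  have hq : ∀ x, |(inner ℂ x (L x)).re| ≤ a * ‖x‖ ^ 2 := by
    intro x
    by_cases hx : x = 0
    · simp [hx]
    have hx' : ‖x‖ ≠ 0 := norm_ne_zero_iff.mpr hx
    have h1 := h ((‖x‖⁻¹ : ℂ) • x) (by
      rw [norm_smul, norm_inv, Complex.norm_real, norm_norm, inv_mul_cancel₀ hx'])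
    rw [map_smul, inner_smul_left, inner_smul_right, ← Complex.ofReal_inv, Complex.conj_ofReal,
      Complex.re_ofReal_mul, Complex.re_ofReal_mul, abs_mul, abs_mul, abs_inv, abs_norm] at h1
    have hpos : 0 < ‖x‖ := lt_of_le_of_ne (norm_nonneg _) (Ne.symm hx')
    field_simp at h1
    linarith
  refine ContinuousLinearMap.opNorm_le_of_unit_norm ha fun x hx => ?_
  by_cases hLx : L x = 0
  · simp [hLx, ha]
  have hn : ‖L x‖ ≠ 0 := norm_ne_zero_iff.mpr hLx
  set y : E := (‖L x‖⁻¹ : ℂ) • L x with hy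
  have hyn : ‖y‖ = 1 := by
    rw [hy, norm_smul, norm_inv, Complex.norm_real, norm_norm, inv_mul_cancel₀ hn]
  have hyL : (inner ℂ y (L x)).re = ‖L x‖ := by
    rw [hy, inner_smul_left, ← Complex.ofReal_inv, Complex.conj_ofReal, Complex.re_ofReal_mul,
      inner_self_eq_norm_sq_to_K]
    norm_cast
    field_simp
    exact Complex.ofReal_re _
  have hsymm : (inner ℂ x (L y)).re = (inner ℂ y (L x)).re := by
    rw [← hL, ← inner_conj_symm, Complex.conj_re]
  have hpol : (inner ℂ (x + y) (L (x + y))).re - (inner ℂ (x - y) (L (x - y))).re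
      = 4 * (inner ℂ y (L x)).re := by
    simp only [map_add, map_sub, inner_add_left, inner_add_right, inner_sub_left, inner_sub_right,
      Complex.add_re, Complex.sub_re]
    linarith
  have hpar := parallelogram_law_with_norm ℂ x y
  have h1 := (abs_le.mp (hq (x + y))).2
  have h2 := (abs_le.mp (hq (x - y))).1
  rw [hx, hyn] at hpar
  rw [← hyL]
  nlinarith

lemma ContinuousLinearMap.norm_le_of_net_of_symm {E : Type*} [NormedAddCommGroup E]
    [InnerProductSpace ℂ E] (L : E →L[ℂ] E) (hL : ∀ x y, inner ℂ (L x) y = inner ℂ x (L y))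
    {T : Finset E} (hT1 : ∀ x ∈ T, ‖x‖ = 1)
    (hT : ∀ x : E, ‖x‖ = 1 → ∃ y ∈ T, ‖x - y‖ ≤ 1 / 10) {a : ℝ} (ha : 0 ≤ a)
    (h : ∀ y ∈ T, |(inner ℂ y (L y)).re| ≤ a) : ‖L‖ ≤ 5 / 4 * a := by
  have : ‖L‖ ≤ a + ‖L‖ * (1 / 5) := by
    refine norm_le_of_re_inner_le L hL (by positivity) fun x hx => ?_
    obtain ⟨y, hy, hxy⟩ := hT x hx
    have hsplit : inner ℂ x (L x) = inner ℂ y (L y) + (inner ℂ (x - y) (L x) +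
        inner ℂ y (L (x - y))) := by
      rw [map_sub, inner_sub_left, inner_sub_right]; ring
    have hLx : ‖L x‖ ≤ ‖L‖ := by simpa [hx] using L.le_opNorm x
    have hLxy : ‖L (x - y)‖ ≤ ‖L‖ * (1 / 10) := (L.le_opNorm _).trans (by gcongr)
    have e1 : |(inner ℂ (x - y) (L x)).re| ≤ 1 / 10 * ‖L‖ :=
      (Complex.abs_re_le_norm _).trans ((norm_inner_le_norm _ _).trans (by gcongr))
    have e2 : |(inner ℂ y (L (x - y))).re| ≤ ‖L‖ * (1 / 10) := by
      refine (Complex.abs_re_le_norm _).trans ((norm_inner_le_norm _ _).trans ?_)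
      rw [hT1 y hy, one_mul]
      exact hLxy
    rw [hsplit, Complex.add_re, Complex.add_re]
    have := abs_add_le (inner ℂ y (L y)).re
      ((inner ℂ (x - y) (L x)).re + (inner ℂ y (L (x - y))).re)
    have := abs_add_le (inner ℂ (x - y) (L x)).re (inner ℂ y (L (x - y))).re
    linarith [h y hy]
  linarith

/-! ### Operator and Frobenius norms in coordinates -/

open Matrix in
/-- A finite set of unit vectors that suffices, up to constants, to bound the norms of
Hermitian forms and of linear maps on `ℂ^n`. -/
lemma exists_net (n : ℕ) : ∃ T : Finset (Fin n → ℂ), (∀ x ∈ T, ∑ i, ‖x i‖ ^ 2 = 1) ∧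
    T.card ≤ 441 ^ n ∧
    (∀ H : Matrix (Fin n) (Fin n) ℂ, H.IsHermitian → ∀ a : ℝ, 0 ≤ a →
      (∀ x ∈ T, |(star x ⬝ᵥ H *ᵥ x).re| ≤ a) → opNorm H ≤ 5 / 4 * a) ∧
    ∀ (κ : Type) [Fintype κ] (B : Matrix κ (Fin n) ℂ) (a : ℝ), 0 ≤ a →
      (∀ x ∈ T, ∑ i, ‖(B *ᵥ x) i‖ ^ 2 ≤ a) →
        ∀ x, ∑ i, ‖(B *ᵥ x) i‖ ^ 2 ≤ 100 / 81 * a * ∑ i, ‖x i‖ ^ 2 := by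
  classical
  obtain ⟨T, hT1, hTc, hT⟩ := exists_net_sphere (EuclideanSpace ℂ (Fin n))
  have hfin : Module.finrank ℝ (EuclideanSpace ℂ (Fin n)) = 2 * n := by
    rw [← Module.finrank_mul_finrank ℝ ℂ, Complex.finrank_real_complex]
    simp
  have hns : ∀ x : EuclideanSpace ℂ (Fin n), ∑ i, ‖x i‖ ^ 2 = ‖x‖ ^ 2 := fun x =>
    (EuclideanSpace.norm_sq_eq x).symm
  refine ⟨T.image WithLp.ofLp, ?_, ?_, ?_, ?_⟩
  · intro x hx
    obtain ⟨y, hy, rfl⟩ := Finset.mem_image.mp hx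
    rw [hns, hT1 y hy, one_pow]
  · refine Finset.card_image_le.trans (hTc.trans (le_of_eq ?_))
    rw [hfin, pow_mul]
    norm_num
  · intro H hH a ha h
    refine ContinuousLinearMap.norm_le_of_net_of_symm _ ?_ hT1 hT ha ?_
    · intro x y
      exact Matrix.isSymmetric_toEuclideanLin_iff.mpr hH x y
    · intro y hy
      have := h _ (Finset.mem_image_of_mem _ hy)
      convert! this using 3
      rw [EuclideanSpace.inner_eq_star_dotProduct, dotProduct_comm]
      rfl
  · intro κ _ B a ha h x
    let L : EuclideanSpace ℂ (Fin n) →L[ℂ] EuclideanSpace ℂ κ :=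
      LinearMap.toContinuousLinearMap (Matrix.toEuclideanLin B)
    have hL : ∀ y, ‖L y‖ ^ 2 = ∑ i, ‖(B *ᵥ y.ofLp) i‖ ^ 2 := fun y => EuclideanSpace.norm_sq_eq _
    have hLn := ContinuousLinearMap.norm_le_of_net L hT (Real.sqrt_nonneg a) (by
      intro y hy
      apply Real.le_sqrt_of_sq_le
      rw [hL]
      exact h _ (Finset.mem_image_of_mem _ hy))
    have h1 : ‖L (WithLp.toLp 2 x)‖ ^ 2 ≤ (10 / 9 * Real.sqrt a * ‖WithLp.toLp 2 x‖) ^ 2 := by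
      gcongr
      exact (L.le_opNorm _).trans (by gcongr)
    rw [hL, mul_pow, mul_pow, Real.sq_sqrt ha, EuclideanSpace.norm_sq_eq] at h1
    norm_num at h1 ⊢
    exact h1

section Frobenius

variable {ι κ l : Type*} [Fintype ι] [Fintype κ] [Fintype l]

/-- The square of the Frobenius norm. -/
def frobSq (X : Matrix ι κ ℂ) : ℝ := ∑ i, ∑ j, ‖X i j‖ ^ 2

lemma frobSq_nonneg (X : Matrix ι κ ℂ) : 0 ≤ frobSq X :=
  Finset.sum_nonneg fun _ _ => Finset.sum_nonneg fun _ _ => by positivity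

lemma frobSq_conjTranspose (X : Matrix ι κ ℂ) : frobSq X.conjTranspose = frobSq X := by
  simp only [frobSq, Matrix.conjTranspose_apply, norm_star]
  exact Finset.sum_comm

lemma frobSq_mul_le_of_bound {B : Matrix ι κ ℂ} {a : ℝ}
    (hB : ∀ x, ∑ i, ‖(B.mulVec x) i‖ ^ 2 ≤ a * ∑ i, ‖x i‖ ^ 2) (X : Matrix κ l ℂ) :
    frobSq (B * X) ≤ a * frobSq X := by
  rw [frobSq, frobSq, Finset.sum_comm, Finset.sum_comm (s := (univ : Finset κ)), Finset.mul_sum]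
  refine Finset.sum_le_sum fun j _ => ?_
  exact hB fun i => X i j

lemma frobSq_mul_le (X : Matrix ι κ ℂ) (Y : Matrix κ l ℂ) :
    frobSq (X * Y) ≤ frobSq X * frobSq Y := by
  rw [frobSq, frobSq, frobSq, Finset.sum_comm (s := (univ : Finset κ)), Finset.sum_mul_sum]
  refine Finset.sum_le_sum fun i _ => Finset.sum_le_sum fun j _ => ?_
  calc ‖(X * Y) i j‖ ^ 2 ≤ (∑ r, ‖X i r‖ * ‖Y r j‖) ^ 2 := by
        gcongr
        rw [Matrix.mul_apply]
        exact (norm_sum_le _ _).trans (le_of_eq (by simp))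
    _ ≤ _ := Finset.sum_mul_sq_le_sq_mul_sq _ _ _

lemma norm_trace_mul_conjTranspose_sq_le (X Y : Matrix ι κ ℂ) :
    ‖(X * Y.conjTranspose).trace‖ ^ 2 ≤ frobSq X * frobSq Y := by
  simp only [frobSq, Matrix.trace, Matrix.diag_apply, Matrix.mul_apply, Matrix.conjTranspose_apply,
    ← Fintype.sum_prod_type' (f := fun i j => _)]
  calc _ ≤ (∑ p : ι × κ, ‖X p.1 p.2‖ * ‖Y p.1 p.2‖) ^ 2 := by
        gcongr
        exact (norm_sum_le _ _).trans (le_of_eq (by simp))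
    _ ≤ _ := Finset.sum_mul_sq_le_sq_mul_sq _ _ _

end Frobenius

lemma opNorm_nonneg {d : ℕ} (O : Matrix (Fin d) (Fin d) ℂ) : 0 ≤ opNorm O := norm_nonneg _

lemma eq_zero_of_opNorm_eq_zero {d : ℕ} {O : Matrix (Fin d) (Fin d) ℂ} (h : opNorm O = 0) :
    O = 0 := by
  rw [opNorm, norm_eq_zero] at h
  exact Matrix.toEuclideanCLM.injective (h.trans (map_zero _).symm)

lemma opNorm_zero {d : ℕ} : opNorm (0 : Matrix (Fin d) (Fin d) ℂ) = 0 := by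
  simp [opNorm]

lemma sum_norm_sq_mulVec_le {d : ℕ} (O : Matrix (Fin d) (Fin d) ℂ) (u : Fin d → ℂ) :
    ∑ y, ‖(O.mulVec u) y‖ ^ 2 ≤ opNorm O ^ 2 * ∑ y, ‖u y‖ ^ 2 := by
  have h := (Matrix.toEuclideanCLM (n := Fin d) (𝕜 := ℂ) O).le_opNorm (WithLp.toLp 2 u)
  have h2 := pow_le_pow_left₀ (norm_nonneg _) h 2
  rw [mul_pow, EuclideanSpace.norm_sq_eq, EuclideanSpace.norm_sq_eq] at h2
  exact h2

lemma frobSq_opNorm_mul_le {d : ℕ} {l : Type*} [Fintype l] (O : Matrix (Fin d) (Fin d) ℂ)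
    (X : Matrix (Fin d) l ℂ) : frobSq (O * X) ≤ opNorm O ^ 2 * frobSq X :=
  frobSq_mul_le_of_bound (sum_norm_sq_mulVec_le O) X

lemma frobSq_mul_opNorm_le {d : ℕ} {l : Type*} [Fintype l] {O : Matrix (Fin d) (Fin d) ℂ}
    (hO : O.IsHermitian) (X : Matrix l (Fin d) ℂ) : frobSq (X * O) ≤ opNorm O ^ 2 * frobSq X := by
  rw [← frobSq_conjTranspose, Matrix.conjTranspose_mul, hO.eq, ← frobSq_conjTranspose X]
  exact frobSq_opNorm_mul_le _ _

lemma frobSq_conjTranspose_mul_self {ι κ : Type*} [Fintype ι] [Fintype κ] (B : Matrix ι κ ℂ) :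
    ((frobSq B : ℝ) : ℂ) = (B.conjTranspose * B).trace := by
  rw [frobSq, Finset.sum_comm]
  simp only [Matrix.trace, Matrix.diag_apply, Matrix.mul_apply, Matrix.conjTranspose_apply]
  push_cast
  refine Finset.sum_congr rfl fun j _ => Finset.sum_congr rfl fun i _ => ?_
  rw [← Complex.conj_mul']
  rfl

lemma IsState.exists_factor {d : ℕ} {ρ : Matrix (Fin d) (Fin d) ℂ} (hρ : IsState ρ) :
    ∃ B : Matrix (Fin d) (Fin d) ℂ, ρ = B.conjTranspose * B ∧ frobSq B = 1 := by
  obtain ⟨B, hB⟩ := exists_eq_conjTranspose_mul_self hρ.1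
  refine ⟨B, hB, ?_⟩
  have := frobSq_conjTranspose_mul_self B
  rw [← hB, hρ.2] at this
  exact_mod_cast this

lemma IsState.frobSq_le_one {d : ℕ} {ρ : Matrix (Fin d) (Fin d) ℂ} (hρ : IsState ρ) :
    frobSq ρ ≤ 1 := by
  obtain ⟨B, rfl, hB⟩ := hρ.exists_factor
  refine (frobSq_mul_le _ _).trans ?_
  rw [frobSq_conjTranspose, hB, one_mul]

lemma IsState.norm_trace_mul_le {d : ℕ} {ρ : Matrix (Fin d) (Fin d) ℂ} (hρ : IsState ρ)
    {O : Matrix (Fin d) (Fin d) ℂ} (hO : O.IsHermitian) : ‖(O * ρ).trace‖ ≤ opNorm O := by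
  obtain ⟨B, rfl, hB⟩ := hρ.exists_factor
  refine (sq_le_sq₀ (norm_nonneg _) (opNorm_nonneg O)).mp ?_
  rw [← Matrix.mul_assoc, Matrix.trace_mul_comm, ← Matrix.mul_assoc]
  refine (norm_trace_mul_conjTranspose_sq_le _ _).trans ?_
  rw [hB, mul_one]
  exact (frobSq_mul_opNorm_le hO B).trans (by rw [hB, mul_one])

/-! ### Random blocks -/

/-- A choice of signs for `m` blocks of size `k × d`. -/
abbrev Signs (m k d : ℕ) : Type := Fin m × Fin k × Fin d → Fin 4

variable {m k d : ℕ}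

/-- The `j`-th block of complex signs. -/
def block (ω : Signs m k d) (j : Fin m) : Matrix (Fin k) (Fin d) ℂ :=
  Matrix.of fun a y => phase (ω (j, a, y))

/-- The matrix that stacks the adjoints of the blocks. -/
def stackAdjoint (ω : Signs m k d) : Matrix (Fin m × Fin d) (Fin k) ℂ :=
  Matrix.of fun p a => conj (phase (ω (p.1, a, p.2)))

lemma block_apply (ω : Signs m k d) (j : Fin m) (a : Fin k) (y : Fin d) :
    block ω j a y = phase (ω (j, a, y)) := rfl

lemma sum_frobSq_block_conjTranspose_mul {l : Type*} [Fintype l] (ω : Signs m k d)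
    (X : Matrix (Fin k) l ℂ) :
    ∑ j, frobSq ((block ω j).conjTranspose * X) = frobSq (stackAdjoint ω * X) := by
  simp only [frobSq, Fintype.sum_prod_type]
  rfl

lemma frobSq_block (ω : Signs m k d) (j : Fin m) : frobSq (block ω j) = k * d := by
  simp [frobSq, block_apply, norm_phase]

/-- `∑ V_j ρ V_j^*`. -/
def conjSum (ω : Signs m k d) (ρ : Matrix (Fin d) (Fin d) ℂ) : Matrix (Fin k) (Fin k) ℂ :=
  ∑ j, block ω j * ρ * (block ω j).conjTranspose

/-- `∑ V_j O W_j^*`. -/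
def crossSum (g : Signs m k d × Signs m k d) (O : Matrix (Fin d) (Fin d) ℂ) :
    Matrix (Fin k) (Fin k) ℂ :=
  ∑ j, block g.1 j * O * (block g.2 j).conjTranspose

/-- The norm bound satisfied by typical signs. -/
def StackBound (ω : Signs m k d) : Prop :=
  ∀ x, ∑ i, ‖((stackAdjoint ω).mulVec x) i‖ ^ 2 ≤ 5 * (m * d) * ∑ i, ‖x i‖ ^ 2

/-! ### Second moments -/

lemma expect_norm_sq_linear_conj_le {ι : Type*} [Fintype ι] [DecidableEq ι] (c : ι → ℂ) :
    𝔼 ω : ι → Fin 4, ‖∑ s, c s * conj (phase (ω s))‖ ^ 2 ≤ ∑ s, ‖c s‖ ^ 2 := by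
  have := expect_norm_sq_linear_le fun s => conj (c s)
  simp only [RCLike.norm_conj] at this
  refine le_trans (le_of_eq (Finset.expect_congr rfl fun ω _ => ?_)) this
  rw [← RCLike.norm_conj]
  simp

lemma sum_ite_row {M : Type*} [AddCommMonoid M] (j : Fin m) (a : Fin k)
    (F : Fin m × Fin k × Fin d → M) :
    ∑ s : Fin m × Fin k × Fin d, (if s.1 = j ∧ s.2.1 = a then F s else 0) = ∑ y, F (j, a, y) := by
  simp only [Fintype.sum_prod_type, ite_and]
  rw [Finset.sum_eq_single j (fun b _ hb => by simp [hb]) (by simp),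
    Finset.sum_eq_single a (fun b _ hb => by simp [hb]) (by simp)]
  simp

lemma sum_ite_slice {M : Type*} [AddCommMonoid M] (a : Fin k)
    (F : Fin m × Fin k × Fin d → M) :
    ∑ s : Fin m × Fin k × Fin d, (if s.2.1 = a then F s else 0) = ∑ j, ∑ y, F (j, a, y) := by
  simp only [Fintype.sum_prod_type]
  refine Finset.sum_congr rfl fun j _ => ?_
  rw [Finset.sum_eq_single a (fun b _ hb => by simp [hb]) (by simp)]
  simp

lemma expect_frobSq_block_mul_le (ρ : Matrix (Fin d) (Fin d) ℂ) :
    𝔼 ω : Signs m k d, ∑ j, frobSq (block ω j * ρ) ≤ m * k * frobSq ρ := by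
  simp only [frobSq]
  rw [Finset.expect_sum_comm]
  have h : ∀ j : Fin m, 𝔼 ω : Signs m k d, ∑ a, ∑ x, ‖(block ω j * ρ) a x‖ ^ 2
      ≤ k * ∑ z, ∑ x, ‖ρ z x‖ ^ 2 := by
    intro j
    rw [Finset.expect_sum_comm]
    refine (Finset.sum_le_card_nsmul _ _ (∑ z, ∑ x, ‖ρ z x‖ ^ 2) fun a _ => ?_).trans (by simp)
    rw [Finset.expect_sum_comm, Finset.sum_comm]
    refine Finset.sum_le_sum fun x _ => ?_
    have h := expect_norm_sq_linear_le fun s : Fin m × Fin k × Fin d =>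
      if s.1 = j ∧ s.2.1 = a then ρ s.2.2 x else 0
    simp only [ite_mul, zero_mul, apply_ite norm, norm_zero, ite_pow, ne_eq, OfNat.ofNat_ne_zero,
      not_false_eq_true, zero_pow, sum_ite_row] at h
    refine le_trans (le_of_eq (Finset.expect_congr rfl fun ω _ => ?_)) h
    simp only [Matrix.mul_apply, block_apply, mul_comm]
  refine (Finset.sum_le_card_nsmul _ _ _ fun j _ => h j).trans ?_
  simp [mul_assoc]

lemma conjSum_apply (ω : Signs m k d) (ρ : Matrix (Fin d) (Fin d) ℂ) (a b : Fin k) :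
    conjSum ω ρ a b
      = ∑ j, ∑ x, ∑ y, ρ x y * (phase (ω (j, a, x)) * conj (phase (ω (j, b, y)))) := by
  simp only [conjSum, Matrix.sum_apply, Matrix.mul_apply, Matrix.conjTranspose_apply, block_apply,
    Finset.sum_mul]
  refine Finset.sum_congr rfl fun j _ => ?_
  rw [Finset.sum_comm]
  refine Finset.sum_congr rfl fun x _ => Finset.sum_congr rfl fun y _ => ?_
  rw [RCLike.star_def]
  ring

lemma expect_norm_sq_conjSum_apply_le {ρ : Matrix (Fin d) (Fin d) ℂ} (hρ : IsState ρ)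
    (a b : Fin k) :
    𝔼 ω : Signs m k d, ‖conjSum ω ρ a b - if a = b then (m : ℂ) else 0‖ ^ 2 ≤ m := by
  have h := expect_norm_sq_quadratic_le fun s t : Fin m × Fin k × Fin d =>
    if s.2.1 = a then (if t.1 = s.1 ∧ t.2.1 = b then ρ s.2.2 t.2.2 else 0) else 0
  simp only [ite_mul, zero_mul, apply_ite norm, norm_zero, ite_pow, ne_eq, OfNat.ofNat_ne_zero,
      not_false_eq_true, zero_pow, Finset.sum_ite_irrel, Finset.sum_const_zero, sum_ite_row,
      sum_ite_slice] at h
  refine le_trans (le_of_eq (Finset.expect_congr rfl fun ω _ => ?_)) (h.trans ?_)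
  · rw [conjSum_apply]
    congr 3
    have htr : ∑ y, ρ y y = 1 := hρ.2
    by_cases hab : a = b
    · simp [hab, htr]
    · simp [hab]
  · have := hρ.frobSq_le_one
    rw [frobSq] at this
    simp only [Finset.sum_const, Finset.card_univ, Fintype.card_fin, nsmul_eq_mul]
    exact mul_le_of_le_one_right (by positivity) this

lemma expect_frobSq_conjSum_le {ρ : Matrix (Fin d) (Fin d) ℂ} (hρ : IsState ρ) :
    𝔼 ω : Signs m k d, frobSq (conjSum ω ρ) ≤ m * k ^ 2 + 2 * m * k + 2 * m ^ 2 * k := by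
  simp only [frobSq]
  rw [Finset.expect_sum_comm]
  have h : ∀ a b : Fin k, 𝔼 ω : Signs m k d, ‖conjSum ω ρ a b‖ ^ 2
      ≤ m + if a = b then (2 * m + 2 * m ^ 2 : ℝ) else 0 := by
    intro a b
    have h1 := expect_norm_sq_conjSum_apply_le (m := m) hρ a b
    split_ifs with hab
    · rw [if_pos hab] at h1
      have h2 : ∀ ω : Signs m k d, ‖conjSum ω ρ a b‖ ^ 2
          ≤ 2 * ‖conjSum ω ρ a b - (m : ℂ)‖ ^ 2 + 2 * (m : ℝ) ^ 2 := by
        intro ω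
        have h3 : ‖conjSum ω ρ a b‖ ≤ ‖conjSum ω ρ a b - (m : ℂ)‖ + m := by
          have := norm_add_le (conjSum ω ρ a b - (m : ℂ)) (m : ℂ)
          simpa using this
        nlinarith [sq_nonneg (‖conjSum ω ρ a b - (m : ℂ)‖ - m), norm_nonneg (conjSum ω ρ a b),
          norm_nonneg (conjSum ω ρ a b - (m : ℂ))]
      refine (expect_mono h2).trans ?_
      rw [Finset.expect_add_distrib, ← Finset.mul_expect, Fintype.expect_const]
      have : (0 : ℝ) ≤ m := by positivity
      linarith
    · rw [if_neg hab] at h1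
      simpa using h1
  calc _ ≤ ∑ a : Fin k, ∑ b : Fin k, (m + if a = b then (2 * m + 2 * m ^ 2 : ℝ) else 0) := by
        refine Finset.sum_le_sum fun a _ => ?_
        rw [Finset.expect_sum_comm]
        exact Finset.sum_le_sum fun b _ => h a b
    _ = _ := by
        simp [Finset.sum_add_distrib]
        ring

lemma trace_crossSum_mul (g : Signs m k d × Signs m k d) (O : Matrix (Fin d) (Fin d) ℂ)
    (X : Matrix (Fin k) (Fin k) ℂ) :
    (crossSum g O * X).trace = ∑ s : Fin m × Fin k × Fin d,
      (O * ((block g.2 s.1).conjTranspose * X)) s.2.2 s.2.1 * phase (g.1 s) := by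
  rw [crossSum, Matrix.sum_mul, Matrix.trace_sum, Fintype.sum_prod_type]
  refine Finset.sum_congr rfl fun j _ => ?_
  rw [Matrix.mul_assoc, Matrix.mul_assoc, Fintype.sum_prod_type]
  simp only [Matrix.trace, Matrix.diag_apply]
  refine Finset.sum_congr rfl fun a _ => ?_
  rw [Matrix.mul_apply]
  exact Finset.sum_congr rfl fun y _ => mul_comm _ _

lemma trace_crossSum_mul' (g : Signs m k d × Signs m k d) (O : Matrix (Fin d) (Fin d) ℂ)
    (X : Matrix (Fin k) (Fin k) ℂ) :
    (crossSum g O * X).trace = ∑ s : Fin m × Fin k × Fin d,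
      (X * block g.1 s.1 * O) s.2.1 s.2.2 * conj (phase (g.2 s)) := by
  rw [Matrix.trace_mul_comm, crossSum, Matrix.mul_sum, Matrix.trace_sum, Fintype.sum_prod_type]
  refine Finset.sum_congr rfl fun j _ => ?_
  rw [← Matrix.mul_assoc, ← Matrix.mul_assoc, Fintype.sum_prod_type]
  simp only [Matrix.trace, Matrix.diag_apply]
  refine Finset.sum_congr rfl fun a _ => ?_
  rw [Matrix.mul_apply]
  rfl

/-- `∑ V_j ρ V_j^*` against the cross terms, averaged over `W`. -/
lemma expect_norm_sq_trace_crossSum_conjSum_fst_le {O ρ : Matrix (Fin d) (Fin d) ℂ}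
    (hO : O.IsHermitian) (hρ : IsState ρ) {V : Signs m k d} (hV : StackBound V) :
    𝔼 W : Signs m k d, ‖(crossSum (V, W) O * conjSum V ρ).trace‖ ^ 2
      ≤ opNorm O ^ 2 * (5 * (m * d) * frobSq (conjSum V ρ)) := by
  simp only [trace_crossSum_mul']
  refine (expect_norm_sq_linear_conj_le _).trans ?_
  have hS : (conjSum V ρ).conjTranspose = conjSum V ρ := by
    simp only [conjSum, Matrix.conjTranspose_sum, Matrix.conjTranspose_mul,
      Matrix.conjTranspose_conjTranspose, hρ.1.isHermitian.eq, Matrix.mul_assoc]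
  calc ∑ s : Fin m × Fin k × Fin d, ‖(conjSum V ρ * block V s.1 * O) s.2.1 s.2.2‖ ^ 2
      = ∑ j, frobSq (conjSum V ρ * block V j * O) := by
        simp only [Fintype.sum_prod_type, frobSq]
    _ ≤ ∑ j, opNorm O ^ 2 * frobSq ((block V j).conjTranspose * conjSum V ρ) := by
        refine Finset.sum_le_sum fun j _ => (frobSq_mul_opNorm_le hO _).trans (le_of_eq ?_)
        rw [← frobSq_conjTranspose (conjSum V ρ * block V j), Matrix.conjTranspose_mul, hS]
    _ ≤ _ := by
        rw [← Finset.mul_sum, sum_frobSq_block_conjTranspose_mul]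
        gcongr
        exact frobSq_mul_le_of_bound hV _

lemma expect_norm_sq_trace_crossSum_conjSum_snd_le {O ρ : Matrix (Fin d) (Fin d) ℂ}
    {W : Signs m k d} (hW : StackBound W) :
    𝔼 V : Signs m k d, ‖(crossSum (V, W) O * conjSum W ρ).trace‖ ^ 2
      ≤ opNorm O ^ 2 * (5 * (m * d) * frobSq (conjSum W ρ)) := by
  simp only [trace_crossSum_mul]
  refine (expect_norm_sq_linear_le _).trans ?_
  calc ∑ s : Fin m × Fin k × Fin d,
        ‖(O * ((block W s.1).conjTranspose * conjSum W ρ)) s.2.2 s.2.1‖ ^ 2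
      = ∑ j, frobSq (O * ((block W j).conjTranspose * conjSum W ρ)) := by
        simp only [Fintype.sum_prod_type, frobSq]
        exact Finset.sum_congr rfl fun j _ => Finset.sum_comm
    _ ≤ ∑ j, opNorm O ^ 2 * frobSq ((block W j).conjTranspose * conjSum W ρ) :=
        Finset.sum_le_sum fun j _ => frobSq_opNorm_mul_le _ _
    _ ≤ _ := by
        rw [← Finset.mul_sum, sum_frobSq_block_conjTranspose_mul]
        gcongr
        exact frobSq_mul_le_of_bound hW _

lemma expect_norm_sq_trace_crossSum_le (O : Matrix (Fin d) (Fin d) ℂ) :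
    𝔼 g : Signs m k d × Signs m k d, ‖(crossSum g O).trace‖ ^ 2
      ≤ opNorm O ^ 2 * (m * k * d) := by
  rw [expect_prod_type_right]
  refine (expect_mono fun W => ?_).trans (le_of_eq (Fintype.expect_const _))
  have h := fun V : Signs m k d => trace_crossSum_mul (V, W) O 1
  simp only [Matrix.mul_one] at h
  simp only [h]
  refine (expect_norm_sq_linear_le _).trans ?_
  calc ∑ s : Fin m × Fin k × Fin d, ‖(O * (block W s.1).conjTranspose) s.2.2 s.2.1‖ ^ 2
      = ∑ j, frobSq (O * (block W j).conjTranspose) := by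
        simp only [Fintype.sum_prod_type, frobSq]
        exact Finset.sum_congr rfl fun j _ => Finset.sum_comm
    _ ≤ ∑ j : Fin m, opNorm O ^ 2 * (k * d) :=
        Finset.sum_le_sum fun j _ => (frobSq_opNorm_mul_le _ _).trans
          (le_of_eq (by rw [frobSq_conjTranspose, frobSq_block]))
    _ = _ := by simp; ring

lemma trace_crossSum_mul_crossSum (V W : Signs m k d) (O ρ : Matrix (Fin d) (Fin d) ℂ) :
    (crossSum (V, W) O * crossSum (V, W) ρ).trace = ∑ s : Fin m × Fin k × Fin d,
      ∑ t : Fin m × Fin k × Fin d, (O * (block W s.1).conjTranspose) s.2.2 t.2.1 *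
        (ρ * (block W t.1).conjTranspose) t.2.2 s.2.1 * (phase (V s) * phase (V t)) := by
  rw [trace_crossSum_mul]
  refine Finset.sum_congr rfl fun s _ => ?_
  rw [← Matrix.mul_assoc, Matrix.mul_apply, Finset.sum_mul]
  have : ∀ b : Fin k, crossSum (V, W) ρ b s.2.1 = ∑ j, ∑ x,
      phase (V (j, b, x)) * (ρ * (block W j).conjTranspose) x s.2.1 := by
    intro b
    simp only [crossSum, Matrix.sum_apply, Matrix.mul_assoc]
    rfl
  simp only [this, Fintype.sum_prod_type, Finset.mul_sum, Finset.sum_mul]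
  refine Finset.sum_comm.trans (Finset.sum_congr rfl fun j _ => Finset.sum_congr rfl fun b _ =>
    Finset.sum_congr rfl fun x _ => ?_)
  ring

/-- The adjoint of `∑ V_j ρ W_j^*`, against the cross terms. -/
lemma trace_crossSum_mul_crossSum_swap (V W : Signs m k d) (O ρ : Matrix (Fin d) (Fin d) ℂ) :
    (crossSum (V, W) O * crossSum (W, V) ρ).trace = ∑ s : Fin m × Fin k × Fin d,
      ∑ t : Fin m × Fin k × Fin d, (if t.2.1 = s.2.1 then
        (O * (block W s.1).conjTranspose * (block W t.1 * ρ)) s.2.2 t.2.2 else 0) *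
          (phase (V s) * conj (phase (V t))) := by
  rw [trace_crossSum_mul]
  refine Finset.sum_congr rfl fun s _ => ?_
  simp only [ite_mul, zero_mul, sum_ite_slice]
  rw [crossSum, ← Matrix.mul_assoc, Matrix.mul_sum, Matrix.sum_apply, Finset.sum_mul]
  refine Finset.sum_congr rfl fun j _ => ?_
  rw [← Matrix.mul_assoc, Matrix.mul_apply, Finset.sum_mul]
  refine Finset.sum_congr rfl fun x _ => ?_
  rw [Matrix.conjTranspose_apply, block_apply, RCLike.star_def]
  ring

lemma expect_norm_sq_trace_crossSum_mul_crossSum_le {O ρ : Matrix (Fin d) (Fin d) ℂ}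
    (hρ : IsState ρ) :
    𝔼 g : Signs m k d × Signs m k d, ‖(crossSum g O * crossSum g ρ).trace‖ ^ 2
      ≤ 2 * opNorm O ^ 2 * (m ^ 2 * k ^ 2 * d) := by
  rw [expect_prod_type_right]
  have h : ∀ W : Signs m k d, 𝔼 V : Signs m k d,
      ‖(crossSum (V, W) O * crossSum (V, W) ρ).trace‖ ^ 2
        ≤ 2 * (opNorm O ^ 2 * (m * k * d)) * ∑ j, frobSq (block W j * ρ) := by
    intro W
    simp only [trace_crossSum_mul_crossSum]
    refine (expect_norm_sq_bilinear_le _).trans ?_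
    have hsum : ∑ s : Fin m × Fin k × Fin d, ∑ t : Fin m × Fin k × Fin d,
        ‖(O * (block W s.1).conjTranspose) s.2.2 t.2.1 *
          (ρ * (block W t.1).conjTranspose) t.2.2 s.2.1‖ ^ 2
        = (∑ j, frobSq (O * (block W j).conjTranspose)) *
          ∑ j, frobSq (ρ * (block W j).conjTranspose) := by
      simp only [norm_mul, mul_pow, Fintype.sum_prod_type, frobSq, Finset.sum_mul_sum]
      refine Finset.sum_congr rfl fun i _ => ?_
      have h1 : ∀ a : Fin k, ∑ y : Fin d, ∑ j : Fin m, ∑ b : Fin k, ∑ x : Fin d,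
          ‖(O * (block W i).conjTranspose) y b‖ ^ 2 * ‖(ρ * (block W j).conjTranspose) x a‖ ^ 2
          = ∑ j : Fin m, ∑ y : Fin d, ∑ b : Fin k, ∑ x : Fin d,
          ‖(O * (block W i).conjTranspose) y b‖ ^ 2 * ‖(ρ * (block W j).conjTranspose) x a‖ ^ 2 :=
        fun a => Finset.sum_comm
      simp only [h1]
      refine Finset.sum_comm.trans (Finset.sum_congr rfl fun j _ => ?_)
      refine Finset.sum_comm.trans (Finset.sum_congr rfl fun y _ => ?_)
      simp only [← Finset.mul_sum, ← Finset.sum_mul]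
      rw [Finset.sum_comm (s := (univ : Finset (Fin k)))]
    rw [hsum, mul_assoc]
    have h1 : ∑ j, frobSq (O * (block W j).conjTranspose) ≤ opNorm O ^ 2 * (m * k * d) := by
      calc ∑ j, frobSq (O * (block W j).conjTranspose)
          ≤ ∑ j : Fin m, opNorm O ^ 2 * (k * d) :=
            Finset.sum_le_sum fun j _ => (frobSq_opNorm_mul_le _ _).trans
              (le_of_eq (by rw [frobSq_conjTranspose, frobSq_block]))
        _ = _ := by simp; ring
    have h2 : ∑ j, frobSq (ρ * (block W j).conjTranspose) = ∑ j, frobSq (block W j * ρ) := by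
      refine Finset.sum_congr rfl fun j _ => ?_
      rw [← frobSq_conjTranspose, Matrix.conjTranspose_mul, Matrix.conjTranspose_conjTranspose,
        hρ.1.isHermitian.eq]
    rw [h2]
    have h3 : 0 ≤ ∑ j, frobSq (block W j * ρ) := Finset.sum_nonneg fun j _ => frobSq_nonneg _
    gcongr
  refine (expect_mono h).trans ?_
  rw [← Finset.mul_expect]
  have h1 := expect_frobSq_block_mul_le (m := m) (k := k) ρ
  have h2 : 𝔼 W : Signs m k d, ∑ j, frobSq (block W j * ρ) ≤ m * k :=
    h1.trans (mul_le_of_le_one_right (by positivity) hρ.frobSq_le_one)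
  calc _ ≤ 2 * (opNorm O ^ 2 * (m * k * d)) * (m * k) := by gcongr
    _ = _ := by ring

/-- The mean over `V` of the trace of `(∑ V_i O W_i^*) (∑ W_j ρ V_j^*)`. -/
def crossMean (W : Signs m k d) (O ρ : Matrix (Fin d) (Fin d) ℂ) : ℂ :=
  k * ∑ j, (O * (block W j).conjTranspose * (block W j * ρ)).trace

lemma expect_norm_sq_trace_sub_crossMean_le {O ρ : Matrix (Fin d) (Fin d) ℂ}
    {W : Signs m k d} (hW : StackBound W) :
    𝔼 V : Signs m k d, ‖(crossSum (V, W) O * crossSum (W, V) ρ).trace - crossMean W O ρ‖ ^ 2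
      ≤ k * (opNorm O ^ 2 * (5 * (m * d) * ∑ j, frobSq (block W j * ρ))) := by
  have h := expect_norm_sq_quadratic_le fun s t : Fin m × Fin k × Fin d =>
    if t.2.1 = s.2.1 then
        (O * (block W s.1).conjTranspose * (block W t.1 * ρ)) s.2.2 t.2.2 else 0
  have htr : ∑ s : Fin m × Fin k × Fin d, (if s.2.1 = s.2.1 then
      (O * (block W s.1).conjTranspose * (block W s.1 * ρ)) s.2.2 s.2.2 else 0)
      = crossMean W O ρ := by
    simp only [if_true, Fintype.sum_prod_type, crossMean, Matrix.trace, Matrix.diag_apply,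
      Finset.sum_const, Finset.card_univ, Fintype.card_fin, nsmul_eq_mul, Finset.mul_sum]
  rw [htr] at h
  simp only [trace_crossSum_mul_crossSum_swap]
  refine h.trans ?_
  simp only [apply_ite norm, norm_zero, ite_pow, ne_eq, OfNat.ofNat_ne_zero,
      not_false_eq_true, zero_pow, sum_ite_slice]
  calc ∑ s : Fin m × Fin k × Fin d, ∑ j, ∑ x,
        ‖(O * (block W s.1).conjTranspose * (block W j * ρ)) s.2.2 x‖ ^ 2
      = k * ∑ i, ∑ j, frobSq (O * ((block W i).conjTranspose * (block W j * ρ))) := by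
        simp only [Fintype.sum_prod_type, Finset.sum_const, Finset.card_univ, Fintype.card_fin,
          nsmul_eq_mul, ← Finset.mul_sum, frobSq, Matrix.mul_assoc]
        congr 1
        exact Finset.sum_congr rfl fun i _ => Finset.sum_comm
    _ ≤ k * ∑ i, ∑ j, opNorm O ^ 2 * frobSq ((block W i).conjTranspose * (block W j * ρ)) := by
        gcongr
        exact frobSq_opNorm_mul_le _ _
    _ = k * (opNorm O ^ 2 * ∑ j, frobSq (stackAdjoint W * (block W j * ρ))) := by
        simp only [← Finset.mul_sum]
        rw [Finset.sum_comm]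
        simp only [sum_frobSq_block_conjTranspose_mul]
    _ ≤ _ := by
        rw [Finset.mul_sum _ _ (5 * ((m : ℝ) * d))]
        gcongr
        exact frobSq_mul_le_of_bound hW _

lemma expect_norm_sq_crossMean_sub_le {O ρ : Matrix (Fin d) (Fin d) ℂ} (hO : O.IsHermitian)
    (hρ : IsState ρ) :
    𝔼 W : Signs m k d, ‖crossMean W O ρ - m * k ^ 2 * (O * ρ).trace‖ ^ 2
      ≤ opNorm O ^ 2 * (m * k ^ 3) := by
  have h := expect_norm_sq_quadratic_le fun s t : Fin m × Fin k × Fin d =>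
    if t.1 = s.1 ∧ t.2.1 = s.2.1 then (ρ * O) s.2.2 t.2.2 else 0
  simp only [ite_mul, zero_mul, apply_ite norm, norm_zero, ite_pow, ne_eq, OfNat.ofNat_ne_zero,
      not_false_eq_true, zero_pow, sum_ite_row, and_self, if_true] at h
  have hC : ∑ s : Fin m × Fin k × Fin d, ∑ y, ‖(ρ * O) s.2.2 y‖ ^ 2
      ≤ m * k * opNorm O ^ 2 := by
    simp only [Fintype.sum_prod_type, Finset.sum_const, Finset.card_univ, Fintype.card_fin,
      nsmul_eq_mul]
    rw [← mul_assoc]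
    gcongr
    have h1 : frobSq (ρ * O) ≤ opNorm O ^ 2 := by
      exact (frobSq_mul_opNorm_le hO ρ).trans
        (mul_le_of_le_one_right (by positivity) hρ.frobSq_le_one)
    exact h1
  have hmean : ∀ W : Signs m k d, crossMean W O ρ - m * k ^ 2 * (O * ρ).trace
      = k * (∑ s : Fin m × Fin k × Fin d, ∑ y, (ρ * O) s.2.2 y *
          (phase (W s) * conj (phase (W (s.1, s.2.1, y)))) -
          ∑ s : Fin m × Fin k × Fin d, (ρ * O) s.2.2 s.2.2) := by
    intro W
    have h1 : ∑ s : Fin m × Fin k × Fin d, (ρ * O) s.2.2 s.2.2 = m * k * (O * ρ).trace := by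
      rw [Matrix.trace_mul_comm]
      simp only [Fintype.sum_prod_type, Finset.sum_const, Finset.card_univ, Fintype.card_fin,
        nsmul_eq_mul, Matrix.trace, Matrix.diag_apply]
      ring
    have h2 : ∑ j, (O * (block W j).conjTranspose * (block W j * ρ)).trace
        = ∑ s : Fin m × Fin k × Fin d, ∑ y, (ρ * O) s.2.2 y *
          (phase (W s) * conj (phase (W (s.1, s.2.1, y)))) := by
      rw [Fintype.sum_prod_type]
      refine Finset.sum_congr rfl fun j _ => ?_
      have : (O * (block W j).conjTranspose * (block W j * ρ)).trace
          = (block W j * (ρ * O) * (block W j).conjTranspose).trace := by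
        rw [Matrix.trace_mul_comm]
        simp only [Matrix.mul_assoc]
      rw [this, Fintype.sum_prod_type]
      simp only [Matrix.trace, Matrix.diag_apply]
      refine Finset.sum_congr rfl fun a _ => ?_
      simp only [Matrix.mul_apply (M := block W j * (ρ * O)), Matrix.mul_apply (M := block W j),
        Finset.sum_mul]
      rw [Finset.sum_comm]
      refine Finset.sum_congr rfl fun z _ => Finset.sum_congr rfl fun y _ => ?_
      rw [Matrix.conjTranspose_apply, block_apply, block_apply, RCLike.star_def]
      ring
    rw [crossMean, h1, h2]
    ring
  simp only [hmean, norm_mul, mul_pow, ← Finset.mul_expect, Complex.norm_natCast]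
  calc _ ≤ (k : ℝ) ^ 2 * (m * k * opNorm O ^ 2) := by
        gcongr
        exact h.trans hC
    _ = _ := by ring

/-! ### The signal and its fluctuations -/

/-- The unnormalized output `∑ K_j ρ K_j^*` of the random channel, with `K_j = V_j + W_j`. -/
def blockOutput (g : Signs m k d × Signs m k d) (ρ : Matrix (Fin d) (Fin d) ℂ) :
    Matrix (Fin k) (Fin k) ℂ :=
  ∑ j, (block g.1 j + block g.2 j) * ρ * (block g.1 j + block g.2 j).conjTranspose

lemma blockOutput_eq (g : Signs m k d × Signs m k d) (ρ : Matrix (Fin d) (Fin d) ℂ) :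
    blockOutput g ρ = conjSum g.1 ρ + conjSum g.2 ρ + crossSum g ρ + crossSum (g.2, g.1) ρ := by
  simp only [blockOutput, conjSum, crossSum, ← Finset.sum_add_distrib]
  refine Finset.sum_congr rfl fun j _ => ?_
  simp only [Matrix.conjTranspose_add, Matrix.add_mul, Matrix.mul_add]
  abel

/-- The deviation of the cross terms from their mean. -/
def deviation (g : Signs m k d × Signs m k d) (O ρ : Matrix (Fin d) (Fin d) ℂ) : ℂ :=
  (crossSum g O * blockOutput g ρ).trace - m * k ^ 2 * (O * ρ).trace

lemma norm_add_five_sq_le (a b c e f : ℂ) :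
    ‖a + b + c + e + f‖ ^ 2 ≤ 5 * (‖a‖ ^ 2 + ‖b‖ ^ 2 + ‖c‖ ^ 2 + ‖e‖ ^ 2 + ‖f‖ ^ 2) := by
  have h1 : ‖a + b + c + e + f‖ ≤ ‖a‖ + ‖b‖ + ‖c‖ + ‖e‖ + ‖f‖ := by
    have := norm_add_le (a + b + c + e) f
    have := norm_add_le (a + b + c) e
    have := norm_add_le (a + b) c
    have := norm_add_le a b
    linarith
  have h3 : ‖a + b + c + e + f‖ ^ 2 ≤ (‖a‖ + ‖b‖ + ‖c‖ + ‖e‖ + ‖f‖) ^ 2 := by gcongr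
  nlinarith [sq_nonneg (‖a‖ - ‖b‖), sq_nonneg (‖a‖ - ‖c‖), sq_nonneg (‖a‖ - ‖e‖),
    sq_nonneg (‖a‖ - ‖f‖), sq_nonneg (‖b‖ - ‖c‖), sq_nonneg (‖b‖ - ‖e‖), sq_nonneg (‖b‖ - ‖f‖),
    sq_nonneg (‖c‖ - ‖e‖), sq_nonneg (‖c‖ - ‖f‖), sq_nonneg (‖e‖ - ‖f‖)]

open Classical in
lemma expect_ite_fst_le {G H : Type*} [Fintype G] [Fintype H] [Nonempty H] (p : G → Prop)
    (F : G → H → ℝ) (b : G → ℝ) (hb : ∀ g, 0 ≤ b g) (h : ∀ g, p g → 𝔼 x, F g x ≤ b g) :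
    𝔼 x : G × H, (if p x.1 then F x.1 x.2 else 0) ≤ 𝔼 g, b g := by
  rw [expect_prod_type]
  refine expect_mono fun g => ?_
  by_cases hp : p g
  · simpa [hp] using h g hp
  · simpa [hp] using hb g

open Classical in
lemma expect_ite_snd_le {G H : Type*} [Fintype G] [Fintype H] [Nonempty G] (p : H → Prop)
    (F : G → H → ℝ) (b : H → ℝ) (hb : ∀ g, 0 ≤ b g) (h : ∀ g, p g → 𝔼 x, F x g ≤ b g) :
    𝔼 x : G × H, (if p x.2 then F x.1 x.2 else 0) ≤ 𝔼 g, b g := by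
  rw [expect_prod_type_right]
  refine expect_mono fun g => ?_
  by_cases hp : p g
  · simpa [hp] using h g hp
  · simpa [hp] using hb g

lemma prob_deviation_le {O ρ : Matrix (Fin d) (Fin d) ℂ} (hO : O.IsHermitian) (hρ : IsState ρ)
    {a : ℝ} (ha : 0 < a) :
    prob (fun g : Signs m k d × Signs m k d =>
      StackBound g.1 ∧ StackBound g.2 ∧ a ≤ ‖deviation g O ρ‖) ≤
      5 * opNorm O ^ 2 * (2 * (5 * (m * d) * (m * k ^ 2 + 2 * m * k + 2 * m ^ 2 * k)) +
        7 * (m ^ 2 * k ^ 2 * d) + m * k ^ 3) / a ^ 2 := by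
  classical
  let A1 : Signs m k d → Signs m k d → ℝ := fun V W =>
    ‖(crossSum (V, W) O * conjSum V ρ).trace‖ ^ 2
  let A2 : Signs m k d → Signs m k d → ℝ := fun V W =>
    ‖(crossSum (V, W) O * conjSum W ρ).trace‖ ^ 2
  let A3 : Signs m k d × Signs m k d → ℝ := fun g => ‖(crossSum g O * crossSum g ρ).trace‖ ^ 2
  let A4 : Signs m k d → Signs m k d → ℝ := fun V W =>
    ‖(crossSum (V, W) O * crossSum (W, V) ρ).trace - crossMean W O ρ‖ ^ 2
  let A5 : Signs m k d → ℝ := fun W => ‖crossMean W O ρ - m * k ^ 2 * (O * ρ).trace‖ ^ 2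
  let X : Signs m k d × Signs m k d → ℝ := fun g =>
    5 * ((if StackBound g.1 then A1 g.1 g.2 else 0) + (if StackBound g.2 then A2 g.1 g.2 else 0) +
      A3 g + (if StackBound g.2 then A4 g.1 g.2 else 0) + A5 g.2)
  have hX0 : ∀ g, 0 ≤ X g := by
    intro g
    refine mul_nonneg (by norm_num) (add_nonneg (add_nonneg (add_nonneg (add_nonneg ?_ ?_) ?_) ?_) ?_)
    · split_ifs
      exacts [sq_nonneg _, le_rfl]
    · split_ifs
      exacts [sq_nonneg _, le_rfl]
    · exact sq_nonneg _
    · split_ifs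
      exacts [sq_nonneg _, le_rfl]
    · exact sq_nonneg _
  refine (prob_le_of_le (X := X) (a := a ^ 2) (by positivity) hX0 ?_).trans ?_
  · rintro g ⟨hV, hW, hdev⟩
    simp only [X, hV, hW, if_true]
    have hsplit : deviation g O ρ = (crossSum g O * conjSum g.1 ρ).trace +
        (crossSum g O * conjSum g.2 ρ).trace + (crossSum g O * crossSum g ρ).trace +
        ((crossSum g O * crossSum (g.2, g.1) ρ).trace - crossMean g.2 O ρ) +
        (crossMean g.2 O ρ - m * k ^ 2 * (O * ρ).trace) := by
      rw [deviation, blockOutput_eq]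
      simp only [Matrix.mul_add, Matrix.trace_add]
      ring
    calc a ^ 2 ≤ ‖deviation g O ρ‖ ^ 2 := by gcongr
      _ ≤ _ := by
        rw [hsplit]
        exact norm_add_five_sq_le _ _ _ _ _
  · refine div_le_div_of_nonneg_right ?_ (sq_nonneg a)
    have hS := expect_frobSq_conjSum_le (m := m) (k := k) hρ
    have e1 : 𝔼 g : Signs m k d × Signs m k d, (if StackBound g.1 then A1 g.1 g.2 else 0)
        ≤ opNorm O ^ 2 * (5 * (m * d) * (m * k ^ 2 + 2 * m * k + 2 * m ^ 2 * k)) := by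
      refine (expect_ite_fst_le _ A1
        (fun V => opNorm O ^ 2 * (5 * (m * d) * frobSq (conjSum V ρ)))
        (fun V => by have := frobSq_nonneg (conjSum V ρ); positivity)
        fun V hV => expect_norm_sq_trace_crossSum_conjSum_fst_le hO hρ hV).trans ?_
      rw [← Finset.mul_expect, ← Finset.mul_expect]
      gcongr
    have e2 : 𝔼 g : Signs m k d × Signs m k d, (if StackBound g.2 then A2 g.1 g.2 else 0)
        ≤ opNorm O ^ 2 * (5 * (m * d) * (m * k ^ 2 + 2 * m * k + 2 * m ^ 2 * k)) := by
      refine (expect_ite_snd_le _ A2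
        (fun V => opNorm O ^ 2 * (5 * (m * d) * frobSq (conjSum V ρ)))
        (fun V => by have := frobSq_nonneg (conjSum V ρ); positivity)
        fun V hV => expect_norm_sq_trace_crossSum_conjSum_snd_le hV).trans ?_
      rw [← Finset.mul_expect, ← Finset.mul_expect]
      gcongr
    have e3 : 𝔼 g, A3 g ≤ 2 * opNorm O ^ 2 * (m ^ 2 * k ^ 2 * d) :=
      expect_norm_sq_trace_crossSum_mul_crossSum_le hρ
    have hB : 𝔼 W : Signs m k d, ∑ j, frobSq (block W j * ρ) ≤ m * k :=
      (expect_frobSq_block_mul_le ρ).trans (mul_le_of_le_one_right (by positivity) hρ.frobSq_le_one)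
    have e4 : 𝔼 g : Signs m k d × Signs m k d, (if StackBound g.2 then A4 g.1 g.2 else 0)
        ≤ k * (opNorm O ^ 2 * (5 * (m * d) * (m * k))) := by
      refine (expect_ite_snd_le _ A4
        (fun W => k * (opNorm O ^ 2 * (5 * (m * d) * ∑ j, frobSq (block W j * ρ))))
        (fun W => by
          have := Finset.sum_nonneg fun j (_ : j ∈ univ) => frobSq_nonneg (block W j * ρ)
          positivity)
        fun W hW => expect_norm_sq_trace_sub_crossMean_le hW).trans ?_
      rw [← Finset.mul_expect, ← Finset.mul_expect, ← Finset.mul_expect]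
      gcongr
    have e5 : 𝔼 g : Signs m k d × Signs m k d, A5 g.2 ≤ opNorm O ^ 2 * (m * k ^ 3) := by
      rw [expect_prod_type_right]
      simp only [Fintype.expect_const]
      exact expect_norm_sq_crossMean_sub_le hO hρ
    simp only [X]
    rw [← Finset.mul_expect, Finset.expect_add_distrib, Finset.expect_add_distrib,
      Finset.expect_add_distrib, Finset.expect_add_distrib]
    calc _ ≤ 5 * (opNorm O ^ 2 * (5 * (m * d) * (m * k ^ 2 + 2 * m * k + 2 * m ^ 2 * k)) +
          opNorm O ^ 2 * (5 * (m * d) * (m * k ^ 2 + 2 * m * k + 2 * m ^ 2 * k)) +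
          2 * opNorm O ^ 2 * (m ^ 2 * k ^ 2 * d) +
          k * (opNorm O ^ 2 * (5 * (m * d) * (m * k))) + opNorm O ^ 2 * (m * k ^ 3)) :=
          mul_le_mul_of_nonneg_left
            (add_le_add (add_le_add (add_le_add (add_le_add e1 e2) e3) e4) e5) (by norm_num)
      _ = _ := by ring

lemma prob_trace_crossSum_le (O : Matrix (Fin d) (Fin d) ℂ) {a : ℝ} (ha : 0 < a) :
    prob (fun g : Signs m k d × Signs m k d => a ≤ ‖(crossSum g O).trace‖) ≤
      opNorm O ^ 2 * (m * k * d) / a ^ 2 := by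
  refine (prob_le_of_le (X := fun g : Signs m k d × Signs m k d => ‖(crossSum g O).trace‖ ^ 2)
    (a := a ^ 2) (by positivity) (fun g => by positivity) fun g hg => by gcongr).trans ?_
  gcongr
  exact expect_norm_sq_trace_crossSum_le O

/-! ### Tail bounds -/

lemma sum_filter_column {M : Type*} [AddCommMonoid M] (b : Fin m × Fin d)
    (F : Fin m × Fin k × Fin d → M) :
    ∑ s : Fin m × Fin k × Fin d with (s.1, s.2.2) = b, F s = ∑ a, F (b.1, a, b.2) := by
  rw [Finset.sum_filter]
  simp only [Fintype.sum_prod_type, Prod.ext_iff, ite_and]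
  rw [Finset.sum_eq_single b.1 (fun j _ hj => by simp [hj]) (by simp)]
  refine Finset.sum_congr rfl fun a _ => ?_
  rw [Finset.sum_eq_single b.2 (fun j _ hj => by simp [hj]) (by simp)]
  simp

lemma sum_filter_row {M : Type*} [AddCommMonoid M] (b : Fin m × Fin k)
    (F : Fin m × Fin k × Fin d → M) :
    ∑ s : Fin m × Fin k × Fin d with (s.1, s.2.1) = b, F s = ∑ y, F (b.1, b.2, y) := by
  rw [Finset.sum_filter, ← sum_ite_row]
  simp only [Prod.ext_iff]

lemma expect_exp_stackAdjoint_le {t : ℝ} (ht : 0 ≤ t) (ht1 : t < 1) {x : Fin k → ℂ}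
    (hx : ∑ i, ‖x i‖ ^ 2 = 1) :
    𝔼 ω : Signs m k d, Real.exp (t * ∑ i, ‖((stackAdjoint ω).mulVec x) i‖ ^ 2)
      ≤ (1 - t)⁻¹ ^ (m * d) := by
  have hc : ∀ b : Fin m × Fin d, ∑ s : Fin m × Fin k × Fin d with (s.1, s.2.2) = b,
      ‖conj (x s.2.1)‖ ^ 2 = 1 := by
    intro b
    rw [sum_filter_column b fun s => ‖conj (x s.2.1)‖ ^ 2]
    simpa only [RCLike.norm_conj] using hx
  have h := expect_exp_sum_sq_le (fun s : Fin m × Fin k × Fin d => (s.1, s.2.2))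
    (fun s => conj (x s.2.1)) univ (fun _ => t) (fun _ => ht)
    (fun b => by rw [hc b, mul_one]; exact ht1)
  simp only [hc, mul_one, Finset.prod_const, Finset.card_univ, Fintype.card_prod,
    Fintype.card_fin] at h
  refine le_trans (le_of_eq (Finset.expect_congr rfl fun ω _ => ?_)) h
  rw [Finset.mul_sum]
  congr 1
  refine Finset.sum_congr rfl fun b _ => ?_
  rw [sum_filter_column b fun s => conj (x s.2.1) * phase (ω s), ← RCLike.norm_conj]
  simp [Matrix.mulVec, dotProduct, stackAdjoint, mul_comm]

lemma prob_not_stackBound_le :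
    prob (fun ω : Signs m k d => ¬ StackBound ω)
      ≤ 441 ^ k * (4 ^ (m * d) * Real.exp (-(243 / 80) * (m * d))) := by
  obtain ⟨T, hT1, hTc, -, hT⟩ := exists_net k
  have hone : ∀ x ∈ T, prob (fun ω : Signs m k d => 81 / 20 * (m * d : ℝ) ≤
      ∑ i, ‖((stackAdjoint ω).mulVec x) i‖ ^ 2)
      ≤ 4 ^ (m * d) * Real.exp (-(243 / 80) * (m * d)) := by
    intro x hx
    refine (prob_le_of_le (a := Real.exp (3 / 4 * (81 / 20 * (m * d : ℝ)))) (Real.exp_pos _)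
      (X := fun ω => Real.exp (3 / 4 * ∑ i, ‖((stackAdjoint ω).mulVec x) i‖ ^ 2))
      (fun _ => (Real.exp_pos _).le) fun ω hω => by gcongr).trans ?_
    rw [div_eq_mul_inv, ← Real.exp_neg]
    have h := expect_exp_stackAdjoint_le (m := m) (d := d) (t := 3 / 4) (by norm_num) (by norm_num)
      (hT1 x hx)
    norm_num at h
    have e : -(3 / 4 * (81 / 20 * ((m : ℝ) * d))) = -(243 / 80) * (m * d) := by ring
    rw [e]
    gcongr
  calc prob (fun ω : Signs m k d => ¬ StackBound ω)
      ≤ prob (fun ω : Signs m k d => ∃ x ∈ T, 81 / 20 * (m * d : ℝ) ≤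
          ∑ i, ‖((stackAdjoint ω).mulVec x) i‖ ^ 2) := by
        refine prob_mono fun ω hω => ?_
        by_contra! hcon
        apply hω
        intro x
        have := hT _ (stackAdjoint ω) (81 / 20 * (m * d : ℝ)) (by positivity)
          (fun x hx => (hcon x hx).le) x
        refine this.trans (le_of_eq ?_)
        ring
    _ ≤ ∑ x ∈ T, prob (fun ω : Signs m k d => 81 / 20 * (m * d : ℝ) ≤
          ∑ i, ‖((stackAdjoint ω).mulVec x) i‖ ^ 2) := prob_exists_le T _
    _ ≤ T.card • (4 ^ (m * d) * Real.exp (-(243 / 80) * (m * d))) :=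
        Finset.sum_le_card_nsmul _ _ _ hone
    _ ≤ _ := by
        rw [nsmul_eq_mul]
        gcongr
        exact_mod_cast hTc

/-- The matrix that stacks the blocks `V_j + W_j`. -/
def stackSum (g : Signs m k d × Signs m k d) : Matrix (Fin m × Fin k) (Fin d) ℂ :=
  Matrix.of fun p y => block g.1 p.1 p.2 y + block g.2 p.1 p.2 y

/-- The bound that makes the Kraus operators `V_j + W_j`, divided by `√τ`, subnormalized. -/
def KrausBound (τ : ℝ) (g : Signs m k d × Signs m k d) : Prop :=
  ∀ x, ∑ i, ‖((stackSum g).mulVec x) i‖ ^ 2 ≤ τ * ∑ i, ‖x i‖ ^ 2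

lemma sum_filter_row_sum {M : Type*} [AddCommMonoid M] (b : Fin m × Fin k)
    (F : (Fin m × Fin k × Fin d) ⊕ (Fin m × Fin k × Fin d) → M) :
    ∑ s : (Fin m × Fin k × Fin d) ⊕ (Fin m × Fin k × Fin d) with
      Sum.elim (fun s => (s.1, s.2.1)) (fun s => (s.1, s.2.1)) s = b, F s
      = ∑ y, F (.inl (b.1, b.2, y)) + ∑ y, F (.inr (b.1, b.2, y)) := by
  rw [Finset.sum_filter, Fintype.sum_sum_type]
  have h1 := sum_filter_row b fun s => F (.inl s)
  have h2 := sum_filter_row b fun s => F (.inr s)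
  rw [Finset.sum_filter] at h1 h2
  exact congrArg₂ (· + ·) h1 h2

lemma expect_exp_stackSum_le {t : ℝ} (ht : 0 ≤ t) (ht1 : t * 2 < 1) {x : Fin d → ℂ}
    (hx : ∑ i, ‖x i‖ ^ 2 = 1) :
    𝔼 g : Signs m k d × Signs m k d, Real.exp (t * ∑ i, ‖((stackSum g).mulVec x) i‖ ^ 2)
      ≤ (1 - t * 2)⁻¹ ^ (m * k) := by
  let π : (Fin m × Fin k × Fin d) ⊕ (Fin m × Fin k × Fin d) → Fin m × Fin k :=
    Sum.elim (fun s => (s.1, s.2.1)) (fun s => (s.1, s.2.1))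
  let x' : (Fin m × Fin k × Fin d) ⊕ (Fin m × Fin k × Fin d) → ℂ :=
    Sum.elim (fun s => x s.2.2) (fun s => x s.2.2)
  have hc : ∀ b : Fin m × Fin k, ∑ s with π s = b, ‖x' s‖ ^ 2 = 2 := by
    intro b
    rw [sum_filter_row_sum b fun s => ‖x' s‖ ^ 2]
    simp only [x', Sum.elim_inl, Sum.elim_inr, hx]
    norm_num
  have h := expect_exp_sum_sq_le π x' univ (fun _ => t) (fun _ => ht)
    (fun b => by rw [hc b]; exact ht1)
  simp only [hc, Finset.prod_const, Finset.card_univ, Fintype.card_prod,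
    Fintype.card_fin] at h
  rw [← expect_comp_equiv (Equiv.sumArrowEquivProdArrow _ _ _)]
  refine le_trans (le_of_eq (Finset.expect_congr rfl fun ω _ => ?_)) h
  rw [Finset.mul_sum]
  congr 1
  refine Finset.sum_congr rfl fun b _ => ?_
  rw [sum_filter_row_sum b fun s => x' s * phase (ω s), ← Finset.sum_add_distrib]
  congr 3
  simp only [Matrix.mulVec, dotProduct, stackSum, Matrix.of_apply, block_apply]
  refine Finset.sum_congr rfl fun y _ => ?_
  simp only [x', Sum.elim_inl, Sum.elim_inr, Equiv.sumArrowEquivProdArrow, Equiv.coe_fn_mk,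
    Function.comp]
  ring

lemma prob_not_krausBound_le {τ : ℝ} (hτ : 0 ≤ τ) :
    prob (fun g : Signs m k d × Signs m k d => ¬ KrausBound (100 / 81 * τ) g)
      ≤ 441 ^ d * (4 ^ (m * k) * Real.exp (-(3 / 8 * τ))) := by
  obtain ⟨T, hT1, hTc, -, hT⟩ := exists_net d
  have hone : ∀ x ∈ T, prob (fun g : Signs m k d × Signs m k d => τ ≤
      ∑ i, ‖((stackSum g).mulVec x) i‖ ^ 2)
      ≤ 4 ^ (m * k) * Real.exp (-(3 / 8 * τ)) := by
    intro x hx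
    refine (prob_le_of_le (a := Real.exp (3 / 8 * τ)) (Real.exp_pos _)
      (X := fun g => Real.exp (3 / 8 * ∑ i, ‖((stackSum g).mulVec x) i‖ ^ 2))
      (fun _ => (Real.exp_pos _).le) fun ω hω => by gcongr).trans ?_
    rw [div_eq_mul_inv, ← Real.exp_neg]
    have h := expect_exp_stackSum_le (m := m) (k := k) (t := 3 / 8) (by norm_num) (by norm_num)
      (hT1 x hx)
    norm_num at h
    gcongr
  calc prob (fun g : Signs m k d × Signs m k d => ¬ KrausBound (100 / 81 * τ) g)
      ≤ prob (fun g : Signs m k d × Signs m k d => ∃ x ∈ T, τ ≤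
          ∑ i, ‖((stackSum g).mulVec x) i‖ ^ 2) := by
        refine prob_mono fun g hg => ?_
        by_contra! hcon
        apply hg
        intro x
        exact hT _ (stackSum g) τ hτ (fun x hx => (hcon x hx).le) x
    _ ≤ ∑ x ∈ T, prob (fun g : Signs m k d × Signs m k d => τ ≤
          ∑ i, ‖((stackSum g).mulVec x) i‖ ^ 2) := prob_exists_le T _
    _ ≤ T.card • (4 ^ (m * k) * Real.exp (-(3 / 8 * τ))) :=
        Finset.sum_le_card_nsmul _ _ _ hone
    _ ≤ _ := by
        rw [nsmul_eq_mul]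
        gcongr
        exact_mod_cast hTc

/-- The observable on `ℂ^k` that is queried in place of `O`. -/
def query (g : Signs m k d × Signs m k d) (O : Matrix (Fin d) (Fin d) ℂ) :
    Matrix (Fin k) (Fin k) ℂ :=
  crossSum g O + (crossSum g O).conjTranspose

lemma isHermitian_query (g : Signs m k d × Signs m k d) (O : Matrix (Fin d) (Fin d) ℂ) :
    (query g O).IsHermitian := by
  rw [Matrix.IsHermitian, query, Matrix.conjTranspose_add, Matrix.conjTranspose_conjTranspose,
    add_comm]

open Matrix in
lemma query_form_re (g : Signs m k d × Signs m k d) (O : Matrix (Fin d) (Fin d) ℂ)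
    (x : Fin k → ℂ) :
    (star x ⬝ᵥ query g O *ᵥ x).re = 2 * (∑ s : Fin m × Fin k × Fin d,
      conj (x s.2.1) * (O *ᵥ ((block g.2 s.1)ᴴ *ᵥ x)) s.2.2 * phase (g.1 s)).re := by
  have h1 : star x ⬝ᵥ crossSum g O *ᵥ x = ∑ s : Fin m × Fin k × Fin d,
      conj (x s.2.1) * (O *ᵥ ((block g.2 s.1)ᴴ *ᵥ x)) s.2.2 * phase (g.1 s) := by
    rw [crossSum, Matrix.sum_mulVec, dotProduct_sum, Fintype.sum_prod_type]
    refine Finset.sum_congr rfl fun j _ => ?_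
    rw [← Matrix.mulVec_mulVec, ← Matrix.mulVec_mulVec, Fintype.sum_prod_type]
    simp only [dotProduct]
    refine Finset.sum_congr rfl fun a _ => ?_
    rw [Matrix.mulVec, dotProduct, Finset.mul_sum]
    refine Finset.sum_congr rfl fun y _ => ?_
    rw [block_apply, Pi.star_apply, RCLike.star_def]
    ring
  have h2 : star x ⬝ᵥ (crossSum g O)ᴴ *ᵥ x = conj (star x ⬝ᵥ crossSum g O *ᵥ x) := by
    rw [← RCLike.star_def, ← Matrix.star_dotProduct_star, star_star, Matrix.star_mulVec,
      dotProduct_comm, ← Matrix.dotProduct_mulVec]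
    exact dotProduct_comm _ _
  rw [query, Matrix.add_mulVec, dotProduct_add, h2, Complex.add_re, Complex.conj_re, h1]
  ring

open Matrix in
lemma expect_exp_query_le {O : Matrix (Fin d) (Fin d) ℂ} {c : ℝ}
    (hc : c ^ 2 * opNorm O ^ 2 < 1) {x : Fin k → ℂ} (hx : ∑ i, ‖x i‖ ^ 2 = 1) :
    𝔼 g : Signs m k d × Signs m k d, Real.exp (c * (star x ⬝ᵥ query g O *ᵥ x).re)
      ≤ (1 - c ^ 2 * opNorm O ^ 2)⁻¹ ^ (m * d) := by
  rw [expect_prod_type_right]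
  refine (expect_mono fun W => ?_).trans
    (expect_exp_stackAdjoint_le (m := m) (d := d) (by positivity) hc hx)
  have h := expect_exp_re_linear_le fun s : Fin m × Fin k × Fin d =>
    (2 * c : ℝ) * (conj (x s.2.1) * (O *ᵥ ((block W s.1)ᴴ *ᵥ x)) s.2.2)
  refine le_trans (le_of_eq (Finset.expect_congr rfl fun V _ => ?_)) (h.trans ?_)
  · rw [query_form_re]
    simp only [mul_assoc, ← Finset.mul_sum]
    rw [Complex.re_ofReal_mul]
    congr 1
    ring
  · apply Real.exp_le_exp.mpr
    have h1 : ∀ s : Fin m × Fin k × Fin d,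
        ‖((2 * c : ℝ) : ℂ) * (conj (x s.2.1) * (O *ᵥ ((block W s.1)ᴴ *ᵥ x)) s.2.2)‖ ^ 2 / 4
        = c ^ 2 * (‖x s.2.1‖ ^ 2 * ‖(O *ᵥ ((block W s.1)ᴴ *ᵥ x)) s.2.2‖ ^ 2) := by
      intro s
      rw [norm_mul, norm_mul, RCLike.norm_conj, Complex.norm_real, mul_pow, mul_pow,
        Real.norm_eq_abs, sq_abs]
      ring
    simp only [h1, ← Finset.mul_sum]
    rw [mul_assoc]
    gcongr
    have h2 : ∑ s : Fin m × Fin k × Fin d,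
        ‖x s.2.1‖ ^ 2 * ‖(O *ᵥ ((block W s.1)ᴴ *ᵥ x)) s.2.2‖ ^ 2
        = ∑ j, ∑ y, ‖(O *ᵥ ((block W j)ᴴ *ᵥ x)) y‖ ^ 2 := by
      rw [Fintype.sum_prod_type]
      refine Finset.sum_congr rfl fun j _ => ?_
      rw [Fintype.sum_prod_type]
      simp only [← Finset.mul_sum, ← Finset.sum_mul, hx, one_mul]
    rw [h2, Fintype.sum_prod_type, Finset.mul_sum]
    exact Finset.sum_le_sum fun j _ => sum_norm_sq_mulVec_le O _

lemma inv_one_sub_pow_le {n : ℕ} {r u : ℝ} (hu : 0 ≤ u) (hu' : u ≤ 1 / 2) (hr : n * u = r) :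
    (1 - u)⁻¹ ^ n ≤ Real.exp (r * (2 * Real.log 2)) := by
  have h1 : Real.exp (-(u * (2 * Real.log 2))) ≤ 1 - u := by
    have h := convexOn_exp.2 (Set.mem_univ (-Real.log 2)) (Set.mem_univ 0)
      (show (0 : ℝ) ≤ 2 * u by linarith) (show (0 : ℝ) ≤ 1 - 2 * u by linarith) (by ring)
    simp only [smul_eq_mul, mul_zero, add_zero, Real.exp_zero, Real.exp_neg,
      Real.exp_log (show (0 : ℝ) < 2 by norm_num)] at h
    have e : 2 * u * -Real.log 2 = -(u * (2 * Real.log 2)) := by ring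
    rw [e] at h
    linarith
  have h2 : (1 - u)⁻¹ ≤ Real.exp (u * (2 * Real.log 2)) := by
    rw [← inv_inv (Real.exp _), ← Real.exp_neg]
    exact inv_anti₀ (Real.exp_pos _) h1
  calc (1 - u)⁻¹ ^ n ≤ Real.exp (u * (2 * Real.log 2)) ^ n := by
        gcongr
        exact inv_nonneg.mpr (by linarith)
    _ = _ := by rw [← Real.exp_nat_mul, ← hr]; ring_nf

open Matrix in
lemma prob_opNorm_query_le {O : Matrix (Fin d) (Fin d) ℂ} (hO : 0 < opNorm O) (hk : 0 < k)
    (hmd : 4 * k ≤ m * d) :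
    prob (fun g : Signs m k d × Signs m k d =>
      8 * Real.sqrt (m * d * k) * opNorm O < opNorm (query g O))
      ≤ 441 ^ k * (2 * (16 ^ k * Real.exp (-(9 * k)))) := by
  obtain ⟨T, hT1, hTc, hT, -⟩ := exists_net k
  set N := opNorm O with hN
  have hkR : (0 : ℝ) < k := by exact_mod_cast hk
  have hmdR : 4 * (k : ℝ) ≤ m * d := by exact_mod_cast hmd
  have hmdpos : (0 : ℝ) < m * d := by linarith
  set a := 32 / 5 * Real.sqrt (m * d * k) * N with ha
  set u : ℝ := 2 * k / (m * d) with hu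
  set c : ℝ := Real.sqrt u / N with hc
  have hu0 : 0 ≤ u := by positivity
  have hu1 : u ≤ 1 / 2 := by
    rw [hu, div_le_iff₀ hmdpos]; linarith
  have hcN : c ^ 2 * N ^ 2 = u := by
    rw [hc, div_pow, Real.sq_sqrt hu0]; field_simp
  have hca : 9 * k ≤ c * a := by
    have e1 : c * a = 32 / 5 * (Real.sqrt u * Real.sqrt (m * d * k)) := by
      rw [hc, ha]; field_simp
    have e2 : u * (m * d * k) = 2 * (k : ℝ) ^ 2 := by
      rw [hu]; field_simp
      exact div_self hmdpos.ne'
    rw [e1, ← Real.sqrt_mul hu0, e2, Real.sqrt_mul (by norm_num), Real.sqrt_sq hkR.le]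
    have : (1.41 : ℝ) ≤ Real.sqrt 2 := Real.le_sqrt_of_sq_le (by norm_num)
    nlinarith
  have hmgf : ∀ c' : ℝ, c' ^ 2 = c ^ 2 → ∀ x ∈ T, 𝔼 g : Signs m k d × Signs m k d,
      Real.exp (c' * (star x ⬝ᵥ query g O *ᵥ x).re) ≤ 16 ^ k := by
    intro c' hc' x hx
    refine (expect_exp_query_le (by rw [hc', ← hN, hcN]; linarith) (hT1 x hx)).trans ?_
    rw [hc', ← hN, hcN]
    refine (inv_one_sub_pow_le (r := 2 * k) hu0 hu1 ?_).trans (le_of_eq ?_)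
    · rw [hu]; push_cast; field_simp
      exact div_self hmdpos.ne'
    · have : 2 * (k : ℝ) * (2 * Real.log 2) = k * Real.log 16 := by
        rw [show (16 : ℝ) = 2 ^ 4 by norm_num, Real.log_pow]; push_cast; ring
      rw [this, Real.exp_nat_mul, Real.exp_log (by norm_num)]
  have hone : ∀ x ∈ T, prob (fun g : Signs m k d × Signs m k d =>
      a ≤ |(star x ⬝ᵥ query g O *ᵥ x).re|) ≤ 2 * (16 ^ k * Real.exp (-(9 * k))) := by
    intro x hx
    refine (prob_le_of_le (a := Real.exp (c * a)) (Real.exp_pos _)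
      (X := fun g => Real.exp (c * (star x ⬝ᵥ query g O *ᵥ x).re) +
        Real.exp (-c * (star x ⬝ᵥ query g O *ᵥ x).re))
      (fun _ => by positivity) fun g hg => ?_).trans ?_
    · have hc0 : 0 ≤ c := by positivity
      rcases le_abs.mp hg with h | h
      · have : Real.exp (c * a) ≤ Real.exp (c * (star x ⬝ᵥ query g O *ᵥ x).re) := by gcongr
        linarith [Real.exp_pos (-c * (star x ⬝ᵥ query g O *ᵥ x).re)]
      · have : Real.exp (c * a) ≤ Real.exp (-c * (star x ⬝ᵥ query g O *ᵥ x).re) := by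
          apply Real.exp_le_exp.mpr
          nlinarith
        linarith [Real.exp_pos (c * (star x ⬝ᵥ query g O *ᵥ x).re)]
    · rw [div_eq_mul_inv, ← Real.exp_neg, Finset.expect_add_distrib]
      have h1 := hmgf c rfl x hx
      have h2 := hmgf (-c) (by ring) x hx
      have h3 : Real.exp (-(c * a)) ≤ Real.exp (-(9 * k)) := by
        apply Real.exp_le_exp.mpr; linarith
      calc _ ≤ (16 ^ k + 16 ^ k) * Real.exp (-(9 * k : ℝ)) := by gcongr
        _ = _ := by ring
  calc prob (fun g : Signs m k d × Signs m k d =>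
        8 * Real.sqrt (m * d * k) * N < opNorm (query g O))
      ≤ prob (fun g : Signs m k d × Signs m k d => ∃ x ∈ T,
          a ≤ |(star x ⬝ᵥ query g O *ᵥ x).re|) := by
        refine prob_mono fun g hg => ?_
        by_contra! hcon
        have := hT _ (isHermitian_query g O) a (by positivity) fun x hx => (hcon x hx).le
        rw [ha] at this
        linarith
    _ ≤ ∑ x ∈ T, prob (fun g : Signs m k d × Signs m k d =>
          a ≤ |(star x ⬝ᵥ query g O *ᵥ x).re|) := prob_exists_le T _
    _ ≤ T.card • (2 * (16 ^ k * Real.exp (-(9 * k)))) :=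
        Finset.sum_le_card_nsmul _ _ _ hone
    _ ≤ _ := by
        rw [nsmul_eq_mul]
        gcongr
        exact_mod_cast hTc

open Matrix in
/-- Subnormalized Kraus operators extend to a channel whose added part prepares the maximally
mixed state. -/
lemma exists_kraus_completion (hk : 0 < k) (K : Fin m → Matrix (Fin k) (Fin d) ℂ)
    (hK : (1 - ∑ j, (K j)ᴴ * K j).PosSemidef) :
    ∃ L : Fin m ⊕ (Fin k × Fin d) → Matrix (Fin k) (Fin d) ℂ, ∑ r, (L r)ᴴ * L r = 1 ∧
      ∀ ρ : Matrix (Fin d) (Fin d) ℂ, IsState ρ → ∃ t : ℝ, 0 ≤ t ∧ t ≤ 1 ∧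
        ∑ r, L r * ρ * (L r)ᴴ = ∑ j, K j * ρ * (K j)ᴴ + ((t / k : ℝ) : ℂ) • 1 := by
  obtain ⟨B, hB⟩ := exists_eq_conjTranspose_mul_self hK
  have hkR : (0 : ℝ) < k := by exact_mod_cast hk
  have hkC : (k : ℂ) ≠ 0 := by exact_mod_cast hk.ne'
  set c : ℂ := (((Real.sqrt k)⁻¹ : ℝ) : ℂ) with hc
  have hcc : conj c = c := Complex.conj_ofReal _
  have hc2 : c * c = (k : ℂ)⁻¹ := by
    rw [hc, ← Complex.ofReal_mul, ← mul_inv, Real.mul_self_sqrt hkR.le]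
    push_cast; rfl
  let L : Fin m ⊕ (Fin k × Fin d) → Matrix (Fin k) (Fin d) ℂ := Sum.elim K fun p =>
    Matrix.of fun b y => if b = p.1 then c * B p.2 y else 0
  have h1 : ∑ r, (L r)ᴴ * L r = 1 := by
    rw [Fintype.sum_sum_type]
    have : ∑ p : Fin k × Fin d, (L (.inr p))ᴴ * L (.inr p) = Bᴴ * B := by
      ext y y'
      rw [Matrix.sum_apply, Fintype.sum_prod_type]
      simp only [L, Sum.elim_inr, Matrix.mul_apply, Matrix.conjTranspose_apply, Matrix.of_apply,
        mul_ite, mul_zero, Finset.sum_ite_eq', Finset.mem_univ, if_true, Finset.sum_const,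
        Finset.card_univ, Fintype.card_fin, nsmul_eq_mul, Finset.mul_sum]
      refine Finset.sum_congr rfl fun x _ => ?_
      rw [star_mul', RCLike.star_def, hcc,
        show (k : ℂ) * (c * conj (B x y) * (c * B x y'))
          = k * (c * c) * (conj (B x y) * B x y') by ring, hc2, mul_inv_cancel₀ hkC, one_mul]
    rw [this, ← hB]
    simp [L]
  refine ⟨L, h1, fun ρ hρ => ?_⟩
  have hpos : (B * ρ * Bᴴ).PosSemidef := hρ.1.mul_mul_conjTranspose_same _
  have htr := hpos.trace_nonneg
  obtain ⟨ht0, hti⟩ := Complex.nonneg_iff.mp htr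
  have htre : (B * ρ * Bᴴ).trace = (((B * ρ * Bᴴ).trace.re : ℝ) : ℂ) :=
    Complex.ext rfl (by simp [← hti])
  have h2 : ∑ r, L r * ρ * (L r)ᴴ = ∑ j, K j * ρ * (K j)ᴴ +
      (((B * ρ * Bᴴ).trace.re / k : ℝ) : ℂ) • 1 := by
    rw [Fintype.sum_sum_type]
    congr 1
    ext b b'
    rw [Matrix.sum_apply, Fintype.sum_prod_type, Complex.ofReal_div, ← htre]
    have hentry : ∀ (a : Fin k) (x : Fin d), (L (.inr (a, x)) * ρ * (L (.inr (a, x)))ᴴ) b b'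
        = if b = a then if b' = a then (k : ℂ)⁻¹ * (B * ρ * Bᴴ) x x else 0 else 0 := by
      intro a x
      have e1 : ∀ z, (L (.inr (a, x)) * ρ) b z = if b = a then c * (B * ρ) x z else 0 := by
        intro z
        simp only [L, Sum.elim_inr, Matrix.mul_apply, Matrix.of_apply]
        split_ifs
        · rw [Finset.mul_sum]
          exact Finset.sum_congr rfl fun _ _ => by ring
        · simp
      rw [Matrix.mul_apply]
      simp only [e1, Matrix.conjTranspose_apply]
      simp only [L, Sum.elim_inr, Matrix.of_apply]
      split_ifs
      · rw [Matrix.mul_apply, Finset.mul_sum]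
        refine Finset.sum_congr rfl fun z _ => ?_
        rw [star_mul', RCLike.star_def, hcc, ← hc2, Matrix.conjTranspose_apply,
          RCLike.star_def]
        ring
      all_goals simp
    simp only [hentry]
    rw [Finset.sum_eq_single b (fun a _ ha => by simp [ha.symm]) (by simp)]
    by_cases hb : b = b'
    · subst hb
      simp only [if_true, ← Finset.mul_sum, Matrix.smul_apply, Matrix.one_apply_eq, smul_eq_mul,
        mul_one]
      rw [Matrix.trace, div_eq_inv_mul]
      simp
    · simp [hb, Ne.symm hb, Matrix.one_apply_ne]
  refine ⟨(B * ρ * Bᴴ).trace.re, ht0, ?_, h2⟩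
  have h3 := congrArg Complex.re (isState_kraus h1 hρ).2
  rw [h2, Matrix.trace_add, Matrix.trace_smul, Matrix.trace_one, Fintype.card_fin, Complex.add_re,
    smul_eq_mul, ← Complex.ofReal_natCast, ← Complex.ofReal_mul, Complex.ofReal_re,
    div_mul_cancel₀ _ hkR.ne', Complex.one_re] at h3
  have h4 : 0 ≤ (∑ j, K j * ρ * (K j)ᴴ).trace.re := (Complex.nonneg_iff.mp
    (Matrix.posSemidef_sum _ fun j _ => hρ.1.mul_mul_conjTranspose_same _).trace_nonneg).1
  linarith

open Matrix in
lemma posSemidef_one_sub_of_bound {ι κ : Type*} [Fintype ι] [Fintype κ] [DecidableEq κ]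
    {Z : Matrix ι κ ℂ} {τ : ℝ} (hτ : 0 < τ)
    (hZ : ∀ x, ∑ i, ‖(Z *ᵥ x) i‖ ^ 2 ≤ τ * ∑ i, ‖x i‖ ^ 2) :
    (1 - ((τ⁻¹ : ℝ) : ℂ) • (Zᴴ * Z)).PosSemidef := by
  have hZZ : (Zᴴ * Z).IsHermitian := Matrix.isHermitian_conjTranspose_mul_self Z
  have hs : ∀ {κ : Type _} [Fintype κ] (x : κ → ℂ),
      star x ⬝ᵥ x = ((∑ i, ‖x i‖ ^ 2 : ℝ) : ℂ) := by
    intro κ _ x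
    push_cast
    exact Finset.sum_congr rfl fun i _ => by
      rw [Pi.star_apply, RCLike.star_def, Complex.conj_mul']
  refine Matrix.PosSemidef.of_dotProduct_mulVec_nonneg ?_ fun x => ?_
  · rw [Matrix.IsHermitian, Matrix.conjTranspose_sub, Matrix.conjTranspose_one,
      Matrix.conjTranspose_smul, hZZ.eq, RCLike.star_def, Complex.conj_ofReal]
  · rw [Matrix.sub_mulVec, Matrix.one_mulVec, dotProduct_sub, Matrix.smul_mulVec, dotProduct_smul,
      ← Matrix.mulVec_mulVec, Matrix.dotProduct_mulVec, ← Matrix.star_mulVec, hs]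
    have h2 : star (Z *ᵥ x) ⬝ᵥ (Z *ᵥ x) = ((∑ i, ‖(Z *ᵥ x) i‖ ^ 2 : ℝ) : ℂ) := by
      push_cast
      exact Finset.sum_congr rfl fun i _ => by
        rw [Pi.star_apply, RCLike.star_def, Complex.conj_mul']
    rw [h2, smul_eq_mul, ← Complex.ofReal_mul, ← Complex.ofReal_sub, Complex.zero_le_real,
      sub_nonneg, inv_mul_le_iff₀ hτ]
    exact hZ x

open Matrix in
/-- The channel attached to the pair `g` of random blocks. -/
lemma exists_channel (hk : 0 < k) {τ : ℝ} (hτ : 0 < τ) (g : Signs m k d × Signs m k d) :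
    ∃ L : Fin m ⊕ (Fin k × Fin d) → Matrix (Fin k) (Fin d) ℂ, ∑ r, (L r)ᴴ * L r = 1 ∧
      (KrausBound τ g → ∀ ρ : Matrix (Fin d) (Fin d) ℂ, IsState ρ → ∃ t : ℝ, 0 ≤ t ∧ t ≤ 1 ∧ ∑ r, L r * ρ * (L r)ᴴ =
        ((τ⁻¹ : ℝ) : ℂ) • blockOutput g ρ + ((t / k : ℝ) : ℂ) • 1) := by
  by_cases hg : KrausBound τ g
  · set c : ℂ := (((Real.sqrt τ)⁻¹ : ℝ) : ℂ) with hc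
    have hcc : star c = c := Complex.conj_ofReal _
    have hc2 : c * c = ((τ⁻¹ : ℝ) : ℂ) := by
      rw [hc, ← Complex.ofReal_mul, ← mul_inv, Real.mul_self_sqrt hτ.le]
    let K : Fin m → Matrix (Fin k) (Fin d) ℂ := fun j => c • (block g.1 j + block g.2 j)
    have hKK : ∑ j, (K j)ᴴ * K j = ((τ⁻¹ : ℝ) : ℂ) • ((stackSum g)ᴴ * stackSum g) := by
      simp only [K, Matrix.conjTranspose_smul, Matrix.smul_mul, Matrix.mul_smul, smul_smul, hcc,
        hc2, ← Finset.smul_sum]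
      congr 1
      ext y y'
      rw [Matrix.sum_apply, Matrix.mul_apply, Fintype.sum_prod_type]
      refine Finset.sum_congr rfl fun j _ => ?_
      rw [Matrix.mul_apply]
      rfl
    obtain ⟨L, h1, h2⟩ := exists_kraus_completion hk K (by
      rw [hKK]; exact posSemidef_one_sub_of_bound hτ hg)
    refine ⟨L, h1, fun _ ρ hρ => ?_⟩
    obtain ⟨t, ht0, ht1, ht⟩ := h2 ρ hρ
    refine ⟨t, ht0, ht1, ht.trans ?_⟩
    congr 1
    simp only [K, Matrix.conjTranspose_smul, Matrix.smul_mul, Matrix.mul_smul, smul_smul, hcc,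
      hc2, ← Finset.smul_sum]
    rfl
  · obtain ⟨L, h1, -⟩ := exists_kraus_completion hk (fun _ : Fin m => (0 : Matrix (Fin k) (Fin d) ℂ))
      (by simpa using Matrix.PosSemidef.one)
    exact ⟨L, h1, fun h => absurd h hg⟩

open Matrix in
lemma trace_query_mul_re (g : Signs m k d × Signs m k d) (O : Matrix (Fin d) (Fin d) ℂ)
    {X : Matrix (Fin k) (Fin k) ℂ} (hX : X.IsHermitian) :
    (query g O * X).trace.re = 2 * (crossSum g O * X).trace.re := by
  have : ((crossSum g O)ᴴ * X).trace = star (crossSum g O * X).trace := by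
    rw [← Matrix.trace_conjTranspose, Matrix.conjTranspose_mul, hX.eq, Matrix.trace_mul_comm]
  rw [query, Matrix.add_mul, Matrix.trace_add, this, Complex.add_re, RCLike.star_def,
    Complex.conj_re]
  ring

open Matrix in
lemma isHermitian_blockOutput (g : Signs m k d × Signs m k d) {ρ : Matrix (Fin d) (Fin d) ℂ}
    (hρ : ρ.IsHermitian) : (blockOutput g ρ).IsHermitian := by
  simp only [Matrix.IsHermitian, blockOutput, Matrix.conjTranspose_sum, Matrix.conjTranspose_mul,
    Matrix.conjTranspose_conjTranspose, hρ.eq, Matrix.mul_assoc]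

/-- The error of the query, split into its fluctuation and the contribution of the maximally
mixed part of the channel. -/
lemma query_error_le (hm : 0 < m) (hk : 0 < k) {τ t : ℝ} (hτ : 0 < τ) (ht0 : 0 ≤ t) (ht1 : t ≤ 1)
    (g : Signs m k d × Signs m k d) {O ρ : Matrix (Fin d) (Fin d) ℂ} (hρ : IsState ρ) :
    |(O * ρ).trace.re - τ / (2 * (m * k ^ 2)) * (query g O *
      (((τ⁻¹ : ℝ) : ℂ) • blockOutput g ρ + ((t / k : ℝ) : ℂ) • 1)).trace.re|
      ≤ ‖deviation g O ρ‖ / (m * k ^ 2) + τ / (m * k ^ 3) * ‖(crossSum g O).trace‖ := by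
  have hmR : (0 : ℝ) < m := by exact_mod_cast hm
  have hkR : (0 : ℝ) < k := by exact_mod_cast hk
  have h1 := trace_query_mul_re g O (isHermitian_blockOutput g hρ.1.isHermitian)
  have h2 := trace_query_mul_re g O (Matrix.isHermitian_one (α := ℂ) (n := Fin k))
  rw [Matrix.mul_one, Matrix.mul_one] at h2
  have h3 : (deviation g O ρ).re
      = (crossSum g O * blockOutput g ρ).trace.re - m * k ^ 2 * (O * ρ).trace.re := by
    rw [deviation, Complex.sub_re, ← Complex.re_ofReal_mul]
    push_cast; rfl
  rw [Matrix.mul_add, Matrix.mul_smul, Matrix.mul_smul, Matrix.mul_one, Matrix.trace_add,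
    Matrix.trace_smul, Matrix.trace_smul, smul_eq_mul, smul_eq_mul, Complex.add_re,
    Complex.re_ofReal_mul, Complex.re_ofReal_mul, h1, h2]
  have e : (O * ρ).trace.re - τ / (2 * (m * k ^ 2)) *
      (τ⁻¹ * (2 * (crossSum g O * blockOutput g ρ).trace.re)
        + t / k * (2 * (crossSum g O).trace.re))
      = -((deviation g O ρ).re / (m * k ^ 2)) - τ / (m * k ^ 3) * (t * (crossSum g O).trace.re) := by
    rw [h3]; field_simp; ring
  rw [e]
  refine (abs_sub _ _).trans ?_
  rw [abs_neg, abs_div, abs_of_pos (show (0 : ℝ) < m * k ^ 2 by positivity), abs_mul,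
    abs_of_pos (show (0 : ℝ) < τ / (m * k ^ 3) by positivity), abs_mul, abs_of_nonneg ht0]
  gcongr
  · exact Complex.abs_re_le_norm _
  · calc t * |(crossSum g O).trace.re| ≤ 1 * ‖(crossSum g O).trace‖ := by
          gcongr
          exact Complex.abs_re_le_norm _
      _ = _ := one_mul _

lemma prob_fst {G H : Type*} [Fintype G] [Fintype H] [Nonempty H] (p : G → Prop) :
    prob (fun x : G × H => p x.1) = prob p := by
  rw [prob, expect_prod_type]
  classical
  refine Finset.expect_congr rfl fun g _ => ?_
  by_cases h : p g <;> simp [h]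

lemma prob_snd {G H : Type*} [Fintype G] [Fintype H] [Nonempty G] (p : H → Prop) :
    prob (fun x : G × H => p x.2) = prob p := by
  rw [prob, expect_prod_type_right]
  classical
  refine Finset.expect_congr rfl fun g _ => ?_
  by_cases h : p g <;> simp [h]

/-! ### Numerical estimates -/

lemma pow_le_inv_two_thousand {x : ℝ} (hx0 : 0 ≤ x) (hx : x ≤ 22 / 25) {n : ℕ} (hn : 100 ≤ n) :
    x ^ n ≤ 1 / 2000 := by
  calc x ^ n ≤ (22 / 25 : ℝ) ^ n := by gcongr
    _ ≤ (22 / 25 : ℝ) ^ 100 := pow_le_pow_of_le_one (by norm_num) (by norm_num) hn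
    _ ≤ 1 / 2000 := by norm_num

lemma exp_neg_le_inv {a c : ℝ} (hc : 0 < c) (h : c ≤ Real.exp a) : Real.exp (-a) ≤ c⁻¹ := by
  rw [Real.exp_neg]
  exact inv_anti₀ hc h

lemma pow_le_exp_natCast {c : ℝ} (n : ℕ) (hc : c ≤ 2.718 ^ n) :
    c ≤ Real.exp n := by
  rw [← Real.exp_one_pow]
  refine hc.trans ?_
  gcongr
  linarith [Real.exp_one_gt_d9]

lemma krausBound_tail_le (hd : 100 ≤ d) :
    (441 : ℝ) ^ d * (4 ^ (m * k) * Real.exp (-(3 / 8 * (17 * d + 37 / 10 * (m * k))))) ≤ 1 / 1000 := by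
  have h1 : (4 : ℝ) * Real.exp (-(111 / 80)) ≤ 1 := by
    rw [show (4 : ℝ) = Real.exp (2 * Real.log 2) by
      rw [mul_comm, Real.exp_mul, Real.exp_log two_pos]; norm_num, ← Real.exp_add,
      Real.exp_le_one_iff]
    linarith [Real.log_two_lt_d9]
  have h2 : (441 : ℝ) * Real.exp (-(51 / 8)) ≤ 22 / 25 := by
    have h6 : (403 : ℝ) ≤ Real.exp 6 := by
      exact_mod_cast pow_le_exp_natCast 6 (by norm_num)
    have h7 : (11 / 8 : ℝ) ≤ Real.exp (3 / 8) := by linarith [Real.add_one_le_exp (3 / 8 : ℝ)]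
    have h8 : (550 : ℝ) ≤ Real.exp (51 / 8) := by
      rw [show (51 / 8 : ℝ) = 6 + 3 / 8 by norm_num, Real.exp_add]
      nlinarith [Real.exp_pos 6]
    linarith [exp_neg_le_inv (by norm_num) h8]
  have e : Real.exp (-(3 / 8 * (17 * d + 37 / 10 * (m * k))))
      = Real.exp (-(51 / 8)) ^ d * Real.exp (-(111 / 80)) ^ (m * k) := by
    rw [← Real.exp_nat_mul, ← Real.exp_nat_mul, ← Real.exp_add]
    push_cast
    ring_nf
  calc (441 : ℝ) ^ d * (4 ^ (m * k) * Real.exp (-(3 / 8 * (17 * d + 37 / 10 * (m * k)))))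
      = (441 * Real.exp (-(51 / 8))) ^ d * (4 * Real.exp (-(111 / 80))) ^ (m * k) := by
        rw [e, mul_pow, mul_pow]; ring
    _ ≤ 1 / 2000 * 1 := by
        gcongr
        · exact pow_le_inv_two_thousand (by positivity) h2 hd
        · exact pow_le_one₀ (by positivity) h1
    _ ≤ _ := by norm_num

lemma stackBound_tail_le (hk : 100 ≤ k) (hmd : 4 * k ≤ m * d) :
    (441 : ℝ) ^ k * (4 ^ (m * d) * Real.exp (-(243 / 80) * (m * d))) ≤ 1 / 1000 := by
  have h1 : (4 : ℝ) * Real.exp (-(243 / 80)) ≤ 1 / 5 := by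
    have h3 : (20 : ℝ) ≤ Real.exp 3 := by
      exact_mod_cast pow_le_exp_natCast 3 (by norm_num)
    have h4 : Real.exp 3 ≤ Real.exp (243 / 80) := Real.exp_le_exp.mpr (by norm_num)
    linarith [exp_neg_le_inv (by norm_num) (h3.trans h4)]
  have e : Real.exp (-(243 / 80) * (m * d)) = Real.exp (-(243 / 80)) ^ (m * d) := by
    rw [← Real.exp_nat_mul]
    push_cast
    ring_nf
  calc (441 : ℝ) ^ k * (4 ^ (m * d) * Real.exp (-(243 / 80) * (m * d)))
      = 441 ^ k * (4 * Real.exp (-(243 / 80))) ^ (m * d) := by rw [e, mul_pow]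
    _ ≤ 441 ^ k * (1 / 5) ^ (m * d) := by gcongr
    _ ≤ 441 ^ k * (1 / 5) ^ (4 * k) := by
        refine mul_le_mul_of_nonneg_left ?_ (by positivity)
        exact pow_le_pow_of_le_one (a := (1 / 5 : ℝ)) (by norm_num) (by norm_num) hmd
    _ = (441 * (1 / 5) ^ 4) ^ k := by rw [mul_pow, ← pow_mul]
    _ ≤ 1 / 2000 := pow_le_inv_two_thousand (by norm_num) (by norm_num) hk
    _ ≤ _ := by norm_num

lemma opNorm_query_tail_le (hk : 100 ≤ k) :
    (441 : ℝ) ^ k * (2 * (16 ^ k * Real.exp (-(9 * k)))) ≤ 1 / 1000 := by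
  have h1 : (441 * 16 : ℝ) * Real.exp (-9) ≤ 22 / 25 := by
    have h3 : (8050 : ℝ) ≤ Real.exp 9 := by
      exact_mod_cast pow_le_exp_natCast 9 (by norm_num)
    linarith [exp_neg_le_inv (by norm_num) h3]
  have e : Real.exp (-(9 * k)) = Real.exp (-9) ^ k := by
    rw [← Real.exp_nat_mul]
    ring_nf
  calc (441 : ℝ) ^ k * (2 * (16 ^ k * Real.exp (-(9 * k))))
      = 2 * (441 * 16 * Real.exp (-9)) ^ k := by rw [e, mul_pow, mul_pow]; ring
    _ ≤ 2 * (1 / 2000) := by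
        gcongr
        exact pow_le_inv_two_thousand (by positivity) h1 hk
    _ = _ := by norm_num

/-- The normalization of the Kraus operators. -/
def krausScale (m k d : ℕ) : ℝ := 100 / 81 * (17 * d + 37 / 10 * (m * k))

lemma krausScale_sq_le (h4 : 4 * d ≤ m * k) (h5 : m * k ≤ 5 * d) :
    krausScale m k d ^ 2 ≤ 386 * (m * k * d) := by
  have h4' : 4 * (d : ℝ) ≤ m * k := by exact_mod_cast h4
  have h5' : (m * k : ℝ) ≤ 5 * d := by exact_mod_cast h5
  have hd : (0 : ℝ) ≤ d := Nat.cast_nonneg d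
  rw [krausScale]
  set S : ℝ := m * k
  nlinarith [mul_nonneg (sub_nonneg.mpr h4') (sub_nonneg.mpr h5'),
    mul_nonneg hd (sub_nonneg.mpr h4'), mul_nonneg hd hd]

lemma deviation_tail_le {ε N : ℝ} (hε : 0 < ε) (hN : 0 < N) (hk : 10000 ≤ k) (hkd : k ≤ d)
    (h4 : 4 * d ≤ m * k) (h5 : m * k ≤ 5 * d) (hdε : 10000 * d ≤ ε ^ 2 * k ^ 2) (hε1 : ε ≤ 1) :
    5 * N ^ 2 * (2 * (5 * (m * d) * (m * k ^ 2 + 2 * m * k + 2 * m ^ 2 * k)) +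
        7 * (m ^ 2 * k ^ 2 * d) + m * k ^ 3) / (19 / 100 * ε * N * (m * k ^ 2)) ^ 2 ≤ 6 / 25 := by
  have h4' : 4 * (d : ℝ) ≤ m * k := by exact_mod_cast h4
  have h5' : (m * k : ℝ) ≤ 5 * d := by exact_mod_cast h5
  have hkR : (10000 : ℝ) ≤ k := by exact_mod_cast hk
  have hkdR : (k : ℝ) ≤ d := by exact_mod_cast hkd
  have hd0 : (0 : ℝ) < d := by linarith
  have hk0 : (0 : ℝ) < k := by linarith
  have hm0 : (0 : ℝ) < m := by
    by_contra! h
    nlinarith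
  have hmk : (m : ℝ) * 2000 ≤ k := by
    have h1 : ε ^ 2 ≤ 1 := pow_le_one₀ hε.le hε1
    have h2 : 10000 * (d : ℝ) ≤ k ^ 2 := by nlinarith [sq_nonneg (k : ℝ)]
    have : (m : ℝ) * 2000 * k ≤ k * k := by nlinarith
    exact le_of_mul_le_mul_right this hk0
  have ht1 : 2 * (m : ℝ) * k ≤ 1 / 5000 * (m * k ^ 2) := by
    have := mul_le_mul_of_nonneg_left hkR (show 0 ≤ (m : ℝ) * k by positivity)
    nlinarith
  have ht2 : 2 * (m : ℝ) ^ 2 * k ≤ 1 / 1000 * (m * k ^ 2) := by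
    have := mul_le_mul_of_nonneg_left hmk (show 0 ≤ (m : ℝ) * k by positivity)
    nlinarith
  have ht3 : (m : ℝ) * k ^ 3 ≤ 1 / 4 * (m ^ 2 * k ^ 2 * d) := by
    have h1 : (k : ℝ) * 4 ≤ m * d := by
      have : (m : ℝ) * k ≤ m * d := by gcongr
      linarith
    have := mul_le_mul_of_nonneg_left h1 (show 0 ≤ (m : ℝ) * k ^ 2 by positivity)
    nlinarith
  have hsum : 2 * (5 * ((m : ℝ) * d) * (m * k ^ 2 + 2 * m * k + 2 * m ^ 2 * k)) +
        7 * (m ^ 2 * k ^ 2 * d) + m * k ^ 3 ≤ 432 / 25 * (m ^ 2 * k ^ 2 * d) := by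
    have h1 : 5 * ((m : ℝ) * d) * (m * k ^ 2 + 2 * m * k + 2 * m ^ 2 * k)
        ≤ 5 * ((m : ℝ) * d) * (5006 / 5000 * (m * k ^ 2)) := by
      gcongr
      linarith
    have h2 : (0 : ℝ) ≤ m ^ 2 * k ^ 2 * d := by positivity
    nlinarith
  rw [div_le_iff₀ (by positivity)]
  calc 5 * N ^ 2 * (2 * (5 * ((m : ℝ) * d) * (m * k ^ 2 + 2 * m * k + 2 * m ^ 2 * k)) +
        7 * (m ^ 2 * k ^ 2 * d) + m * k ^ 3)
      ≤ 5 * N ^ 2 * (432 / 25 * (m ^ 2 * k ^ 2 * d)) := by gcongr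
    _ = 432 / 5 * (N ^ 2 * m ^ 2 * k ^ 2) / 10000 * (10000 * d) := by ring
    _ ≤ 432 / 5 * (N ^ 2 * m ^ 2 * k ^ 2) / 10000 * (ε ^ 2 * k ^ 2) := by gcongr
    _ = 432 / 50000 * (ε ^ 2 * N ^ 2 * m ^ 2 * k ^ 4) := by ring
    _ ≤ 6 / 25 * (361 / 10000) * (ε ^ 2 * N ^ 2 * m ^ 2 * k ^ 4) := by gcongr; norm_num
    _ = _ := by ring

lemma trace_crossSum_tail_le {ε N : ℝ} (hε : 0 < ε) (hN : 0 < N) (hk : 0 < k)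
    (hm : 0 < m) (h4 : 4 * d ≤ m * k) (h5 : m * k ≤ 5 * d)
    (hdε : 10000 * d ≤ ε ^ 2 * k ^ 2) (hε1 : ε ≤ 1) (hτ : 0 < krausScale m k d) :
    N ^ 2 * (m * k * d) / (1 / 50 * ε * N * (m * k ^ 3 / krausScale m k d)) ^ 2 ≤ 1 / 100 := by
  have hkR : (0 : ℝ) < k := by exact_mod_cast hk
  have hmR : (0 : ℝ) < m := by exact_mod_cast hm
  have hsq := krausScale_sq_le h4 h5
  set τ := krausScale m k d
  have h2 : (10000 * (d : ℝ)) ^ 2 ≤ ε ^ 2 * k ^ 4 := by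
    have h1 : ε ^ 2 ≤ 1 := pow_le_one₀ hε.le hε1
    calc (10000 * (d : ℝ)) ^ 2 ≤ (ε ^ 2 * k ^ 2) ^ 2 := by gcongr
      _ = ε ^ 2 * (ε ^ 2 * k ^ 4) := by ring
      _ ≤ 1 * (ε ^ 2 * k ^ 4) := by gcongr
      _ = _ := one_mul _
  rw [div_le_iff₀ (by positivity), ← mul_le_mul_iff_of_pos_right (show 0 < τ ^ 2 by positivity)]
  calc N ^ 2 * (m * k * d) * τ ^ 2 ≤ N ^ 2 * (m * k * d) * (386 * (m * k * d)) := by gcongr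
    _ = 386 / 100000000 * (N ^ 2 * m ^ 2 * k ^ 2) * (10000 * (d : ℝ)) ^ 2 := by ring
    _ ≤ 386 / 100000000 * (N ^ 2 * m ^ 2 * k ^ 2) * (ε ^ 2 * k ^ 4) := by gcongr
    _ ≤ 400 / 100000000 * (N ^ 2 * m ^ 2 * k ^ 2) * (ε ^ 2 * k ^ 4) := by gcongr; norm_num
    _ = _ := by field_simp; norm_num

lemma query_accuracy_le {ε N : ℝ} (hε : 0 < ε) (hN : 0 ≤ N) (hk : 0 < k) (hm : 0 < m) (hd : 0 < d)
    (h4 : 4 * d ≤ m * k) (h5 : m * k ≤ 5 * d) :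
    krausScale m k d / (2 * (m * k ^ 2)) *
      (0.01 * ε * k / d * (8 * Real.sqrt (m * d * k) * N)) ≤ 79 / 100 * (ε * N) := by
  have hkR : (0 : ℝ) < k := by exact_mod_cast hk
  have hmR : (0 : ℝ) < m := by exact_mod_cast hm
  have hdR : (0 : ℝ) < d := by exact_mod_cast hd
  have hsq := krausScale_sq_le h4 h5
  set τ := krausScale m k d
  set r := Real.sqrt (m * d * k)
  have hr : r ^ 2 = m * d * k := Real.sq_sqrt (by positivity)
  have hr0 : 0 < r := Real.sqrt_pos.mpr (by positivity)
  have hτr : τ ≤ 79 / 4 * r := by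
    refine abs_le_of_sq_le_sq' ?_ (by positivity) |>.2
    rw [mul_pow, hr]
    nlinarith [mul_pos (mul_pos hmR hkR) hdR]
  have e : τ / (2 * (m * k ^ 2)) * (0.01 * ε * k / d * (8 * r * N))
      = 1 / 25 * (τ / r) * (ε * N) := by
    have : (m : ℝ) = r ^ 2 / (d * k) := by rw [hr]; field_simp
    rw [this]; field_simp; ring
  rw [e]
  have : τ / r ≤ 79 / 4 := by rwa [div_le_iff₀ hr0]
  gcongr
  linarith

/-- With constant probability over the random blocks, the query predicts `tr(O ρ)`. -/
lemma prob_bad_le {ε : ℝ} (hε : 0 < ε) (hε1 : ε ≤ 1) (hk : 10000 ≤ k) (hkd : k ≤ d)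
    (h4 : 4 * d ≤ m * k) (h5 : m * k ≤ 5 * d) (hdε : 10000 * d ≤ ε ^ 2 * k ^ 2)
    {O ρ : Matrix (Fin d) (Fin d) ℂ} (hO : O.IsHermitian) (hN : 0 < opNorm O) (hρ : IsState ρ) :
    prob (fun g : Signs m k d × Signs m k d => ¬ (KrausBound (krausScale m k d) g ∧
      opNorm (query g O) ≤ 8 * Real.sqrt (m * d * k) * opNorm O ∧
      ‖deviation g O ρ‖ ≤ 19 / 100 * ε * opNorm O * (m * k ^ 2) ∧
      ‖(crossSum g O).trace‖ ≤ 1 / 50 * ε * opNorm O * (m * k ^ 3 / krausScale m k d)))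
      ≤ 13 / 50 := by
  have hk0 : 0 < k := by omega
  have hm4 : 4 ≤ m := by
    by_contra! h
    have : m * k ≤ 3 * k := Nat.mul_le_mul_right k (by omega)
    omega
  have hmd : 4 * k ≤ m * d := Nat.mul_le_mul hm4 hkd
  have hkR : (0 : ℝ) < k := by exact_mod_cast hk0
  have hmR : (0 : ℝ) < m := by exact_mod_cast (show 0 < m by omega)
  have hτ : 0 < krausScale m k d := by rw [krausScale]; positivity
  have p1 : prob (fun g : Signs m k d × Signs m k d => ¬ KrausBound (krausScale m k d) g)
      ≤ 1 / 1000 := (prob_not_krausBound_le (by positivity)).trans (krausBound_tail_le (by omega))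
  have hs : prob (fun ω : Signs m k d => ¬ StackBound ω) ≤ 1 / 1000 :=
    prob_not_stackBound_le.trans (stackBound_tail_le (by omega) hmd)
  have p2 : prob (fun g : Signs m k d × Signs m k d => ¬ StackBound g.1) ≤ 1 / 1000 := by
    rwa [prob_fst fun ω : Signs m k d => ¬ StackBound ω]
  have p3 : prob (fun g : Signs m k d × Signs m k d => ¬ StackBound g.2) ≤ 1 / 1000 := by
    rwa [prob_snd fun ω : Signs m k d => ¬ StackBound ω]
  have p4 := (prob_opNorm_query_le hN hk0 hmd).trans (opNorm_query_tail_le (by omega))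
  have p5 := (prob_deviation_le hO hρ (a := 19 / 100 * ε * opNorm O * (m * k ^ 2))
    (by positivity)).trans (deviation_tail_le hε hN hk hkd h4 h5 hdε hε1)
  have p6 := (prob_trace_crossSum_le (m := m) (k := k) O
    (a := 1 / 50 * ε * opNorm O * (m * k ^ 3 / krausScale m k d))
    (by positivity)).trans (trace_crossSum_tail_le hε hN hk0 (by omega) h4 h5 hdε hε1 hτ)
  refine (prob_mono (q := fun g => ¬ KrausBound (krausScale m k d) g ∨ ¬ StackBound g.1 ∨
    ¬ StackBound g.2 ∨ 8 * Real.sqrt (m * d * k) * opNorm O < opNorm (query g O) ∨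
    (StackBound g.1 ∧ StackBound g.2 ∧
      19 / 100 * ε * opNorm O * (m * k ^ 2) ≤ ‖deviation g O ρ‖) ∨
    1 / 50 * ε * opNorm O * (m * k ^ 3 / krausScale m k d) ≤ ‖(crossSum g O).trace‖)
    fun g hg => ?_).trans ?_
  · contrapose! hg
    obtain ⟨q1, q2, q3, q4, q5, q6⟩ := hg
    exact ⟨q1, q4, (q5 q2 q3).le, q6.le⟩
  · refine (prob_or_le _ _).trans ?_
    have r1 := prob_or_le (fun g : Signs m k d × Signs m k d => ¬ StackBound g.1) (fun g =>
      ¬ StackBound g.2 ∨ 8 * Real.sqrt (m * d * k) * opNorm O < opNorm (query g O) ∨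
      (StackBound g.1 ∧ StackBound g.2 ∧
        19 / 100 * ε * opNorm O * (m * k ^ 2) ≤ ‖deviation g O ρ‖) ∨
      1 / 50 * ε * opNorm O * (m * k ^ 3 / krausScale m k d) ≤ ‖(crossSum g O).trace‖)
    have r2 := prob_or_le (fun g : Signs m k d × Signs m k d => ¬ StackBound g.2) (fun g =>
      8 * Real.sqrt (m * d * k) * opNorm O < opNorm (query g O) ∨
      (StackBound g.1 ∧ StackBound g.2 ∧
        19 / 100 * ε * opNorm O * (m * k ^ 2) ≤ ‖deviation g O ρ‖) ∨
      1 / 50 * ε * opNorm O * (m * k ^ 3 / krausScale m k d) ≤ ‖(crossSum g O).trace‖)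
    have r3 := prob_or_le (fun g : Signs m k d × Signs m k d =>
      8 * Real.sqrt (m * d * k) * opNorm O < opNorm (query g O)) (fun g =>
      (StackBound g.1 ∧ StackBound g.2 ∧
        19 / 100 * ε * opNorm O * (m * k ^ 2) ≤ ‖deviation g O ρ‖) ∨
      1 / 50 * ε * opNorm O * (m * k ^ 3 / krausScale m k d) ≤ ‖(crossSum g O).trace‖)
    have r4 := prob_or_le (fun g : Signs m k d × Signs m k d =>
      StackBound g.1 ∧ StackBound g.2 ∧
        19 / 100 * ε * opNorm O * (m * k ^ 2) ≤ ‖deviation g O ρ‖) (fun g =>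
      1 / 50 * ε * opNorm O * (m * k ^ 3 / krausScale m k d) ≤ ‖(crossSum g O).trace‖)
    linarith

lemma Algorithm.Solves.mono {d n : ℕ} {A : Algorithm d n} {ε p q : ℝ} (hA : A.Solves ε p)
    (hqp : q ≤ p) : A.Solves ε q :=
  fun ρ hρ O hO => (ENNReal.ofReal_le_ofReal hqp).trans (hA ρ hρ O hO)

/-- The dimension reduction: an algorithm for `ℂ^k` yields one for `ℂ^d` with the same number of
copies. -/
lemma exists_algorithm_of_smaller_dim {f : ℕ} {ε : ℝ} (hε : 0 < ε) (hε1 : ε ≤ 1) (hk : 10000 ≤ k)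
    (hkd : k ≤ d) (hdε : 10000 * d ≤ ε ^ 2 * k ^ 2) (A : Algorithm k f)
    (hA : A.Solves (0.01 * ε * k / d) 0.9) : ∃ B : Algorithm d f, B.Solves ε 0.66 := by
  classical
  have hk0 : 0 < k := by omega
  have hd0 : 0 < d := by omega
  obtain ⟨m, h4, h5⟩ : ∃ m, 4 * d ≤ m * k ∧ m * k ≤ 5 * d := by
    refine ⟨4 * d / k + 1, ?_, ?_⟩
    · rw [Nat.add_mul, one_mul]
      have := Nat.div_add_mod (4 * d) k
      have := Nat.mod_lt (4 * d) hk0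
      nlinarith
    · rw [Nat.add_mul, one_mul]
      have := Nat.div_mul_le_self (4 * d) k
      omega
  have hm0 : 0 < m := Nat.pos_of_ne_zero fun h => by simp [h] at h4; omega
  have hkR : (0 : ℝ) < k := by exact_mod_cast hk0
  have hmR : (0 : ℝ) < m := by exact_mod_cast hm0
  have hdR : (0 : ℝ) < d := by exact_mod_cast hd0
  have hτ : 0 < krausScale m k d := by rw [krausScale]; positivity
  choose L hL1 hL2 using fun g : Signs m k d × Signs m k d => exists_channel hk0 hτ g
  have hne : Nonempty (Signs m k d × Signs m k d) := ⟨(fun _ => 0, fun _ => 0)⟩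
  refine Exists.imp (fun B hB => Algorithm.Solves.mono hB (p := 0.9 * (37 / 50)) (by norm_num))
    (exists_algorithm_of_channels (ε := ε) (q := 37 / 50)
      (s := krausScale m k d / (2 * (m * k ^ 2))) A (by norm_num) (by positivity) hA L hL1 query
      (fun g O _ => isHermitian_query g O) ?_)
  intro ρ hρ O hO
  rcases (opNorm_nonneg O).eq_or_lt with hN | hN
  · obtain rfl := eq_zero_of_opNorm_eq_zero hN.symm
    refine ⟨univ, ?_, fun g _ => ?_⟩
    · rw [Finset.card_univ]
      have : (0 : ℝ) ≤ Fintype.card (Signs m k d × Signs m k d) := Nat.cast_nonneg _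
      linarith
    · have : query g (0 : Matrix (Fin d) (Fin d) ℂ) = 0 := by simp [query, crossSum]
      simp [this, opNorm_zero]
  refine ⟨univ.filter fun g : Signs m k d × Signs m k d => KrausBound (krausScale m k d) g ∧
      opNorm (query g O) ≤ 8 * Real.sqrt (m * d * k) * opNorm O ∧
      ‖deviation g O ρ‖ ≤ 19 / 100 * ε * opNorm O * (m * k ^ 2) ∧
      ‖(crossSum g O).trace‖ ≤ 1 / 50 * ε * opNorm O * (m * k ^ 3 / krausScale m k d),
    ?_, fun g hg => ?_⟩
  · rw [← card_mul_prob, mul_comm]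
    gcongr
    have := prob_bad_le hε hε1 hk hkd h4 h5 hdε hO hN hρ
    rw [prob_not] at this
    linarith
  · obtain ⟨g1, g2, g3, g4⟩ := (Finset.mem_filter.mp hg).2
    obtain ⟨t, ht0, ht1, ht⟩ := hL2 g g1 ρ hρ
    rw [ht]
    have e1 := query_error_le hm0 hk0 hτ ht0 ht1 g (O := O) hρ
    have e2 : ‖deviation g O ρ‖ / (m * k ^ 2) ≤ 19 / 100 * ε * opNorm O := by
      rwa [div_le_iff₀ (by positivity)]
    have e3 : krausScale m k d / (m * k ^ 3) * ‖(crossSum g O).trace‖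
        ≤ 1 / 50 * ε * opNorm O := by
      calc _ ≤ krausScale m k d / (m * k ^ 3) *
            (1 / 50 * ε * opNorm O * (m * k ^ 3 / krausScale m k d)) := by gcongr
        _ = _ := by field_simp
    have e4 : krausScale m k d / (2 * (m * k ^ 2)) * (0.01 * ε * k / d * opNorm (query g O))
        ≤ 79 / 100 * (ε * opNorm O) := by
      refine le_trans ?_ (query_accuracy_le hε hN.le hk0 hm0 hd0 h4 h5)
      gcongr
    linarith

/-- The algorithm that uses no copies and always answers `0`. -/
def zeroAlgorithm (d : ℕ) : Algorithm d 0 where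
  Ω := Unit
  mΩ := inferInstance
  povm :=
    { μ := Measure.dirac ()
      sigmaFinite := inferInstance
      elem := fun _ => 1
      measurable_elem := fun _ _ => measurable_const
      posSemidef_elem := fun _ => Matrix.PosSemidef.one
      integrable_elem := fun _ _ => integrable_const _
      integral_elem := fun i j => by simp }
  estimate := fun _ _ => 0
  measurable_estimate := fun _ _ => measurable_const

lemma zeroAlgorithm_solves {d : ℕ} {ε : ℝ} (hε : 1 ≤ ε ∨ d = 0) {p : ℝ} (hp : p ≤ 1) :
    (zeroAlgorithm d).Solves ε p := by
  intro ρ hρ O hO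
  have h1 : ∀ z, |(O * ρ).trace.re - (zeroAlgorithm d).estimate O z| ≤ ε * opNorm O := by
    intro z
    change |_ - 0| ≤ _
    rw [sub_zero]
    rcases hε with hε | rfl
    · calc _ ≤ ‖(O * ρ).trace‖ := Complex.abs_re_le_norm _
        _ ≤ 1 * opNorm O := by rw [one_mul]; exact hρ.norm_trace_mul_le hO
        _ ≤ _ := mul_le_mul_of_nonneg_right hε (opNorm_nonneg O)
    · exact absurd hρ.2 (by simp [Matrix.trace])
  let _ := (zeroAlgorithm d).mΩ
  have := (zeroAlgorithm d).povm.isProbabilityMeasure_law (hρ.tensorPower (n := 0))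
  simp only [h1, Set.ofPred_true, measure_univ]
  exact ENNReal.ofReal_le_one.mpr hp

end Shadows

end

theorem mainTheorem3 :
    ∃ C : ℝ, 0 < C ∧
      ∀ (d k : ℕ) (ε : ℝ), 0 < ε → k ≤ d → 100 * Real.sqrt d / ε ≤ k →
        ∀ f : ℕ, (∃ A : Shadows.Algorithm k f, A.Solves (0.01 * ε * k / d) 0.9) →
          ∀ δ : ℝ, 0 < δ → δ ≤ 1 / 2 →
            ∃ n : ℕ, (n : ℝ) ≤ C * (f + 1 / ε ^ 2) * Real.log (1 / δ) ∧
              ∃ B : Shadows.Algorithm d n, B.Solves ε (1 - δ) := by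
  refine ⟨27, by norm_num, fun d k ε hε hkd hk f ⟨A, hA⟩ δ hδ hδ' => ?_⟩
  have hlog : 0 ≤ Real.log (1 / δ) := Real.log_nonneg (by rw [le_div_iff₀ hδ]; linarith)
  by_cases hcase : 1 ≤ ε ∨ d = 0
  · refine ⟨0, ?_, Shadows.zeroAlgorithm d, Shadows.zeroAlgorithm_solves hcase (by linarith)⟩
    rw [Nat.cast_zero]
    positivity
  push Not at hcase
  obtain ⟨hε1, hd⟩ := hcase
  have hdR : (0 : ℝ) < d := by exact_mod_cast Nat.pos_of_ne_zero hd
  have hkdR : (k : ℝ) ≤ d := by exact_mod_cast hkd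
  have hsq : Real.sqrt d ^ 2 = d := Real.sq_sqrt hdR.le
  have hsqrt : 0 < Real.sqrt d := Real.sqrt_pos.mpr hdR
  rw [div_le_iff₀ hε] at hk
  have hdε : 10000 * d ≤ ε ^ 2 * (k : ℝ) ^ 2 := by
    calc 10000 * (d : ℝ) = (100 * Real.sqrt d) ^ 2 := by rw [mul_pow, hsq]; norm_num
      _ ≤ (k * ε) ^ 2 := by gcongr
      _ = _ := by ring
  have hk0 : (0 : ℝ) < k := by
    by_contra! h
    nlinarith
  have hkbig : 10000 ≤ k := by
    have h1 : ε ^ 2 ≤ 1 := pow_le_one₀ hε.le hε1.le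
    have h2 : 10000 * (k : ℝ) ≤ k * k := by nlinarith [sq_nonneg (k : ℝ)]
    exact_mod_cast le_of_mul_le_mul_right h2 hk0
  obtain ⟨B, hB⟩ := Shadows.exists_algorithm_of_smaller_dim hε hε1.le hkbig hkd hdε A hA
  obtain ⟨N, hN, B', hB'⟩ := Shadows.exists_algorithm_boost B hB hδ hδ'
  refine ⟨N * f, ?_, B', hB'⟩
  rw [Nat.cast_mul]
  calc (N : ℝ) * f ≤ 27 * Real.log (1 / δ) * f := by gcongr
    _ = 27 * f * Real.log (1 / δ) := by ring
    _ ≤ 27 * (f + 1 / ε ^ 2) * Real.log (1 / δ) := by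
        gcongr
        have : 0 ≤ 1 / ε ^ 2 := by positivity
        linarith
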